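/- Let $G$ be a finite additive group of order $n$. An $(n,2,\ell;1)$-SEDF (strong external difference family) in $G$ is a pair $(A_0,A_1)$ of disjoint $\ell$-subsets of $G$ such that, for $i=0,1$, the multiset $\{y-x : y\in A_i,\ x\in A_{1-i}\}$ contains every element of $G\setminus\{0\}$ exactly once (and does not contain $0$). Two such pairs $(A_0,A_1)$, $(B_0,B_1)$ in $\mathbb{Z}_n$ are affine-equivalent if there are $\alpha\in\mathbb{Z}_n^*$, $\beta\in\mathbb{Z}_n$ with $B_i=\alpha A_i+\beta$ for $i=0,1$, or $B_i=\alpha A_{1-i}+\beta$ for $i=0,1$. An $\alpha$-valuation of a graph with $n$ edges is an injective labelling of the vertices by elements of $\{0,\dots,n\}$ for which the absolute differences of labels along the edges form exactly the set $\{1,\dots,n\}$, and for which there is $x\in\{0,\dots,n\}$ such that each edge has one end with label at most $x$ and one end with label greater than $x$. An $\alpha$-valuation of $K_{a,b}$ is identified with the pair $(V^{\rm small},V^{\rm large})$ of its sets of labels $\le x$ and $>x$; for $a=b$ it is regarded, modulo $a^2+1$, as a pair of subsets of $\mathbb{Z}_{a^2+1}$. For $\ell>1$, Blowup I multiplies all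 labels by $\ell$ and then replaces each small label $\ell i$ by $\ell i,\ell i+1,\dots,\ell i+\ell-1$; Blowup II multiplies all labels by $\ell$ and then replaces each large label $\ell i$ by $\ell i,\ell i-1,\dots,\ell i-(\ell-1)$. A blowup sequence $(\ell_1,\dots,\ell_k)$, with all $\ell_j>1$, is applied to the trivial $\alpha$-valuation $(\{0\},\{1\})$ of $K_{1,1}$, in the order Blowup II with $\ell_1$, Blowup I with $\ell_2$, Blowup II with $\ell_3$, and so on; $()$ is the empty sequence. A pair $(A,B)$ of subsets of $\mathbb{Z}_n$ is symmetric if $A=-A$ and $B=-B$; put $P_x=\{x,-x\}$, and let $\{P_x,\dots,P_z\}$ denote the union of the listed sets. A pair $(C,D)$ is in canonical form if $C$ is lexicographically least (elements being listed in increasing order as integers in $\{0,\dots,n-1\}$) among all images of $C$ and of $D$ under maps $X\mapsto\alpha X+\beta$ with $\alpha\in\mathbb{Z}_n^*$, $\beta\in\mathbb{Z}_n$. Consider the following table. Row $a.i$ lists: a pair of unions of sets $P_x$ in $\mathbb{Z}_{a^2+1}$; an affine mapping; a pair of sets of integers; a blowup sequence. - 1.1: $\{P_{0}\},\ \{P_{1}\}$;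 $X$; $\{0\},\ \{1\}$; $()$. - 2.1: $\{P_{1}\},\ \{P_{2}\}$; $2X+3$; $\{0,1\},\ \{2,4\}$; $(2,2)$. - 3.1: $\{P_{0},P_{1}\},\ \{P_{2},P_{5}\}$; $X+1$; $\{0,1,2\},\ \{3,6,9\}$; $(3,3)$. - 4.1: $\{P_{1},P_{3}\},\ \{P_{4},P_{5}\}$; $8X+10$; $\{0,1,2,3\},\ \{4,8,12,16\}$; $(4,4)$. - 4.2: $\{P_{1},P_{4}\},\ \{P_{2},P_{8}\}$; $6X+11$; $\{0,1,4,5\},\ \{6,8,14,16\}$; $(2,2,2,2)$. - 5.1: $\{P_{0},P_{1},P_{2}\},\ \{P_{3},P_{8},P_{13}\}$; $X+2$; $\{0,1,2,3,4\},\ \{5,10,15,20,25\}$; $(5,5)$. - 6.1: $\{P_{1},P_{3},P_{5}\},\ \{P_{6},P_{7},P_{18}\}$; $18X+21$; $\{0,1,2,3,4,5\},\ \{6,12,18,24,30,36\}$; $(6,6)$. - 6.2: $\{P_{1},P_{2},P_{17}\},\ \{P_{4},P_{10},P_{16}\}$; $2X+4$; $\{0,1,2,6,7,8\},\ \{9,12,21,24,33,36\}$;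 $(3,2,2,3)$. - 7.1: $\{P_{0},P_{1},P_{2},P_{3}\},\ \{P_{4},P_{11},P_{18},P_{25}\}$; $X+3$; $\{0,1,2,3,4,5,6\},\ \{7,14,21,28,35,42,49\}$; $(7,7)$. - 8.1: $\{P_{1},P_{3},P_{5},P_{7}\},\ \{P_{8},P_{9},P_{24},P_{25}\}$; $32X+36$; $\{0,1,2,3,4,5,6,7\},\ \{8,16,24,32,40,48,56,64\}$; $(8,8)$. - 8.2: $\{P_{1},P_{6},P_{8},P_{15}\},\ \{P_{5},P_{13},P_{23},P_{24}\}$; $28X+38$; $\{0,1,2,3,8,9,10,11\},\ \{12,16,28,32,44,48,60,64\}$; $(2,2,4,4)$. - 8.3: $\{P_{1},P_{4},P_{13},P_{16}\},\ \{P_{2},P_{8},P_{26},P_{32}\}$; $22X+43$; $\{0,1,4,5,16,17,20,21\},\ \{22,24,30,32,54,56,62,64\}$; $(2,2,2,2,2,2)$. - 9.1: $\{P_{0},P_{1},P_{2},P_{3},P_{4}\},\ \{P_{5},P_{14},P_{23},P_{32},P_{41}\}$; $X+4$; $\{0,1,2,3,4,5,6,7,8\},\ \{9,18,27,36,45,54,63,72,81\}$;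 $(9,9)$. - 9.2: $\{P_{0},P_{1},P_{8},P_{9},P_{10}\},\ \{P_{11},P_{14},P_{17},P_{38},P_{41}\}$; $X+10$; $\{0,1,2,9,10,11,18,19,20\},\ \{21,24,27,48,51,54,75,78,81\}$; $(3,3,3,3)$. - 10.1: $\{P_{1},P_{3},P_{5},P_{7},P_{9}\},\ \{P_{10},P_{11},P_{30},P_{31},P_{50}\}$; $50X+55$; $\{0,1,2,3,4,5,6,7,8,9\},\ \{10,20,30,40,50,60,70,80,90,100\}$; $(10,10)$. - 10.2: $\{P_{1},P_{2},P_{32},P_{35},P_{36}\},\ \{P_{11},P_{16},P_{31},P_{38},P_{43}\}$; $3X+7$; $\{0,1,2,3,4,10,11,12,13,14\},\ \{15,20,35,40,55,60,75,80,95,100\}$; $(5,2,2,5)$. - 11.1: $\{P_{0},P_{1},P_{2},P_{3},P_{4},P_{5}\},\ \{P_{6},P_{17},P_{28},P_{39},P_{50},P_{61}\}$; $X+5$; $\{0,1,2,3,4,5,6,7,8,9,10\},\ \{11,22,33,44,55,66,77,88,99,110,121\}$; $(11,11)$. - 12.1: $\{P_{1},P_{3},P_{5},P_{7},P_{9},P_{11}\},\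 \{P_{12},P_{13},P_{36},P_{37},P_{60},P_{61}\}$; $72X+78$; $\{0,1,2,3,4,5,6,7,8,9,10,11\},\ \{12,24,36,48,60,72,84,96,108,120,132,144\}$; $(12,12)$. - 12.2: $\{P_{8},P_{22},P_{31},P_{45},P_{54},P_{68}\},\ \{P_{1},P_{6},P_{27},P_{34},P_{55},P_{62}\}$; $63X+81$; $\{0,1,2,3,4,5,12,13,14,15,16,17\},\ \{18,24,42,48,66,72,90,96,114,120,138,144\}$; $(6,2,2,6)$. - 12.3: $\{P_{7},P_{19},P_{31},P_{43},P_{55},P_{67}\},\ \{P_{1},P_{2},P_{4},P_{5},P_{68},P_{71}\}$; $12X+84$; $\{0,1,2,3,4,5,18,19,20,21,22,23\},\ \{24,30,36,60,66,72,96,102,108,132,138,144\}$; $(4,2,3,6)$. - 12.4: $\{P_{20},P_{21},P_{28},P_{29},P_{68},P_{69}\},\ \{P_{1},P_{3},P_{13},P_{15},P_{17},P_{19}\}$; $3X+87$; $\{0,1,2,3,4,5,24,25,26,27,28,29\},\ \{30,36,42,48,78,84,90,96,126,132,138,144\}$; $(3,2,4,6)$. - 12.5: $\{P_{1},P_{3},P_{21},P_{23},P_{25},P_{27}\},\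 \{P_{28},P_{29},P_{36},P_{37},P_{44},P_{45}\}$; $72X+86$; $\{0,1,2,3,12,13,14,15,24,25,26,27\},\ \{28,32,36,64,68,72,100,104,108,136,140,144\}$; $(4,3,3,4)$. - 12.6: $\{P_{1},P_{2},P_{17},P_{20},P_{35},P_{38}\},\ \{P_{4},P_{10},P_{16},P_{58},P_{64},P_{70}\}$; $8X+16$; $\{0,1,2,6,7,8,24,25,26,30,31,32\},\ \{33,36,45,48,81,84,93,96,129,132,141,144\}$; $(3,2,2,2,2,3)$. - 12.7: $\{P_{1},P_{10},P_{19},P_{35},P_{44},P_{53}\},\ \{P_{12},P_{15},P_{25},P_{52},P_{56},P_{62}\}$; $16X+22$; $\{0,1,2,6,7,8,36,37,38,42,43,44\},\ \{45,48,57,60,69,72,117,120,129,132,141,144\}$; $(2,2,3,2,2,3)$. - 13.1: $\{P_{0},P_{1},P_{2},P_{3},P_{4},P_{5},P_{6}\},\ \{P_{7},P_{20},P_{33},P_{46},P_{59},P_{72},P_{85}\}$; $X+6$; $\{0,1,2,3,4,5,6,7,8,9,10,11,12\},\ \{13,26,39,52,65,78,91,104,117,130,143,156,169\}$; $(13,13)$.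 - 14.1: $\{P_{1},P_{3},P_{5},P_{7},P_{9},P_{11},P_{13}\},\ \{P_{14},P_{15},P_{42},P_{43},P_{70},P_{71},P_{98}\}$; $98X+105$; $\{0,1,2,3,4,5,6,7,8,9,10,11,12,13\},\ \{14,28,42,56,70,84,98,112,126,140,154,168,182,196\}$; $(14,14)$. - 14.2: $\{P_{1},P_{2},P_{38},P_{41},P_{77},P_{78},P_{80}\},\ \{P_{19},P_{26},P_{43},P_{64},P_{71},P_{81},P_{88}\}$; $5X+10$; $\{0,1,2,3,4,5,6,14,15,16,17,18,19,20\},\ \{21,28,49,56,77,84,105,112,133,140,161,168,189,196\}$; $(7,2,2,7)$. Let $1\le a\le 14$. Then the following hold. 1. For each row $a.i$, the first pair is a symmetric $(a^2+1,2,a;1)$-SEDF in $\mathbb{Z}_{a^2+1}$; the mapping has the form $X\mapsto\alpha X+\beta$ with $\alpha\in\mathbb{Z}_{a^2+1}^*$ and takes the two sets of the first pair, in order, to the two sets of the second pair modulo $a^2+1$; the second pair is an $(a^2+1,2,a;1)$-SEDF in canonical form, and as a pair of sets of integers it is an $\alpha$-valuation of $K_{a,a}$. The blowup sequence of the row has all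 entries greater than $1$ and yields an $\alpha$-valuation of $K_{a,a}$ that is affine-equivalent to the SEDF of the row. 2. SEDFs in different rows $a.i$, $a.j$ are not affine-equivalent. 3. Every $(a^2+1,2,a;1)$-SEDF in $\mathbb{Z}_{a^2+1}$ is affine-equivalent to the SEDF of some row $a.i$, and to the $\alpha$-valuation obtained from the blowup sequence of that row. In particular, every such SEDF is affine-equivalent to an $\alpha$-valuation of $K_{a,a}$. -/

import Mathlib

open Finset

/-- The multiset `D(B, A)` of all differences `y - x` with `y ∈ B`, `x ∈ A`. -/
def differences {G : Type*} [AddGroup G] (B A : Finset G) : Multiset G :=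
  (B ×ˢ A).val.map fun p => p.1 - p.2

/-- An `(n, m, ℓ; lam)`-strong external difference family in a finite additive group `G`. -/
structure IsSEDF {G : Type*} [AddGroup G] [Fintype G] [DecidableEq G] (n m ℓ lam : ℕ)
    (A : Fin m → Finset G) : Prop where
  card_group : Fintype.card G = n
  two_le : 2 ≤ m
  card_eq : ∀ i, (A i).card = ℓ
  disjoint : ∀ i j, i ≠ j → Disjoint (A i) (A j)
  differences_eq : ∀ i,
    ∑ j ∈ univ.erase i, differences (A i) (A j) = lam • (univ.erase (0 : G)).val

/-- The image of `X ⊆ ℤ/n` under `x ↦ α x + β`. -/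
def affineImage {n : ℕ} (α β : ZMod n) (X : Finset (ZMod n)) : Finset (ZMod n) :=
  X.image fun x => α * x + β

/-- Affine equivalence of pairs of subsets of `ℤ/n`, allowing the two sets to be switched. -/
def AffineEquivalent {n : ℕ} (A B : Fin 2 → Finset (ZMod n)) : Prop :=
  ∃ (α : (ZMod n)ˣ) (β : ZMod n),
    (∀ i, B i = affineImage (α : ZMod n) β (A i)) ∨
    (∀ i, B i = affineImage (α : ZMod n) β (A (1 - i)))

/-- A β-valuation (graceful labelling) of a finite graph. -/
structure IsBetaValuation {V : Type*} [Finite V] (G : SimpleGraph V) (f : V → ℕ) : Prop where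
  injective : Function.Injective f
  le_edges : ∀ v, f v ≤ G.edgeSet.ncard
  edge_labels : {d : ℕ | ∃ u v, G.Adj u v ∧ d = ((f u : ℤ) - (f v : ℤ)).natAbs}
    = Set.Icc 1 G.edgeSet.ncard

/-- An α-valuation of a finite graph, with separating value `x`. -/
structure IsAlphaValuation {V : Type*} [Finite V] (G : SimpleGraph V) (f : V → ℕ) (x : ℕ) :
    Prop where
  beta : IsBetaValuation G f
  le_edges : x ≤ G.edgeSet.ncard
  separates : ∀ u v, G.Adj u v → (f u ≤ x ∧ x < f v) ∨ (f v ≤ x ∧ x < f u)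

/-- `p = (V^small, V^large)` is the pair of label sets of some α-valuation of `K_{a,b}`. -/
def IsAlphaPair (a b : ℕ) (p : Finset ℕ × Finset ℕ) : Prop :=
  ∃ (f : Fin a ⊕ Fin b → ℕ) (x : ℕ),
    IsAlphaValuation (completeBipartiteGraph (Fin a) (Fin b)) f x ∧
    (p.1 : Set ℕ) = {k | k ∈ Set.range f ∧ k ≤ x} ∧
    (p.2 : Set ℕ) = {k | k ∈ Set.range f ∧ x < k}

/-- Blowup I: multiply all labels by `ℓ`, then replace each small label `ℓ i` by
`ℓ i, ℓ i + 1, …, ℓ i + (ℓ - 1)`. -/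
def blowupI (ℓ : ℕ) (p : Finset ℕ × Finset ℕ) : Finset ℕ × Finset ℕ :=
  (p.1.biUnion fun i => (range ℓ).image fun j => ℓ * i + j, p.2.image fun i => ℓ * i)

/-- Blowup II: multiply all labels by `ℓ`, then replace each large label `ℓ i` by
`ℓ i, ℓ i - 1, …, ℓ i - (ℓ - 1)` (large labels are positive). -/
def blowupII (ℓ : ℕ) (p : Finset ℕ × Finset ℕ) : Finset ℕ × Finset ℕ :=
  (p.1.image fun i => ℓ * i, p.2.biUnion fun i => (range ℓ).image fun j => ℓ * i - j)

/-- Apply blowups with the given values of `ℓ`, in the order II, I, II, I, … -/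
def blowupSequence : List ℕ → Finset ℕ × Finset ℕ → Finset ℕ × Finset ℕ
  | [], p => p
  | [ℓ], p => blowupII ℓ p
  | ℓ :: ℓ' :: ls, p => blowupSequence ls (blowupI ℓ' (blowupII ℓ p))

/-- The result of a blowup sequence started at the trivial α-valuation `({0}, {1})` of `K_{1,1}`. -/
def blowupResult (ls : List ℕ) : Finset ℕ × Finset ℕ := blowupSequence ls ({0}, {1})

/-- A pair of sets of integers, reduced modulo `n`. -/
def reduceMod (n : ℕ) (p : Finset ℕ × Finset ℕ) : Fin 2 → Finset (ZMod n) :=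
  ![p.1.image (Nat.cast : ℕ → ZMod n), p.2.image (Nat.cast : ℕ → ZMod n)]

/-- The elements of `X ⊆ ℤ/n` as an increasing list of residues in `{0, …, n - 1}`;
lists of natural numbers are ordered lexicographically. -/
def residueList {n : ℕ} (X : Finset (ZMod n)) : List ℕ := (X.image ZMod.val).sort

/-- `C 0` is lexicographically least among all affine images of `C 0` and of `C 1`. -/
def IsCanonical {n : ℕ} (C : Fin 2 → Finset (ZMod n)) : Prop :=
  ∀ (i : Fin 2) (α : (ZMod n)ˣ) (β : ZMod n),
    residueList (C 0) ≤ residueList (affineImage (α : ZMod n) β (C i))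

/-- The set `P_x = {x, -x}` in `ℤ/n`. -/
def orbitP (n x : ℕ) : Finset (ZMod n) := {(x : ZMod n), -(x : ZMod n)}

/-- A row of the table: the indices `x` of the sets `P_x` making up the two sets of a symmetric
representation, the mapping `X ↦ scale * X + shift`, the two sets of the canonical
representation, and a blowup sequence. -/
structure TableRow where
  symFirst : List ℕ
  symSecond : List ℕ
  scale : ℕ
  shift : ℕ
  canonFirst : List ℕ
  canonSecond : List ℕ
  blowups : List ℕ

/-- The symmetric representation of a row, as a pair of subsets of `ℤ/n`. -/
def TableRow.symmetricPair (r : TableRow) (n : ℕ) : Fin 2 → Finset (ZMod n) :=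
  ![r.symFirst.toFinset.biUnion (orbitP n), r.symSecond.toFinset.biUnion (orbitP n)]

/-- The canonical representation of a row, as a pair of sets of integers. -/
def TableRow.canonicalSets (r : TableRow) : Finset ℕ × Finset ℕ :=
  (r.canonFirst.toFinset, r.canonSecond.toFinset)

/-- The canonical representation of a row, as a pair of subsets of `ℤ/n`. -/
def TableRow.canonicalPair (r : TableRow) (n : ℕ) : Fin 2 → Finset (ZMod n) :=
  reduceMod n r.canonicalSets

/-- The table: the `i`-th entry of `sedfTable a` is solution `a.i`. -/
def sedfTable : ℕ → List TableRow
  | 1 => [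
    { symFirst := [0], symSecond := [1], scale := 1, shift := 0,
      canonFirst := [0],
      canonSecond := [1],
      blowups := [] }]
  | 2 => [
    { symFirst := [1], symSecond := [2], scale := 2, shift := 3,
      canonFirst := [0, 1],
      canonSecond := [2, 4],
      blowups := [2, 2] }]
  | 3 => [
    { symFirst := [0, 1], symSecond := [2, 5], scale := 1, shift := 1,
      canonFirst := [0, 1, 2],
      canonSecond := [3, 6, 9],
      blowups := [3, 3] }]
  | 4 => [
    { symFirst := [1, 3], symSecond := [4, 5], scale := 8, shift := 10,
      canonFirst := [0, 1, 2, 3],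
      canonSecond := [4, 8, 12, 16],
      blowups := [4, 4] },
    { symFirst := [1, 4], symSecond := [2, 8], scale := 6, shift := 11,
      canonFirst := [0, 1, 4, 5],
      canonSecond := [6, 8, 14, 16],
      blowups := [2, 2, 2, 2] }]
  | 5 => [
    { symFirst := [0, 1, 2], symSecond := [3, 8, 13], scale := 1, shift := 2,
      canonFirst := [0, 1, 2, 3, 4],
      canonSecond := [5, 10, 15, 20, 25],
      blowups := [5, 5] }]
  | 6 => [
    { symFirst := [1, 3, 5], symSecond := [6, 7, 18], scale := 18, shift := 21,
      canonFirst := [0, 1, 2, 3, 4, 5],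
      canonSecond := [6, 12, 18, 24, 30, 36],
      blowups := [6, 6] },
    { symFirst := [1, 2, 17], symSecond := [4, 10, 16], scale := 2, shift := 4,
      canonFirst := [0, 1, 2, 6, 7, 8],
      canonSecond := [9, 12, 21, 24, 33, 36],
      blowups := [3, 2, 2, 3] }]
  | 7 => [
    { symFirst := [0, 1, 2, 3], symSecond := [4, 11, 18, 25], scale := 1, shift := 3,
      canonFirst := [0, 1, 2, 3, 4, 5, 6],
      canonSecond := [7, 14, 21, 28, 35, 42, 49],
      blowups := [7, 7] }]
  | 8 => [
    { symFirst := [1, 3, 5, 7], symSecond := [8, 9, 24, 25], scale := 32, shift := 36,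
      canonFirst := [0, 1, 2, 3, 4, 5, 6, 7],
      canonSecond := [8, 16, 24, 32, 40, 48, 56, 64],
      blowups := [8, 8] },
    { symFirst := [1, 6, 8, 15], symSecond := [5, 13, 23, 24], scale := 28, shift := 38,
      canonFirst := [0, 1, 2, 3, 8, 9, 10, 11],
      canonSecond := [12, 16, 28, 32, 44, 48, 60, 64],
      blowups := [2, 2, 4, 4] },
    { symFirst := [1, 4, 13, 16], symSecond := [2, 8, 26, 32], scale := 22, shift := 43,
      canonFirst := [0, 1, 4, 5, 16, 17, 20, 21],
      canonSecond := [22, 24, 30, 32, 54, 56, 62, 64],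
      blowups := [2, 2, 2, 2, 2, 2] }]
  | 9 => [
    { symFirst := [0, 1, 2, 3, 4], symSecond := [5, 14, 23, 32, 41], scale := 1, shift := 4,
      canonFirst := [0, 1, 2, 3, 4, 5, 6, 7, 8],
      canonSecond := [9, 18, 27, 36, 45, 54, 63, 72, 81],
      blowups := [9, 9] },
    { symFirst := [0, 1, 8, 9, 10], symSecond := [11, 14, 17, 38, 41], scale := 1, shift := 10,
      canonFirst := [0, 1, 2, 9, 10, 11, 18, 19, 20],
      canonSecond := [21, 24, 27, 48, 51, 54, 75, 78, 81],
      blowups := [3, 3, 3, 3] }]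
  | 10 => [
    { symFirst := [1, 3, 5, 7, 9], symSecond := [10, 11, 30, 31, 50], scale := 50, shift := 55,
      canonFirst := [0, 1, 2, 3, 4, 5, 6, 7, 8, 9],
      canonSecond := [10, 20, 30, 40, 50, 60, 70, 80, 90, 100],
      blowups := [10, 10] },
    { symFirst := [1, 2, 32, 35, 36], symSecond := [11, 16, 31, 38, 43], scale := 3, shift := 7,
      canonFirst := [0, 1, 2, 3, 4, 10, 11, 12, 13, 14],
      canonSecond := [15, 20, 35, 40, 55, 60, 75, 80, 95, 100],
      blowups := [5, 2, 2, 5] }]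
  | 11 => [
    { symFirst := [0, 1, 2, 3, 4, 5], symSecond := [6, 17, 28, 39, 50, 61], scale := 1, shift := 5,
      canonFirst := [0, 1, 2, 3, 4, 5, 6, 7, 8, 9, 10],
      canonSecond := [11, 22, 33, 44, 55, 66, 77, 88, 99, 110, 121],
      blowups := [11, 11] }]
  | 12 => [
    { symFirst := [1, 3, 5, 7, 9, 11], symSecond := [12, 13, 36, 37, 60, 61], scale := 72, shift := 78,
      canonFirst := [0, 1, 2, 3, 4, 5, 6, 7, 8, 9, 10, 11],
      canonSecond := [12, 24, 36, 48, 60, 72, 84, 96, 108, 120, 132, 144],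
      blowups := [12, 12] },
    { symFirst := [8, 22, 31, 45, 54, 68], symSecond := [1, 6, 27, 34, 55, 62], scale := 63, shift := 81,
      canonFirst := [0, 1, 2, 3, 4, 5, 12, 13, 14, 15, 16, 17],
      canonSecond := [18, 24, 42, 48, 66, 72, 90, 96, 114, 120, 138, 144],
      blowups := [6, 2, 2, 6] },
    { symFirst := [7, 19, 31, 43, 55, 67], symSecond := [1, 2, 4, 5, 68, 71], scale := 12, shift := 84,
      canonFirst := [0, 1, 2, 3, 4, 5, 18, 19, 20, 21, 22, 23],
      canonSecond := [24, 30, 36, 60, 66, 72, 96, 102, 108, 132, 138, 144],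
      blowups := [4, 2, 3, 6] },
    { symFirst := [20, 21, 28, 29, 68, 69], symSecond := [1, 3, 13, 15, 17, 19], scale := 3, shift := 87,
      canonFirst := [0, 1, 2, 3, 4, 5, 24, 25, 26, 27, 28, 29],
      canonSecond := [30, 36, 42, 48, 78, 84, 90, 96, 126, 132, 138, 144],
      blowups := [3, 2, 4, 6] },
    { symFirst := [1, 3, 21, 23, 25, 27], symSecond := [28, 29, 36, 37, 44, 45], scale := 72, shift := 86,
      canonFirst := [0, 1, 2, 3, 12, 13, 14, 15, 24, 25, 26, 27],
      canonSecond := [28, 32, 36, 64, 68, 72, 100, 104, 108, 136, 140, 144],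
      blowups := [4, 3, 3, 4] },
    { symFirst := [1, 2, 17, 20, 35, 38], symSecond := [4, 10, 16, 58, 64, 70], scale := 8, shift := 16,
      canonFirst := [0, 1, 2, 6, 7, 8, 24, 25, 26, 30, 31, 32],
      canonSecond := [33, 36, 45, 48, 81, 84, 93, 96, 129, 132, 141, 144],
      blowups := [3, 2, 2, 2, 2, 3] },
    { symFirst := [1, 10, 19, 35, 44, 53], symSecond := [12, 15, 25, 52, 56, 62], scale := 16, shift := 22,
      canonFirst := [0, 1, 2, 6, 7, 8, 36, 37, 38, 42, 43, 44],
      canonSecond := [45, 48, 57, 60, 69, 72, 117, 120, 129, 132, 141, 144],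
      blowups := [2, 2, 3, 2, 2, 3] }]
  | 13 => [
    { symFirst := [0, 1, 2, 3, 4, 5, 6], symSecond := [7, 20, 33, 46, 59, 72, 85], scale := 1, shift := 6,
      canonFirst := [0, 1, 2, 3, 4, 5, 6, 7, 8, 9, 10, 11, 12],
      canonSecond := [13, 26, 39, 52, 65, 78, 91, 104, 117, 130, 143, 156, 169],
      blowups := [13, 13] }]
  | 14 => [
    { symFirst := [1, 3, 5, 7, 9, 11, 13], symSecond := [14, 15, 42, 43, 70, 71, 98], scale := 98, shift := 105,
      canonFirst := [0, 1, 2, 3, 4, 5, 6, 7, 8, 9, 10, 11, 12, 13],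
      canonSecond := [14, 28, 42, 56, 70, 84, 98, 112, 126, 140, 154, 168, 182, 196],
      blowups := [14, 14] },
    { symFirst := [1, 2, 38, 41, 77, 78, 80], symSecond := [19, 26, 43, 64, 71, 81, 88], scale := 5, shift := 10,
      canonFirst := [0, 1, 2, 3, 4, 5, 6, 14, 15, 16, 17, 18, 19, 20],
      canonSecond := [21, 28, 49, 56, 77, 84, 105, 112, 133, 140, 161, 168, 189, 196],
      blowups := [7, 2, 2, 7] }]
  | _ => []

/-! ### Base-256 encodings of functions on `ℤ/n` -/

/-! Write n = a² + 1. In an SEDF the a² differences x - y with x in A₀ and y in A₁ are the nonzero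
residues, once each. The sums x + y are then distinct as well, since x + y = x' + y' means x - y' =
x' - y, so they miss exactly one residue c. In the group ring, -A₁ and A₁ - c are both complementary
to A₀, with product G - 1, and a complementary factor of given size is unique (`factor_unique`).
Hence A₁ = c - A₁, and likewise A₀ = c - A₀ (`IsSEDF.sub_mem`). Moreover c = 2d for some d: for n
odd, 2 is invertible; for a odd, x ↦ c - x has a fixed point on A₀. Translation by -d gives a
symmetric near-factorization: X = -X, Y = -Y, every nonzero residue is x + y in exactly one way, and
0 in none (`IsSEDF.exists_nearFactorization`).

These pairs are classified, up to units and interchange of the factors, by an exhaustive search that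
the kernel evaluates. A subset of ℤ/n is a natural number with digits 0 and 1 in base 256.
Multiplication modulo 256^n - 1 is cyclic convolution (`enc_mul`), so one product yields all sums of
two sets, and bit operations give supports and intersections. A search state consists of known parts
A ⊆ X, B ⊆ Y and of candidates for the remaining elements. Each round discards candidates
(`prune_sound`), closes the branch on a contradiction, and otherwise picks a residue g that is not
yet a sum and branches over the possible x in g = x + y (`opts_sound`). `search_sound` says that if
the search returns `true`, then (X, Y) passes the test made at the leaves, namely containing a unit
multiple of a listed pair. Equal cardinalities turn this into affine equivalence.

Counting keeps the search short. Swapping two summands shows that, for n odd, an element of X is 2y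
+ b with y in X and b in Y for exactly one y (`doubleUnique_left`); this yields further pruning
rules. Rotating three summands shows that x in X and 3x in Y occurs if |X| ≡ 2 modulo 3
(`exists_three_mul`). A unit can move a chosen element to a divisor of n. For n = 145 and n = 170
the distribution over classes modulo 5 and 10 is determined first (`sum_classCard`).

On the side of the table, an α-valuation of K_{a,a} is an SEDF modulo n because its a² differences
are 1, …, a². Canonical form is tested by comparing the binary numbers of indicator functions, and
inequivalence of rows follows because equivalent canonical pairs have the same first set. -/

/-- The natural number with base-256 digits `f x`. -/
def enc {n : ℕ} [NeZero n] (f : ZMod n → ℕ) : ℕ := ∑ x, f x * 256 ^ x.val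

theorem sum_digits_lt (F : ℕ → ℕ) (hF : ∀ i, F i < 256) (m : ℕ) :
    ∑ i ∈ range m, F i * 256 ^ i < 256 ^ m := by
  induction m with
  | zero => simp
  | succ m ih =>
    rw [sum_range_succ, pow_succ]
    have := hF m
    nlinarith [show 0 < 256 ^ m by positivity]

/-- Digits below 256 occupy disjoint blocks of eight bits, so there are no carries and each digit
can be read by itself. -/
theorem sum_digits_testBit (F : ℕ → ℕ) (hF : ∀ i, F i < 256) (m i j : ℕ) (hj : j < 8) :
    (∑ i ∈ range m, F i * 256 ^ i).testBit (8 * i + j) = (decide (i < m) && (F i).testBit j) := by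
  induction m with
  | zero => simp
  | succ m ih =>
    have hlt := sum_digits_lt F hF m
    have h256 : (256 : ℕ) ^ m = 2 ^ (8 * m) := by rw [pow_mul]; norm_num
    rw [sum_range_succ, add_comm, mul_comm (F m), h256,
      Nat.testBit_two_pow_mul_add _ (by rw [← h256]; exact hlt), ih]
    rcases lt_trichotomy i m with h | h | h
    · rw [if_pos (by omega)]; simp [h, Nat.lt_succ_of_lt h]
    · subst h; rw [if_neg (by omega)]; simp
    · rw [if_neg (by omega)]
      have : (F m).testBit (8 * i + j - 8 * m) = false := by
        apply Nat.testBit_lt_two_pow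
        calc F m < 256 := hF m
          _ = 2 ^ 8 := by norm_num
          _ ≤ _ := Nat.pow_le_pow_right (by norm_num) (by omega)
      rw [this]; simp; omega

section
variable {n : ℕ} [NeZero n]

theorem sum_zmod_eq_range (F : ZMod n → ℕ → ℕ) :
    ∑ x : ZMod n, F x x.val = ∑ i ∈ range n, F (i : ZMod n) i := by
  refine sum_bij' (fun x _ => x.val) (fun i _ => (i : ZMod n)) ?_ ?_ ?_ ?_ ?_
  · intro x _; exact mem_range.2 (ZMod.val_lt x)
  · intros; exact mem_univ _
  · intro x _; exact ZMod.natCast_zmod_val x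
  · intro i hi; exact ZMod.val_natCast_of_lt (mem_range.1 hi)
  · intro x _; rw [ZMod.natCast_zmod_val]

theorem enc_eq_range (f : ZMod n → ℕ) : enc f = ∑ i ∈ range n, f (i : ZMod n) * 256 ^ i :=
  sum_zmod_eq_range fun x i => f x * 256 ^ i

theorem enc_testBit_nat {f : ZMod n → ℕ} (hf : ∀ x, f x < 256) (i j : ℕ) (hj : j < 8) :
    (enc f).testBit (8 * i + j) = (decide (i < n) && (f (i : ZMod n)).testBit j) := by
  rw [enc_eq_range, sum_digits_testBit (fun i => f i) (fun i => hf _) n i j hj]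

theorem enc_testBit {f : ZMod n → ℕ} (hf : ∀ x, f x < 256) (x : ZMod n) (j : ℕ) (hj : j < 8) :
    (enc f).testBit (8 * x.val + j) = (f x).testBit j := by
  rw [enc_testBit_nat hf _ _ hj, ZMod.natCast_zmod_val]; simp [ZMod.val_lt]

theorem eq_of_testBit_digits {a b : ℕ}
    (h : ∀ i j, j < 8 → a.testBit (8 * i + j) = b.testBit (8 * i + j)) : a = b := by
  apply Nat.eq_of_testBit_eq
  intro k
  have := h (k / 8) (k % 8) (Nat.mod_lt _ (by norm_num))
  rwa [Nat.div_add_mod] at this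

theorem enc_add (f g : ZMod n → ℕ) : enc f + enc g = enc fun x => f x + g x := by
  simp only [enc, ← sum_add_distrib, add_mul]

theorem enc_smul (c : ℕ) (f : ZMod n → ℕ) : c * enc f = enc fun x => c * f x := by
  simp only [enc, mul_sum, mul_assoc]

theorem enc_const_mul (c : ℕ) : enc (n := n) (fun _ => c) = c * enc (n := n) (fun _ => 1) := by
  rw [enc_smul]; simp

theorem enc_land {f g : ZMod n → ℕ} (hf : ∀ x, f x < 256) (hg : ∀ x, g x < 256) :
    enc f &&& enc g = enc fun x => f x &&& g x := by
  apply eq_of_testBit_digits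
  intro i j hj
  rw [Nat.testBit_land, enc_testBit_nat hf _ _ hj, enc_testBit_nat hg _ _ hj,
    enc_testBit_nat (fun x => lt_of_le_of_lt Nat.and_le_left (hf x)) _ _ hj, Nat.testBit_land]
  cases decide (i < n) <;> simp

theorem enc_lor {f g : ZMod n → ℕ} (hf : ∀ x, f x < 256) (hg : ∀ x, g x < 256) :
    enc f ||| enc g = enc fun x => f x ||| g x := by
  apply eq_of_testBit_digits
  intro i j hj
  rw [Nat.testBit_lor, enc_testBit_nat hf _ _ hj, enc_testBit_nat hg _ _ hj,
    enc_testBit_nat (fun x => Nat.or_lt_two_pow (n := 8) (hf x) (hg x)) _ _ hj, Nat.testBit_lor]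
  cases decide (i < n) <;> simp

theorem enc_xor {f g : ZMod n → ℕ} (hf : ∀ x, f x < 256) (hg : ∀ x, g x < 256) :
    enc f ^^^ enc g = enc fun x => f x ^^^ g x := by
  apply eq_of_testBit_digits
  intro i j hj
  rw [Nat.testBit_xor, enc_testBit_nat hf _ _ hj, enc_testBit_nat hg _ _ hj,
    enc_testBit_nat (fun x => Nat.xor_lt_two_pow (n := 8) (hf x) (hg x)) _ _ hj, Nat.testBit_xor]
  cases decide (i < n) <;> simp

theorem enc_injective {f g : ZMod n → ℕ} (hf : ∀ x, f x < 256) (hg : ∀ x, g x < 256)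
    (h : enc f = enc g) : f = g := by
  funext x
  apply Nat.eq_of_testBit_eq
  intro j
  by_cases hj : j < 8
  · rw [← enc_testBit hf x j hj, h, enc_testBit hg x j hj]
  · have key : ∀ y, y < 256 → y.testBit j = false := fun y hy =>
      Nat.testBit_lt_two_pow (lt_of_lt_of_le (show y < 2 ^ 8 from hy)
        (Nat.pow_le_pow_right (by norm_num) (by omega)))
    rw [key _ (hf x), key _ (hg x)]

/-- The modulus of the cyclic convolution. -/
def modulus (n : ℕ) : ℕ := 256 ^ n - 1

theorem modulus_eq : modulus n = enc (n := n) fun _ => 255 := by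
  rw [enc_eq_range]
  show 256 ^ n - 1 = _
  induction n with
  | zero => simp
  | succ m ih =>
    rcases Nat.eq_zero_or_pos m with rfl | hm
    · simp
    · have : NeZero m := ⟨hm.ne'⟩
      have := ih
      rw [sum_range_succ, ← this, pow_succ]
      have : 0 < 256 ^ m := by positivity
      omega

theorem enc_mono {f g : ZMod n → ℕ} (h : ∀ x, f x ≤ g x) : enc f ≤ enc g :=
  sum_le_sum fun x _ => Nat.mul_le_mul_right _ (h x)

/-- The modulus is the numeral all of whose digits are 255. Digits of at most 254 stay strictly
below it, so a residue modulo it determines them. -/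
theorem enc_lt_modulus {f : ZMod n → ℕ} (hf : ∀ x, f x ≤ 254) : enc f < modulus n := by
  rw [modulus_eq]
  apply sum_lt_sum_of_nonempty ⟨0, mem_univ _⟩
  intro x _
  exact Nat.mul_lt_mul_of_pos_right (by have := hf x; show f x < 255; omega) (by positivity)

theorem pow_modEq (k : ℕ) : 256 ^ k ≡ 256 ^ (k % n) [MOD modulus n] := by
  have h1 : 256 ^ n ≡ 1 [MOD modulus n] := by
    have : 256 ^ n = 1 + modulus n * 1 := by
      have : 0 < 256 ^ n := by positivity
      unfold modulus; omega
    rw [this]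
    exact (Nat.modEq_iff_dvd' (by omega)).2 (by simp) |>.symm
  conv_lhs => rw [← Nat.div_add_mod k n, pow_add, pow_mul]
  simpa using (h1.pow (k / n)).mul_right (256 ^ (k % n))

/-- Cyclic convolution. -/
def conv (f g : ZMod n → ℕ) (z : ZMod n) : ℕ := ∑ x, f x * g (z - x)

/-- Since 256^n ≡ 1, exponents of 256 add modulo n. Multiplication modulo 256^n - 1 is therefore
multiplication in the group ring of ℤ/n, as long as the digits do not overflow. -/
theorem enc_mul (f g : ZMod n → ℕ) : enc f * enc g ≡ enc (conv f g) [MOD modulus n] := by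
  have h1 : enc f * enc g = ∑ x : ZMod n, ∑ y : ZMod n, f x * g y * 256 ^ (x.val + y.val) := by
    simp only [enc, sum_mul_sum, pow_add]
    exact sum_congr rfl fun x _ => sum_congr rfl fun y _ => by ring
  have h2 : enc (conv f g) = ∑ x : ZMod n, ∑ y : ZMod n, f x * g y * 256 ^ ((x + y).val) := by
    simp only [enc, conv, sum_mul]
    rw [sum_comm]
    refine sum_congr rfl fun x _ => ?_
    exact (Fintype.sum_equiv (Equiv.addLeft x) _ _ (fun y => by simp)).symm
  rw [h1, h2]
  refine Nat.ModEq.sum fun x _ => Nat.ModEq.sum fun y _ => ?_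
  rw [ZMod.val_add]
  exact (pow_modEq _).mul_left _

theorem mod_eq_enc {v : ℕ} {f : ZMod n → ℕ} (hf : ∀ x, f x ≤ 254)
    (h : v ≡ enc f [MOD modulus n]) : v % modulus n = enc f := by
  rw [h, Nat.mod_eq_of_lt (enc_lt_modulus hf)]

/-- The encoding of a finite set. -/
def encS (S : Finset (ZMod n)) : ℕ := enc fun x => if x ∈ S then 1 else 0

theorem encS_inj {S T : Finset (ZMod n)} (h : encS S = encS T) : S = T := by
  have := enc_injective (fun x => by split_ifs <;> norm_num) (fun x => by split_ifs <;> norm_num) h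
  ext x
  have := congrFun this x
  by_cases h1 : x ∈ S <;> by_cases h2 : x ∈ T <;> simp_all

theorem ind_lt (S : Finset (ZMod n)) (x : ZMod n) : (if x ∈ S then 1 else 0) < 256 := by
  split_ifs <;> norm_num

theorem encS_land (S T : Finset (ZMod n)) : encS S &&& encS T = encS (S ∩ T) := by
  rw [encS, encS, enc_land (ind_lt S) (ind_lt T), encS]
  congr 1; funext x
  by_cases h1 : x ∈ S <;> by_cases h2 : x ∈ T <;> simp [h1, h2]

theorem encS_lor (S T : Finset (ZMod n)) : encS S ||| encS T = encS (S ∪ T) := by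
  rw [encS, encS, enc_lor (ind_lt S) (ind_lt T), encS]
  congr 1; funext x
  by_cases h1 : x ∈ S <;> by_cases h2 : x ∈ T <;> simp [h1, h2]

theorem encS_xor_land (S T : Finset (ZMod n)) : encS S ^^^ (encS S &&& encS T) = encS (S \ T) := by
  rw [encS_land, encS, encS, enc_xor (ind_lt S) (ind_lt _), encS]
  congr 1; funext x
  by_cases h1 : x ∈ S <;> by_cases h2 : x ∈ T <;> simp [h1, h2]

theorem encS_add {S T : Finset (ZMod n)} (h : Disjoint S T) : encS S + encS T = encS (S ∪ T) := by
  rw [encS, encS, enc_add, encS]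
  congr 1; funext x
  by_cases h1 : x ∈ S
  · simp [h1, disjoint_left.1 h h1]
  · simp [h1]

theorem encS_empty : encS (∅ : Finset (ZMod n)) = 0 := by simp [encS, enc]

theorem encS_singleton (x : ZMod n) : encS {x} = 256 ^ x.val := by
  simp [encS, enc, ite_mul]

theorem encS_eq_zero {S : Finset (ZMod n)} : encS S = 0 ↔ S = ∅ := by
  constructor
  · intro h; exact encS_inj (h.trans encS_empty.symm)
  · rintro rfl; exact encS_empty

/-- As 256 ≡ 1 modulo 255, the residue modulo 255 is the digit sum. -/
theorem encS_mod_255 {S : Finset (ZMod n)} (h : S.card < 255) : encS S % 255 = S.card := by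
  have : encS S ≡ S.card [MOD 255] := by
    have : S.card = ∑ x : ZMod n, (if x ∈ S then 1 else 0) * 1 := by simp
    rw [this, encS, enc]
    refine Nat.ModEq.sum fun x _ => Nat.ModEq.mul_left _ ?_
    have : 256 ≡ 1 [MOD 255] := by decide
    simpa using this.pow x.val
  rw [this, Nat.mod_eq_of_lt h]

/-- The support of `w` can be read off after adding `127` to every digit. -/
theorem encS_diff_supp (U : Finset (ZMod n)) {w : ZMod n → ℕ} (hw : ∀ x, w x ≤ 128) :
    encS U ^^^ (encS U &&& ((127 * enc (n := n) (fun _ => 1) + enc w) >>> 7)) =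
      encS (U.filter fun x => w x = 0) := by
  -- For a digit w ≤ 128, the number 127 + w is at most 255 and has bit 7 exactly when w ≥ 1. The
  -- shift by 7 moves this bit to the bottom of the digit, and the 0/1 digits of `encS U` mask all
  -- other bits.
  have key : encS U &&& ((127 * enc (n := n) (fun _ => 1) + enc w) >>> 7) =
      encS U &&& encS (univ.filter fun x => w x ≠ 0) := by
    rw [← enc_const_mul, enc_add]
    apply eq_of_testBit_digits
    intro i j hj
    rw [Nat.testBit_land, Nat.testBit_land]
    rcases Nat.eq_zero_or_pos j with rfl | hj0
    · congr 1
      rw [Nat.testBit_shiftRight, show 7 + (8 * i + 0) = 8 * i + 7 by ring,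
        enc_testBit_nat (fun x => by have := hw x; omega) _ _ (by norm_num), encS,
        enc_testBit_nat (ind_lt _) _ _ hj]
      congr 1
      have := hw (i : ZMod n)
      by_cases h : w (i : ZMod n) = 0
      · simp [h]; decide
      · simp only [mem_filter, mem_univ, true_and, ne_eq, h, not_false_eq_true, if_true]
        generalize w (i : ZMod n) = v at *
        interval_cases v <;> simp_all <;> decide
    · have : (encS U).testBit (8 * i + j) = false := by
        rw [encS, enc_testBit_nat (ind_lt U) _ _ hj]
        have : (if (i : ZMod n) ∈ U then 1 else 0 : ℕ).testBit j = false := by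
          split_ifs
          · apply Nat.testBit_lt_two_pow
            exact Nat.one_lt_two_pow (by omega)
          · simp
        rw [this]; simp
      rw [this]; simp
  rw [key, encS_xor_land]
  congr 1; ext x; simp

end

/-- Write O = 2^k (2m + 1). Subtracting 1 changes only the bits up to k, so `O &&& (O - 1)` is O
with its lowest set bit cleared. -/
theorem low_bit {O : ℕ} (hO : O ≠ 0) : ∃ k, O.testBit k = true ∧
    O ^^^ (O &&& (O - 1)) = 2 ^ k ∧
    ∀ j, (O &&& (O - 1)).testBit j = (O.testBit j && decide (j ≠ k)) := by
  obtain ⟨k, m, hm, rfl⟩ := Nat.exists_eq_two_pow_mul_odd hO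
  obtain ⟨m, rfl⟩ := hm
  have hpos : 0 < 2 ^ k := by positivity
  have e1 : 2 ^ k * (2 * m + 1) - 1 = 2 ^ k * (2 * m) + (2 ^ k - 1) := by
    have : 2 ^ k * (2 * m + 1) = 2 ^ k * (2 * m) + 2 ^ k := by ring
    omega
  have hb : ∀ j, (2 ^ k * (2 * m + 1) &&& (2 ^ k * (2 * m + 1) - 1)).testBit j =
      ((2 ^ k * (2 * m + 1)).testBit j && decide (j ≠ k)) := by
    intro j
    rw [Nat.testBit_land, e1, Nat.testBit_two_pow_mul_add _ (by omega), Nat.testBit_two_pow_mul]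
    rcases lt_trichotomy j k with h | h | h
    · simp [h, not_le.2 h]
    · subst h; simp
    · obtain ⟨d, rfl⟩ := Nat.exists_eq_add_of_lt h
      have e : k + d + 1 - k = d + 1 := by omega
      rw [if_neg (by omega), e, Nat.testBit_succ, Nat.testBit_succ]
      have : (2 * m + 1) / 2 = 2 * m / 2 := by omega
      rw [this]
      simp; intro _ _; omega
  refine ⟨k, ?_, ?_, hb⟩
  · rw [Nat.testBit_two_pow_mul]; simp
  · apply Nat.eq_of_testBit_eq
    intro j
    rw [Nat.testBit_xor, hb, Nat.testBit_two_pow]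
    by_cases h : j = k
    · subst h; simp [Nat.testBit_two_pow_mul]
    · have : ¬ k = j := fun e => h e.symm
      simp [h, this]

/-! ### The search, as a computation on encodings that the kernel evaluates quickly -/

-- Recursors and the binary `Nat` operations are used throughout because the kernel reduces them
-- directly, the latter on large literals.
local notation "ifB(" c "," t "," e ")" => Bool.rec (motive := fun _ => Bool) e t c
local notation "ifN(" c "," t "," e ")" => Bool.rec (motive := fun _ => Nat) e t c
-- With N = 256^n and L the bit of x ≠ 0, the quotient is the bit of -x.
local notation "pairBits(" N "," L ")" => Nat.lor L (Nat.div N L)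
-- Halving an exponent has no arithmetic expression in terms of the bit. The table T stores, in
-- 16-bit fields addressed by 256^i modulo q, the position 8 · (i/2 mod n) of the bit of half of i.
local notation "halfBit(" T "," q "," L ")" =>
  Nat.shiftLeft 1 (Nat.mod (Nat.shiftRight T (Nat.mul 16 (Nat.mod L q))) 65536)
-- For S = {x, -x} the square has the terms 2x and -2x, and twice the term x + (-x) = 0, which is
-- the subtracted 2.
local notation "double(" M "," S ")" => Nat.sub (Nat.mod (Nat.mul S S) M) 2
local notation "diff(" a "," b ")" => Nat.xor a (Nat.land a b)
local notation "low(" H ")" => Nat.xor H (Nat.land H (Nat.sub H 1))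
-- Discards the candidates x for A which occur in one of the following sets; here C = A + B, the
-- sets A2, B2 consist of doubles, and Ah, Bh of halves, of elements of A, B. C + B: from x = a + b'
-- + b one gets x + (-b) = a + b', so x = a is already known. Bh + Bh: from x = c + b one gets x -
-- 2c = -x + 2b, so x = -x is already known. A, and B: the former is known, the latter would give x
-- + (-x) = 0 as a sum. (B ∩ (B2 + A)) + B2: an element s of B is 2b' + a and 2(-b) + x, so b' = -b
-- and x = a by uniqueness of doubles. (Ah ∩ (A + Bh)) + Bh: likewise 2s is 2a + 2b' and 2x - 2b, so
-- x = a.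
local notation "prune(" M "," K "," cA "," C "," A "," B "," A2 "," B2 "," Ah "," Bh ")" =>
  diff(cA, (Nat.shiftRight (Nat.add K (Nat.mod (Nat.add (Nat.add (Nat.add (Nat.mul C B)
    (Nat.mul Bh Bh)) (Nat.add A B)) (Nat.add (Nat.mul (Nat.land B (Nat.mod (Nat.mul B2 A) M)) B2)
    (Nat.mul (Nat.land Ah (Nat.mod (Nat.mul A Bh) M)) Bh))) M)) 7))
-- The possible x in g = x + y, where x is known or a candidate, and so is -y = x - g. Three sets
-- are excluded, since each would make g a sum of known elements. Ah + Bh + g/2: then x - y = 2a +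
-- 2b, so x = 2a and -y = 2b are known. B - g: then x + y = -x + (2x + y), so x = -x and 2x + y = y
-- are known. A + 2g: then -a = x + 2y satisfies x + y = -a - y, so y = -y and x = -a are known.
local notation "opts(" M "," N "," K "," T "," q "," A "," B "," cA "," cB "," Ah "," Bh "," G ")" =>
  diff((Nat.land (Nat.add A cA) (Nat.mod (Nat.mul (Nat.add B cB) G) M)),
    (Nat.shiftRight (Nat.add K (Nat.mod (Nat.add (Nat.mul (Nat.mul Ah Bh) halfBit(T,q,G))
      (Nat.add (Nat.mul B (Nat.div N G)) (Nat.mul A (Nat.mul G G)))) M)) 7))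
-- Counts the representations that are still possible for each residue, with weight 3 for a known
-- summand. Zero excludes a representation; small values are preferred for branching.
local notation "weight(" M "," A "," B "," cA "," cB ")" =>
  Nat.mod (Nat.mul (Nat.add (Nat.mul 3 A) cA) (Nat.add (Nat.mul 3 B) cB)) M
-- Marks, in bit 7 of the digit, each nonzero residue that is not a sum. Adding 1 to C counts the
-- residue 0 as covered.
local notation "uncovered(" K1 "," C ")" => Nat.sub K1 (Nat.mul 128 (Nat.add C 1))

/-- A predicate on search states `A B cA cB Ah Bh A2 B2`. -/
def StateTest := Nat → Nat → Nat → Nat → Nat → Nat → Nat → Nat → Bool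

/-- A step that thins out a set of candidates before it continues. -/
def CandidateStep := (Nat → Nat → Bool) → Nat → Nat → Bool

/-- A step that adds a pair of elements, given by the bits `G` and `L`, to a state. -/
def ChildStep := StateTest → Nat → Nat → Nat → Nat → Nat → Nat → Nat → Nat → Nat → Nat → Bool

/-- All set bits of a number satisfy `p`. -/
noncomputable def allBits (p : Nat → Bool) : Nat → Nat → Bool :=
  Nat.rec (motive := fun _ => Nat → Bool) (fun O => Nat.beq O 0)
    (fun _ ih O => ifB(p low(O), ih (Nat.land O (Nat.sub O 1)), false))

/-- A threshold has digits 128 + t, so bit 7 of the difference with W tells whether the weight is at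
most t when no borrow occurs. The first threshold met by a marked residue decides; the lowest marked
residue is the default. -/
noncomputable def pickBit (U W : Nat) : List Nat → Nat :=
  List.rec (motive := fun _ => Nat) (Nat.shiftRight low(U) 7) (fun t _ ih =>
    ifN(Nat.beq (Nat.land (Nat.sub t W) U) 0, ih,
      Nat.shiftRight low(Nat.land (Nat.sub t W) U) 7))

noncomputable def oddChildAux (M N T q : Nat) (ih : StateTest)
    (A B cA cB Ah Bh A2 B2 L L' : Nat) : Bool :=
  ih (Nat.lor A pairBits(N,L)) (Nat.lor B pairBits(N,L')) cA cB
    (Nat.lor Ah pairBits(N,halfBit(T,q,L))) (Nat.lor Bh pairBits(N,halfBit(T,q,L')))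
    (Nat.lor A2 double(M,pairBits(N,L))) (Nat.lor B2 double(M,pairBits(N,L')))

/-- For g = x + y, multiplying the bit of g by the bit of -x gives the bit of y. -/
noncomputable def oddChild (M N T q : Nat) : ChildStep :=
  fun ih A B cA cB Ah Bh A2 B2 G L =>
    oddChildAux M N T q ih A B cA cB Ah Bh A2 B2 L (Nat.mod (Nat.mul G (Nat.div N L)) M)

/-- Here 0 may occur, for which 256^n / 1 is not a digit position; hence the additional reductions
modulo M. Halves and doubles are not tracked for even order. -/
noncomputable def evenChildAux (M N : Nat) (ih : StateTest) (A B cA cB L L' : Nat) : Bool :=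
  ih (Nat.lor A (Nat.lor L (Nat.mod (Nat.div N L) M)))
    (Nat.lor B (Nat.lor L' (Nat.mod (Nat.div N L') M))) cA cB 0 0 0 0

noncomputable def evenChild (M N : Nat) : ChildStep :=
  fun ih A B cA cB _ _ _ _ G L =>
    evenChildAux M N ih A B cA cB L (Nat.mod (Nat.mul G (Nat.div N L)) M)

/-- The fuel `O mod 255` is the number of options, by the digit sum. -/
noncomputable def branch (ch : ChildStep) (ih : StateTest)
    (A B cA cB Ah Bh A2 B2 G O : Nat) : Bool :=
  allBits (ch ih A B cA cB Ah Bh A2 B2 G) (Nat.mod O 255) O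

/-- The first test says that all nonzero residues are sums, so that the state is complete. The
chosen G is tested again for being uncovered, which makes the choice itself irrelevant to soundness.
-/
noncomputable def select (M N ones K T q : Nat) (ch : ChildStep) (leaf : Nat → Nat → Bool)
    (ih : StateTest) (A B cA cB Ah Bh A2 B2 C G : Nat) : Bool :=
  ifB(Nat.beq (Nat.add C 1) ones, leaf A B,
    ifB(Nat.beq (Nat.land (Nat.add C 1) G) 0,
      branch ch ih A B cA cB Ah Bh A2 B2 G opts(M,N,K,T,q,A,B,cA,cB,Ah,Bh,G), false))

/-- The bound 118 on cardinalities keeps the digits of W at most 127, so that 128 - w has bit 7 only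
for w = 0. An uncovered residue of weight 0 closes the branch. Beyond the bound, halved weights
merely guide the choice, and K masks bits crossing digit boundaries. -/
noncomputable def weigh (M N ones K K1 T q : Nat) (ts : List Nat) (ch : ChildStep)
    (leaf : Nat → Nat → Bool) (ih : StateTest) (A B cA cB Ah Bh A2 B2 C W U : Nat) : Bool :=
  ifB(Nat.ble (Nat.add (Nat.mod (Nat.add A cA) 255)
      (Nat.mul 3 (Nat.add (Nat.mod A 255) (Nat.mod B 255)))) 118,
    ifB(Nat.beq (Nat.land (Nat.sub K1 W) U) 0,
      select M N ones K T q ch leaf ih A B cA cB Ah Bh A2 B2 C (pickBit U W ts), true),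
    select M N ones K T q ch leaf ih A B cA cB Ah Bh A2 B2 C
      (pickBit U (Nat.land (Nat.shiftRight W 1) K) ts))

noncomputable def afterCaps (M N ones K K1 T q : Nat) (ts : List Nat) (ch : ChildStep)
    (leaf : Nat → Nat → Bool) (ih : StateTest) (A Ah Bh A2 B2 C cA B cB : Nat) : Bool :=
  weigh M N ones K K1 T q ts ch leaf ih A B cA cB Ah Bh A2 B2 C weight(M,A,B,cA,cB)
    uncovered(K1,C)

/-- The set with mask m must contain exactly c elements. Too few known elements and candidates close
the branch; if c elements are known, the other candidates in it are dropped. -/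
noncomputable def capStep (m c : Nat) : CandidateStep := fun k A cA =>
  ifB(Nat.ble c (Nat.mod (Nat.land (Nat.add A cA) m) 255),
    k A ifN(Nat.beq (Nat.mod (Nat.land A m) 255) c, diff(cA, m), cA), true)

noncomputable def secondCaps (M N ones K K1 T q : Nat) (ts : List Nat) (ch : ChildStep)
    (capB : CandidateStep) (leaf : Nat → Nat → Bool) (ih : StateTest)
    (B Ah Bh A2 B2 C cB A cA : Nat) : Bool :=
  capB (afterCaps M N ones K K1 T q ts ch leaf ih A Ah Bh A2 B2 C cA) B cB

/-- The opening test asks that the product A · B have digits 0 and 1 only, with digit 0 at the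
residue 0. Otherwise two sums coincide or 0 is a sum, and the branch is closed. -/
noncomputable def propagate (M N ones ones1 K K1 T q : Nat) (ts : List Nat) (ch : ChildStep)
    (capA capB : CandidateStep) (leaf : Nat → Nat → Bool) (ih : StateTest)
    (A B cA cB Ah Bh A2 B2 C : Nat) : Bool :=
  ifB(Nat.beq (Nat.land C ones1) C,
    capA (secondCaps M N ones K K1 T q ts ch capB leaf ih B Ah Bh A2 B2 C
      prune(M,K,cB,C,B,A,B2,A2,Bh,Ah)) A prune(M,K,cA,C,A,B,A2,B2,Ah,Bh), true)

noncomputable def search (M N ones ones1 K K1 T q : Nat) (ts : List Nat) (ch : ChildStep)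
    (capA capB : CandidateStep) (leaf : Nat → Nat → Bool) : Nat → StateTest :=
  Nat.rec (motive := fun _ => StateTest)
    -- Exhausted fuel counts as failure, so no bound on the depth is needed for soundness.
    (fun _ _ _ _ _ _ _ _ => false)
    (fun _ ih A B cA cB Ah Bh A2 B2 =>
      propagate M N ones ones1 K K1 T q ts ch capA capB leaf ih A B cA cB Ah Bh A2 B2
        (Nat.mod (Nat.mul A B) M))

/-- The part of the search below a given state in which the element represented by the bit `G`
is covered with a first summand in `mask`. -/
noncomputable def searchChunk (M N ones ones1 K K1 T q : Nat) (ts : List Nat) (ch : ChildStep)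
    (capA capB : CandidateStep) (leaf : Nat → Nat → Bool)
    (A B cA cB Ah Bh A2 B2 G mask : Nat) : Bool :=
  branch ch (search M N ones ones1 K K1 T q ts ch capA capB leaf 20) A B cA cB Ah Bh A2 B2 G
    (Nat.land opts(M,N,K,T,q,A,B,cA,cB,Ah,Bh,G) mask)

/-! ### Soundness -/

section
variable {n : ℕ} [NeZero n]

/-- Symmetric near-factorizations of `ℤ/n`. -/
structure NearFactorization (X Y : Finset (ZMod n)) : Prop where
  neg_left : ∀ x ∈ X, -x ∈ X
  neg_right : ∀ y ∈ Y, -y ∈ Y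
  eq_left : ∀ x ∈ X, ∀ y ∈ Y, ∀ x' ∈ X, ∀ y' ∈ Y, x + y = x' + y' → x = x'
  add_ne_zero : ∀ x ∈ X, ∀ y ∈ Y, x + y ≠ 0
  exists_add : ∀ g, g ≠ 0 → ∃ x ∈ X, ∃ y ∈ Y, x + y = g
  left_nonempty : X.Nonempty
  right_nonempty : Y.Nonempty

theorem NearFactorization.symm {X Y : Finset (ZMod n)} (h : NearFactorization X Y) :
    NearFactorization Y X where
  neg_left := h.neg_right
  neg_right := h.neg_left
  eq_left y hy x hx y' hy' x' hx' e := by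
    have := h.eq_left x hx y hy x' hx' y' hy' (by rw [add_comm x, e, add_comm])
    subst this; exact add_right_cancel e
  add_ne_zero y hy x hx := by rw [add_comm]; exact h.add_ne_zero x hx y hy
  exists_add g hg := by
    obtain ⟨x, hx, y, hy, e⟩ := h.exists_add g hg
    exact ⟨y, hy, x, hx, by rw [add_comm, e]⟩
  left_nonempty := h.right_nonempty
  right_nonempty := h.left_nonempty

/-- Every element has at most one representation `2 y + b`, on the side of `y`. -/
structure DoubleUnique (X Y : Finset (ZMod n)) : Prop where
  left : ∀ x ∈ X, ∀ y ∈ X, ∀ b ∈ Y, ∀ y' ∈ X, ∀ b' ∈ Y, x = 2 * y + b → x = 2 * y' + b' → y = y'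
  right : ∀ x ∈ Y, ∀ y ∈ Y, ∀ b ∈ X, ∀ y' ∈ Y, ∀ b' ∈ X, x = 2 * y + b → x = 2 * y' + b' → y = y'
  inj : ∀ x y : ZMod n, 2 * x = 2 * y → x = y

theorem DoubleUnique.symm {X Y : Finset (ZMod n)} (h : DoubleUnique X Y) : DoubleUnique Y X :=
  ⟨h.right, h.left, h.inj⟩

/-- `A, B` are parts of `X, Y`, and `cA, cB` contain the missing elements. -/
structure State (X Y A B cA cB Ah Bh A2 B2 : Finset (ZMod n)) : Prop where
  subA : A ⊆ X
  subB : B ⊆ Y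
  supA : X ⊆ A ∪ cA
  supB : Y ⊆ B ∪ cB
  negA : ∀ x ∈ A, -x ∈ A
  negB : ∀ x ∈ B, -x ∈ B
  fixA : ∀ x ∈ X, x = -x → x ∈ A
  fixB : ∀ x ∈ Y, x = -x → x ∈ B
  half : ∀ z ∈ Ah, 2 * z ∈ A
  half' : ∀ z ∈ Bh, 2 * z ∈ B
  dbl : ∀ z ∈ A2, ∃ x ∈ A, z = 2 * x
  dbl' : ∀ z ∈ B2, ∃ x ∈ B, z = 2 * x
  unique : DoubleUnique X Y ∨ (Ah = ∅ ∧ Bh = ∅ ∧ A2 = ∅ ∧ B2 = ∅)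

variable {X Y A B cA cB Ah Bh A2 B2 : Finset (ZMod n)}

theorem State.symm (h : State X Y A B cA cB Ah Bh A2 B2) : State Y X B A cB cA Bh Ah B2 A2 :=
  ⟨h.subB, h.subA, h.supB, h.supA, h.negB, h.negA, h.fixB, h.fixA, h.half',
    h.half, h.dbl', h.dbl, h.unique.imp DoubleUnique.symm fun ⟨a, b, c, d⟩ => ⟨b, a, d, c⟩⟩

/-- Indicator functions. -/
def ind (S : Finset (ZMod n)) (x : ZMod n) : ℕ := if x ∈ S then 1 else 0

theorem ind_le (S : Finset (ZMod n)) (x : ZMod n) : ind S x ≤ 1 := by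
  unfold ind; split_ifs <;> norm_num

theorem encS_eq (S : Finset (ZMod n)) : encS S = enc (ind S) := rfl

theorem conv_comm (f g : ZMod n → ℕ) (z : ZMod n) : conv f g z = conv g f z := by
  unfold conv
  exact Fintype.sum_equiv (Equiv.subLeft z) _ _ fun x => by simp [mul_comm]

theorem conv_le (S : Finset (ZMod n)) {f : ZMod n → ℕ} {c : ℕ} (hf : ∀ x, f x ≤ c) (z : ZMod n) :
    conv f (ind S) z ≤ c * S.card := by
  rw [conv_comm]
  calc conv (ind S) f z ≤ ∑ x, ind S x * c := sum_le_sum fun x _ => Nat.mul_le_mul_left _ (hf _)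
    _ = c * S.card := by rw [← sum_mul]; simp [ind, mul_comm]

theorem conv_ind_le (S T : Finset (ZMod n)) (z : ZMod n) : conv (ind S) (ind T) z ≤ T.card := by
  simpa using conv_le T (ind_le S) z

theorem conv_ind_ne_zero {S T : Finset (ZMod n)} {z : ZMod n} (h : conv (ind S) (ind T) z ≠ 0) :
    ∃ s ∈ S, ∃ t ∈ T, s + t = z := by
  obtain ⟨x, _, hx⟩ := exists_ne_zero_of_sum_ne_zero h
  unfold ind at hx
  refine ⟨x, ?_, z - x, ?_, by ring⟩ <;> by_contra hc <;> simp [hc] at hx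

theorem conv_ind_pos {S T : Finset (ZMod n)} {s t : ZMod n} (hs : s ∈ S) (ht : t ∈ T) :
    0 < conv (ind S) (ind T) (s + t) := by
  refine lt_of_lt_of_le ?_ (single_le_sum (f := fun x => ind S x * ind T (s + t - x))
    (fun _ _ => Nat.zero_le _) (mem_univ s))
  simp [ind, hs, ht]

theorem encS_mul_mod {S T : Finset (ZMod n)} (h : T.card ≤ 254) :
    encS S * encS T % modulus n = enc (conv (ind S) (ind T)) :=
  mod_eq_enc (fun z => (conv_ind_le S T z).trans h) (enc_mul _ _)

/-- The set of sums. -/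
def sums (A B : Finset (ZMod n)) : Finset (ZMod n) := (A ×ˢ B).image fun p => p.1 + p.2

theorem mem_sums {z : ZMod n} : z ∈ sums A B ↔ ∃ a ∈ A, ∃ b ∈ B, a + b = z := by
  simp [sums, and_assoc]

theorem conv_eq_sums (hF : NearFactorization X Y) (hA : A ⊆ X) (hB : B ⊆ Y) :
    conv (ind A) (ind B) = ind (sums A B) := by
  funext z
  by_cases hz : z ∈ sums A B
  · obtain ⟨a, ha, b, hb, rfl⟩ := mem_sums.1 hz
    rw [ind, if_pos hz]
    unfold conv
    rw [sum_eq_single a]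
    · simp [ind, ha, hb]
    · intro x _ hx
      by_contra hc
      unfold ind at hc
      have h1 : x ∈ A := by by_contra h; simp [h] at hc
      have h2 : a + b - x ∈ B := by by_contra h; simp [h] at hc
      exact hx (hF.eq_left x (hA h1) _ (hB h2) a (hA ha) b (hB hb) (by ring))
    · simp
  · rw [ind, if_neg hz]
    by_contra hc
    exact hz (mem_sums.2 (conv_ind_ne_zero hc))

theorem enc_land_ind (S : Finset (ZMod n)) {f : ZMod n → ℕ} (hf : ∀ x, f x < 256) :
    encS S &&& enc f = encS (S.filter fun x => f x % 2 = 1) := by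
  rw [encS, enc_land (ind_lt S) hf, encS]
  congr 1; funext x
  by_cases h : x ∈ S
  · simp only [h, if_true, mem_filter, true_and, Nat.one_and_eq_mod_two]
    rcases Nat.mod_two_eq_zero_or_one (f x) with h | h <;> simp [h]
  · simp [h]

theorem prune_sound (hF : NearFactorization X Y) (hX : X.card ≤ 30) (hY : Y.card ≤ 30)
    (h : State X Y A B cA cB Ah Bh A2 B2) :
    ∃ cA', prune((modulus n), (127 * enc (n := n) fun _ => 1), (encS cA), (encS (sums A B)),
        (encS A), (encS B), (encS A2), (encS B2), (encS Ah), (encS Bh)) = encS cA' ∧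
      cA' ⊆ cA ∧ Disjoint A cA' ∧ X ⊆ A ∪ cA' := by
  have cB : B.card ≤ 30 := (card_le_card h.subB).trans hY
  have cA0 : A.card ≤ 30 := (card_le_card h.subA).trans hX
  have cBh : Bh.card ≤ 30 := by
    rcases h.unique with hu | hu
    · refine le_trans ?_ cB
      exact card_le_card_of_injOn (fun z => 2 * z) h.half' fun x _ y _ e => hu.inj x y e
    · simp [hu.2.1]
  have cB2 : B2.card ≤ 30 := by
    refine le_trans (card_le_card (t := B.image fun z => 2 * z) ?_) (card_image_le.trans cB)
    intro z hz
    obtain ⟨x, hx, rfl⟩ := h.dbl' z hz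
    exact mem_image_of_mem _ hx
  set f1 := conv (ind B2) (ind A)
  set f2 := conv (ind A) (ind Bh)
  -- The digits of the convolution may exceed 1, and intersection with 0/1 digits sees only their
  -- lowest bit. Restricting to odd multiplicity only weakens the rule.
  set sB := B.filter fun x => f1 x % 2 = 1
  set sA := Ah.filter fun x => f2 x % 2 = 1
  have e1 : encS B &&& (encS B2 * encS A % modulus n) = encS sB := by
    rw [encS_mul_mod (by omega), enc_land_ind]
    intro x; have := conv_ind_le B2 A x; omega
  have e2 : encS Ah &&& (encS A * encS Bh % modulus n) = encS sA := by
    rw [encS_mul_mod (by omega), enc_land_ind]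
    intro x; have := conv_ind_le A Bh x; omega
  let w : ZMod n → ℕ := fun x => conv (ind (sums A B)) (ind B) x + conv (ind Bh) (ind Bh) x +
    (ind A x + ind B x) + (conv (ind sB) (ind B2) x + conv (ind sA) (ind Bh) x)
  -- The bound 30 on the factors serves here: four convolutions of at most 30 each and two
  -- indicators give at most 122.
  have hw : ∀ x, w x ≤ 128 := by
    intro x
    have h1 := conv_ind_le (sums A B) B x
    have h2 := conv_ind_le Bh Bh x
    have h3 := conv_ind_le sB B2 x
    have h4 := conv_ind_le sA Bh x
    have h5 := ind_le A x
    have h6 := ind_le B x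
    show _ + _ + (_ + _) + (_ + _) ≤ _
    omega
  have e3 : (encS (sums A B) * encS B + encS Bh * encS Bh + (encS A + encS B) +
      (encS sB * encS B2 + encS sA * encS Bh)) % modulus n = enc w := by
    apply mod_eq_enc (fun x => by have := hw x; omega)
    have : enc w = enc (conv (ind (sums A B)) (ind B)) + enc (conv (ind Bh) (ind Bh)) +
        (encS A + encS B) + (enc (conv (ind sB) (ind B2)) + enc (conv (ind sA) (ind Bh))) := by
      simp only [encS_eq, enc_add]; rfl
    rw [this]
    exact (((enc_mul _ _).add (enc_mul _ _)).add rfl).add ((enc_mul _ _).add (enc_mul _ _))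
  refine ⟨cA.filter fun x => w x = 0, ?_, filter_subset _ _, ?_, ?_⟩
  · rw [← encS_diff_supp cA hw, ← e3, ← e1, ← e2]; rfl
  · refine disjoint_left.2 fun x hx hx' => ?_
    have h0 : _ + _ + (ind A x + _) + (_ + _) = 0 := (mem_filter.1 hx').2
    have : ind A x = 1 := by simp [ind, hx]
    omega
  · intro x hx
    by_cases hxA : x ∈ A
    · exact mem_union_left _ hxA
    refine mem_union_right _ (mem_filter.2 ⟨?_, ?_⟩)
    · exact (mem_union.1 (h.supA hx)).resolve_left hxA
    have hsym : ∀ b ∈ B, -b ∈ Y := fun b hb => h.subB (h.negB b hb)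
    have g1 : conv (ind (sums A B)) (ind B) x = 0 := by
      by_contra hc
      obtain ⟨c, hcS, b, hb, rfl⟩ := conv_ind_ne_zero hc
      obtain ⟨a, ha, b', hb', rfl⟩ := mem_sums.1 hcS
      have := hF.eq_left _ hx (-b) (hsym b hb) a (h.subA ha) b' (h.subB hb') (by ring)
      exact hxA (by rw [this]; exact ha)
    have g2 : conv (ind Bh) (ind Bh) x = 0 := by
      by_contra hc
      obtain ⟨c, hcB, b, hb, rfl⟩ := conv_ind_ne_zero hc
      have := hF.eq_left _ hx (-(2 * c)) (hsym _ (h.half' c hcB)) _ (hF.neg_left _ hx) (2 * b)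
        (h.subB (h.half' b hb)) (by ring)
      exact hxA (h.fixA _ hx this)
    have g3 : ind A x = 0 := by simp [ind, hxA]
    have g4 : ind B x = 0 := by
      by_contra hc
      have hxB : x ∈ B := by by_contra h; simp [ind, h] at hc
      exact hF.add_ne_zero x hx (-x) (hsym x hxB) (by ring)
    have g5 : conv (ind sB) (ind B2) x = 0 := by
      by_contra hc
      obtain ⟨s, hs, b2, hb2, rfl⟩ := conv_ind_ne_zero hc
      obtain ⟨hsB, hs2⟩ := mem_filter.1 hs
      obtain ⟨d, hd, a, ha, hda⟩ := conv_ind_ne_zero (S := B2) (T := A) (z := s)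
        (fun h0 => by rw [show f1 s = 0 from h0] at hs2; simp at hs2)
      obtain ⟨b', hb', rfl⟩ := h.dbl' d hd
      obtain ⟨b, hb, rfl⟩ := h.dbl' b2 hb2
      have hu := h.unique.resolve_right (by rintro ⟨_, _, _, h0⟩; simp [h0] at hd)
      have := hu.right s (h.subB hsB) b' (h.subB hb') a (h.subA ha) (-b) (hsym b hb) _ hx
        hda.symm (by ring)
      have e : s + 2 * b = a := by
        rw [← hda, this]; ring
      exact hxA (by rw [e]; exact ha)
    have g6 : conv (ind sA) (ind Bh) x = 0 := by
      by_contra hc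
      obtain ⟨s, hs, b, hb, rfl⟩ := conv_ind_ne_zero hc
      obtain ⟨hsA, hs2⟩ := mem_filter.1 hs
      obtain ⟨a, ha, b', hb', hab⟩ := conv_ind_ne_zero (S := A) (T := Bh) (z := s)
        (fun h0 => by rw [show f2 s = 0 from h0] at hs2; simp at hs2)
      have hu := h.unique.resolve_right (by rintro ⟨_, h0, _, _⟩; simp [h0] at hb)
      have := hu.left (2 * s) (h.subA (h.half s hsA)) (s + b) hx (-(2 * b)) (hsym _ (h.half' b hb))
        a (h.subA ha) (2 * b') (h.subB (h.half' b' hb')) (by ring) (by rw [← hab]; ring)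
      exact hxA (by rw [this]; exact ha)
    show _ + _ + (_ + _) + (_ + _) = 0
    rw [g1, g2, g3, g4, g5, g6]

end

/-! ### Soundness of enumeration of bits, candidate filters and child states. -/

section
variable {n : ℕ} [NeZero n] {X Y A B cA cB Ah Bh A2 B2 : Finset (ZMod n)}

theorem bool_rec_true {c t e : Bool} (h : (ifB(c, t, e) : Bool) = true) :
    (c = true ∧ t = true) ∨ (c = false ∧ e = true) := by
  cases c
  · exact Or.inr ⟨rfl, h⟩
  · exact Or.inl ⟨rfl, h⟩

/-- Every set bit of an encoded set is the lowest bit of its digit, so the lowest set bit is the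
encoding of an element. -/
theorem encS_low {S : Finset (ZMod n)} (hS : S.Nonempty) : ∃ x ∈ S,
    low((encS S)) = 256 ^ x.val ∧ Nat.land (encS S) (Nat.sub (encS S) 1) = encS (S.erase x) := by
  have h0 : encS S ≠ 0 := fun h => hS.ne_empty (encS_eq_zero.1 h)
  obtain ⟨k, hk, h1, h2⟩ := low_bit h0
  have hd := Nat.div_add_mod k 8
  have hm : k % 8 < 8 := Nat.mod_lt _ (by norm_num)
  rw [← hd, encS, enc_testBit_nat (ind_lt S) _ _ hm] at hk
  obtain ⟨hkn, hk⟩ := Bool.and_eq_true_iff.1 hk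
  have hkn : k / 8 < n := by simpa using hkn
  have hmem : ((k / 8 : ℕ) : ZMod n) ∈ S := by by_contra h; simp [h] at hk
  rw [if_pos hmem] at hk
  have hk0 : k % 8 = 0 := by
    by_contra h
    rw [Nat.testBit_lt_two_pow (Nat.one_lt_two_pow h)] at hk
    simp at hk
  have hkk : k = 8 * (k / 8) := by omega
  have hv : ((k / 8 : ℕ) : ZMod n).val = k / 8 := ZMod.val_natCast_of_lt hkn
  refine ⟨_, hmem, ?_, ?_⟩
  · show encS S ^^^ (encS S &&& (encS S - 1)) = _
    rw [h1, hv]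
    conv_lhs => rw [hkk, pow_mul]
    norm_num
  · apply eq_of_testBit_digits
    intro i j hj
    show (encS S &&& (encS S - 1)).testBit _ = _
    rw [h2, encS, encS, enc_testBit_nat (ind_lt S) _ _ hj, enc_testBit_nat (ind_lt _) _ _ hj]
    by_cases hi : i < n
    · by_cases hik : i = k / 8
      · subst hik
        rw [if_neg (fun h => (mem_erase.1 h).1 rfl)]
        by_cases hj0 : j = 0
        · subst hj0
          simp [← hkk]
        · have : (1 : ℕ).testBit j = false := Nat.testBit_lt_two_pow (Nat.one_lt_two_pow hj0)
          split_ifs <;> simp [this]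
      · have hne : 8 * i + j ≠ k := by omega
        have : (i : ZMod n) ≠ ((k / 8 : ℕ) : ZMod n) := by
          intro h
          have := congrArg ZMod.val h
          rw [hv, ZMod.val_natCast_of_lt hi] at this
          exact hik this
        simp [hne, mem_erase, this]
    · simp [hi]

theorem allBits_sound {p : ℕ → Bool} (m : ℕ) {S : Finset (ZMod n)}
    (h : allBits p m (encS S) = true) : ∀ x ∈ S, p (256 ^ x.val) = true := by
  induction m generalizing S with
  | zero =>
    have : encS S = 0 := Nat.eq_of_beq_eq_true h
    rw [encS_eq_zero.1 this]; simp
  | succ m ih =>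
    intro x hx
    obtain ⟨y, hy, h1, h2⟩ := encS_low ⟨x, hx⟩
    rcases bool_rec_true h with ⟨h3, h4⟩ | ⟨_, h4⟩
    · rw [h1] at h3
      rcases eq_or_ne x y with rfl | hxy
      · exact h3
      · refine ih (S := S.erase y) ?_ x (mem_erase.2 ⟨hxy, hx⟩)
        rw [← h2]; exact h4
    · simp at h4

theorem low_eq_of_land {V : Finset (ZMod n)} {H v : ℕ} (hH : H = v &&& (128 * encS V))
    (h0 : H ≠ 0) : ∃ g : ZMod n, Nat.shiftRight low(H) 7 = 256 ^ g.val := by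
  obtain ⟨k, hk, h1, -⟩ := low_bit h0
  have hk' : (128 * encS V).testBit k = true := by
    rw [hH, Nat.testBit_land] at hk
    exact (Bool.and_eq_true_iff.1 hk).2
  have hd := Nat.div_add_mod k 8
  have hm : k % 8 < 8 := Nat.mod_lt _ (by norm_num)
  rw [encS, enc_smul, ← hd, enc_testBit_nat (fun x => by split_ifs <;> norm_num) _ _ hm] at hk'
  obtain ⟨hkn, hk'⟩ := Bool.and_eq_true_iff.1 hk'
  have hkn : k / 8 < n := by simpa using hkn
  have h7 : k % 8 = 7 := by
    generalize k % 8 = j at *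
    split_ifs at hk' <;> interval_cases j <;> first | rfl | (exfalso; revert hk'; decide)
  refine ⟨((k / 8 : ℕ) : ZMod n), ?_⟩
  show (H ^^^ (H &&& (H - 1))) >>> 7 = _
  rw [h1, ZMod.val_natCast_of_lt hkn, Nat.shiftRight_eq_div_pow, show (256 : ℕ) = 2 ^ 8 by norm_num,
    ← pow_mul, Nat.pow_div (by omega) (by norm_num)]
  congr 1; omega

/-- True for arbitrary W and thresholds: every marked bit sits at a position 8i + 7, whatever the
heuristic does. Hence nothing about the weights has to be proved for the choice. -/
theorem pickBit_eq {V : Finset (ZMod n)} (hV : V.Nonempty) (W : ℕ) (ts : List ℕ) :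
    ∃ g : ZMod n, pickBit (128 * encS V) W ts = 256 ^ g.val := by
  induction ts with
  | nil =>
    refine low_eq_of_land (V := V) (Nat.and_self _).symm ?_
    have : encS V ≠ 0 := fun h => hV.ne_empty (encS_eq_zero.1 h)
    omega
  | cons t ts ih =>
    by_cases h0 : Nat.land (Nat.sub t W) (128 * encS V) = 0
    · obtain ⟨g, hg⟩ := ih
      refine ⟨g, Eq.trans ?_ hg⟩
      show (Bool.rec (motive := fun _ => Nat) _ _
        (Nat.beq (Nat.land (Nat.sub t W) (128 * encS V)) 0)) = _
      rw [h0]; rfl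
    · obtain ⟨g, hg⟩ := low_eq_of_land (V := V) rfl h0
      refine ⟨g, Eq.trans ?_ hg⟩
      have hb : Nat.beq (Nat.land (Nat.sub t W) (128 * encS V)) 0 = false := by
        rw [Bool.eq_false_iff]; exact fun h => h0 (Nat.eq_of_beq_eq_true h)
      show (Bool.rec (motive := fun _ => Nat) _ _
        (Nat.beq (Nat.land (Nat.sub t W) (128 * encS V)) 0)) = _
      rw [hb]; rfl

/-- A candidate step does not discard elements of `X`. -/
def CandidateSound (X : Finset (ZMod n)) (cap : CandidateStep) : Prop :=
  ∀ A cA, A ⊆ X → X ⊆ A ∪ cA → Disjoint A cA → ∀ k, cap k (encS A) (encS cA) = true →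
    ∃ cA', Disjoint A cA' ∧ X ⊆ A ∪ cA' ∧ k (encS A) (encS cA') = true

/-- If A ∩ S already has c elements it equals X ∩ S, so discarding the candidates in S loses
nothing. The other way of closing a branch is impossible as X ⊆ A ∪ cA. Reading cardinalities modulo
255 requires n < 255. -/
theorem capStep_sound (hn : n < 255) {S : Finset (ZMod n)} {c : ℕ} (hS : (X ∩ S).card = c) :
    CandidateSound X (capStep (encS S) c) := by
  intro A cA hA hX hd k h
  have hcard : ∀ U : Finset (ZMod n), U.card < 255 := fun U =>
    lt_of_le_of_lt (card_le_univ U) (by rwa [ZMod.card])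
  rcases bool_rec_true h with ⟨-, h⟩ | ⟨h, -⟩
  · by_cases hc : Nat.beq (Nat.mod (Nat.land (encS A) (encS S)) 255) c = true
    · rw [hc] at h
      have e1 : (A ∩ S).card = c := by
        have := Nat.eq_of_beq_eq_true hc
        rw [← this, ← encS_mod_255 (hcard _), ← encS_land]; rfl
      have e2 : A ∩ S = X ∩ S :=
        eq_of_subset_of_card_le (inter_subset_inter_right hA) (by rw [e1, hS])
      refine ⟨cA \ S, hd.mono_right sdiff_subset, fun x hx => ?_, ?_⟩
      · by_cases hxA : x ∈ A
        · exact mem_union_left _ hxA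
        refine mem_union_right _ (mem_sdiff.2 ⟨(mem_union.1 (hX hx)).resolve_left hxA, fun hxS => ?_⟩)
        have : x ∈ A ∩ S := by rw [e2]; exact mem_inter.2 ⟨hx, hxS⟩
        exact hxA (mem_inter.1 this).1
      · rw [← encS_xor_land]; exact h
    · rw [Bool.not_eq_true] at hc
      rw [hc] at h
      exact ⟨cA, hd, hX, h⟩
  · exfalso
    have : ¬ c ≤ Nat.mod (Nat.land (Nat.add (encS A) (encS cA)) (encS S)) 255 := by
      intro hle; rw [Nat.ble_eq_true_of_le hle] at h; simp at h
    apply this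
    have e : Nat.mod (Nat.land (Nat.add (encS A) (encS cA)) (encS S)) 255 =
        ((A ∪ cA) ∩ S).card := by
      rw [← encS_mod_255 (hcard _), ← encS_land, ← encS_add hd]; rfl
    rw [e, ← hS]
    exact card_le_card (inter_subset_inter_right hX)

theorem CandidateSound.comp {cap cap' : CandidateStep} (h : CandidateSound X cap)
    (h' : CandidateSound X cap') : CandidateSound X fun k => cap (cap' k) := by
  intro A cA hA hX hd k hk
  obtain ⟨c1, hd1, hX1, hk1⟩ := h A cA hA hX hd _ hk
  exact h' A c1 hA hX1 hd1 k hk1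

theorem State.of_candidates (h : State X Y A B cA cB Ah Bh A2 B2) {cA' cB' : Finset (ZMod n)}
    (hA : X ⊆ A ∪ cA') (hB : Y ⊆ B ∪ cB') : State X Y A B cA' cB' Ah Bh A2 B2 :=
  { h with supA := hA, supB := hB }

theorem pow_div_pow_val {x : ZMod n} (hx : x ≠ 0) : 256 ^ n / 256 ^ x.val = 256 ^ (-x).val := by
  have : NeZero x := ⟨hx⟩
  rw [Nat.pow_div (ZMod.val_lt x).le (by norm_num), ZMod.val_neg_of_ne_zero]

theorem pow_div_pow_modEq (x : ZMod n) : 256 ^ n / 256 ^ x.val ≡ 256 ^ (-x).val [MOD modulus n] := by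
  rcases eq_or_ne x 0 with rfl | hx
  · simpa using pow_modEq (n := n) n
  · rw [pow_div_pow_val hx]

theorem pow_modEq_iff_mod {v : ℕ} {x : ZMod n} (h : v ≡ 256 ^ x.val [MOD modulus n]) :
    v % modulus n = 256 ^ x.val := by
  rw [← encS_singleton, encS] at h ⊢
  exact mod_eq_enc (fun z => by split_ifs <;> norm_num) h

theorem pow_val_add (x y : ZMod n) :
    256 ^ x.val * 256 ^ y.val ≡ 256 ^ (x + y).val [MOD modulus n] := by
  rw [← pow_add, ZMod.val_add]; exact pow_modEq _

theorem encS_pair (x : ZMod n) : 256 ^ x.val ||| 256 ^ (-x).val = encS {x, -x} := by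
  rw [← encS_singleton, ← encS_singleton, encS_lor]; rfl

/-- A step which adds the pairs of `x ∈ X` and `y ∈ Y`. -/
def ChildSound (X Y : Finset (ZMod n)) (ch : ChildStep) : Prop :=
  ∀ A B cA cB Ah Bh A2 B2, State X Y A B cA cB Ah Bh A2 B2 → ∀ x ∈ X, ∀ y ∈ Y, ∀ ih,
    ch ih (encS A) (encS B) (encS cA) (encS cB) (encS Ah) (encS Bh) (encS A2) (encS B2)
      (256 ^ (x + y).val) (256 ^ x.val) = true →
    ∃ A' B' Ah' Bh' A2' B2', State X Y A' B' cA cB Ah' Bh' A2' B2' ∧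
      ih (encS A') (encS B') (encS cA) (encS cB) (encS Ah') (encS Bh') (encS A2') (encS B2') = true

theorem neg_mem_union_pair {x : ZMod n} (h : ∀ x ∈ A, -x ∈ A) : ∀ z ∈ A ∪ {x, -x}, -z ∈ A ∪ {x, -x} := by
  intro z hz
  rcases mem_union.1 hz with hz | hz
  · exact mem_union_left _ (h z hz)
  · apply mem_union_right
    rcases mem_insert.1 hz with rfl | hz
    · simp
    · rw [mem_singleton.1 hz]; simp

theorem union_pair_subset {x : ZMod n} (hX : ∀ x ∈ X, -x ∈ X) (hA : A ⊆ X) (hx : x ∈ X) :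
    A ∪ {x, -x} ⊆ X := by
  refine union_subset hA ?_
  rintro z hz
  rcases mem_insert.1 hz with rfl | hz
  · exact hx
  · rw [mem_singleton.1 hz]; exact hX x hx

theorem evenChild_sound (hF : NearFactorization X Y) :
    ChildSound X Y (evenChild (modulus n) (256 ^ n)) := by
  intro A B cA cB Ah Bh A2 B2 h x hx y hy ih hc
  have e1 : (256 ^ n / 256 ^ x.val) % modulus n = 256 ^ (-x).val :=
    pow_modEq_iff_mod (pow_div_pow_modEq x)
  have e2 : 256 ^ (x + y).val * (256 ^ n / 256 ^ x.val) % modulus n = 256 ^ y.val := by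
    apply pow_modEq_iff_mod
    have := ((pow_div_pow_modEq x).mul_left (256 ^ (x + y).val)).trans (pow_val_add _ _)
    rwa [show x + y + -x = y by ring] at this
  have e3 : (256 ^ n / 256 ^ y.val) % modulus n = 256 ^ (-y).val :=
    pow_modEq_iff_mod (pow_div_pow_modEq y)
  have hc : ih (encS A ||| (256 ^ x.val ||| (256 ^ n / 256 ^ x.val) % modulus n))
    (encS B ||| (256 ^ (x + y).val * (256 ^ n / 256 ^ x.val) % modulus n |||
      (256 ^ n / (256 ^ (x + y).val * (256 ^ n / 256 ^ x.val) % modulus n)) % modulus n))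
    (encS cA) (encS cB) 0 0 0 0 = true := hc
  rw [e2, e1, e3, encS_pair, encS_pair, encS_lor, encS_lor] at hc
  refine ⟨A ∪ {x, -x}, B ∪ {y, -y}, ∅, ∅, ∅, ∅, ?_, by simpa only [encS_empty] using hc⟩
  exact {
    subA := union_pair_subset hF.neg_left h.subA hx
    subB := union_pair_subset hF.neg_right h.subB hy
    supA := h.supA.trans (union_subset_union_left subset_union_left)
    supB := h.supB.trans (union_subset_union_left subset_union_left)
    negA := neg_mem_union_pair h.negA
    negB := neg_mem_union_pair h.negB
    fixA := fun z hz e => mem_union_left _ (h.fixA z hz e)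
    fixB := fun z hz e => mem_union_left _ (h.fixB z hz e)
    half := by simp
    half' := by simp
    dbl := by simp
    dbl' := by simp
    unique := Or.inr ⟨rfl, rfl, rfl, rfl⟩ }

/-- `T` tabulates the exponents of the bits of the halves. -/
def HalfTable (n T q : ℕ) : Prop :=
  ∀ i < n, (T >>> (16 * (256 ^ i % q))) % 65536 = 8 * (i * ((n + 1) / 2) % n)

theorem halfBit_eq {T q : ℕ} (hT : HalfTable n T q) (x : ZMod n) :
    halfBit(T, q, (256 ^ x.val)) = 256 ^ (x * ((n + 1) / 2 : ℕ)).val := by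
  have : (x * ((n + 1) / 2 : ℕ)).val = x.val * ((n + 1) / 2) % n := by
    conv_lhs => rw [← ZMod.natCast_zmod_val x, ← Nat.cast_mul, ZMod.val_natCast]
  show 1 <<< ((T >>> (16 * (256 ^ x.val % q))) % 65536) = _
  rw [hT _ (ZMod.val_lt x), this, Nat.one_shiftLeft, pow_mul]; norm_num

theorem double_eq {x : ZMod n} (h2 : 2 * x ≠ -(2 * x)) :
    double((modulus n), (encS {x, -x})) = encS {2 * x, -(2 * x)} := by
  have hne : x ≠ -x := by rintro h; exact h2 (by linear_combination 2 * h)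
  have e0 : encS {x, -x} = 256 ^ x.val + 256 ^ (-x).val := by
    rw [← encS_singleton, ← encS_singleton, encS_add (by simpa using hne)]; rfl
  have e1 : encS {2 * x, -(2 * x)} = 256 ^ (2 * x).val + 256 ^ (-(2 * x)).val := by
    rw [← encS_singleton, ← encS_singleton, encS_add (by simpa using h2)]; rfl
  let w : ZMod n → ℕ := fun z => ind {2 * x, -(2 * x)} z + 2 * ind {0} z
  have hw : enc w = 256 ^ (2 * x).val + 256 ^ (-(2 * x)).val + 2 := by
    show enc (fun z => ind {2 * x, -(2 * x)} z + 2 * ind {0} z) = _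
    rw [← enc_add, ← enc_smul, ← encS_eq, ← encS_eq, e1, encS_singleton]; simp
  have hm : encS {x, -x} * encS {x, -x} % modulus n = enc w := by
    apply mod_eq_enc
    · intro z
      have := ind_le {2 * x, -(2 * x)} z
      have := ind_le {0} z
      show ind {2 * x, -(2 * x)} z + 2 * ind {0} z ≤ _
      omega
    · rw [hw, e0]
      have a1 := pow_val_add x x
      have a2 := pow_val_add x (-x)
      have a3 := pow_val_add (-x) (-x)
      rw [← two_mul] at a1
      rw [add_neg_cancel, ZMod.val_zero, pow_zero] at a2
      rw [show -x + -x = -(2 * x) by ring] at a3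
      have : (256 ^ x.val + 256 ^ (-x).val) * (256 ^ x.val + 256 ^ (-x).val) =
        256 ^ x.val * 256 ^ x.val + 256 ^ (-x).val * 256 ^ (-x).val +
          2 * (256 ^ x.val * 256 ^ (-x).val) := by ring
      rw [this]
      exact (a1.add a3).add (a2.mul_left 2)
  show encS {x, -x} * encS {x, -x} % modulus n - 2 = _
  rw [hm, hw, e1]; simp

theorem half_mem_union_pair {x c : ZMod n} (hc : 2 * c = 1) (h : ∀ z ∈ Ah, 2 * z ∈ A) :
    ∀ z ∈ Ah ∪ {x * c, -(x * c)}, 2 * z ∈ A ∪ {x, -x} := by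
  intro z hz
  rcases mem_union.1 hz with hz | hz
  · exact mem_union_left _ (h z hz)
  · apply mem_union_right
    rcases mem_insert.1 hz with rfl | hz
    · rw [show 2 * (x * c) = x by linear_combination x * hc]; simp
    · rw [mem_singleton.1 hz, show 2 * (-(x * c)) = -x by linear_combination -x * hc]; simp

theorem double_mem_union_pair {x : ZMod n} (h : ∀ z ∈ A2, ∃ x ∈ A, z = 2 * x) :
    ∀ z ∈ A2 ∪ {2 * x, -(2 * x)}, ∃ y ∈ A ∪ {x, -x}, z = 2 * y := by
  intro z hz
  rcases mem_union.1 hz with hz | hz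
  · obtain ⟨y, hy, e⟩ := h z hz
    exact ⟨y, mem_union_left _ hy, e⟩
  · rcases mem_insert.1 hz with rfl | hz
    · exact ⟨x, by simp, rfl⟩
    · exact ⟨-x, by simp, by rw [mem_singleton.1 hz]; ring⟩

/-- With 0 in neither factor and 2 cancellable, the elements x, y and their halves are nonzero, so
the quotients of 256^n are bits of negatives without reduction modulo M. -/
theorem oddChild_sound (hF : NearFactorization X Y) (hD : DoubleUnique X Y) {T q : ℕ}
    (hT : HalfTable n T q) (hodd : n % 2 = 1) (hX0 : 0 ∉ X) (hY0 : 0 ∉ Y) :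
    ChildSound X Y (oddChild (modulus n) (256 ^ n) T q) := by
  intro A B cA cB Ah Bh A2 B2 h x hx y hy ih hc
  have hx0 : x ≠ 0 := fun e => hX0 (e ▸ hx)
  have hy0 : y ≠ 0 := fun e => hY0 (e ▸ hy)
  set c : ZMod n := (((n + 1) / 2 : ℕ) : ZMod n) with hcdef
  have hc1 : 2 * c = 1 := by
    have : 2 * ((n + 1) / 2) = n + 1 := by omega
    rw [hcdef]
    have := congrArg (Nat.cast : ℕ → ZMod n) this
    push_cast at this ⊢
    rw [this]; simp
  have hxc : x * c ≠ 0 := fun e => hx0 (by linear_combination 2 * e - x * hc1)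
  have hyc : y * c ≠ 0 := fun e => hy0 (by linear_combination 2 * e - y * hc1)
  have hne : ∀ z : ZMod n, z ≠ 0 → 2 * z ≠ -(2 * z) := by
    intro z hz e
    have h1 : z = -z := hD.inj _ _ (by rw [e]; ring)
    exact hz (hD.inj z 0 (by linear_combination h1))
  have e1 := pow_div_pow_val hx0
  have e2 : 256 ^ (x + y).val * 256 ^ (-x).val % modulus n = 256 ^ y.val := by
    apply pow_modEq_iff_mod
    have := pow_val_add (x + y) (-x)
    rwa [show x + y + -x = y by ring] at this
  have e3 := pow_div_pow_val hy0
  have e4 := pow_div_pow_val hxc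
  have e5 := pow_div_pow_val hyc
  have hc : oddChildAux (modulus n) (256 ^ n) T q ih (encS A) (encS B) (encS cA) (encS cB) (encS Ah)
    (encS Bh) (encS A2) (encS B2) (256 ^ x.val)
    (256 ^ (x + y).val * (256 ^ n / 256 ^ x.val) % modulus n) = true := hc
  rw [e1, e2] at hc
  have hc : ih (encS A ||| (256 ^ x.val ||| 256 ^ n / 256 ^ x.val))
    (encS B ||| (256 ^ y.val ||| 256 ^ n / 256 ^ y.val)) (encS cA) (encS cB)
    (encS Ah ||| pairBits((256 ^ n), halfBit(T, q, (256 ^ x.val))))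
    (encS Bh ||| pairBits((256 ^ n), halfBit(T, q, (256 ^ y.val))))
    (encS A2 ||| double((modulus n), (256 ^ x.val ||| 256 ^ n / 256 ^ x.val)))
    (encS B2 ||| double((modulus n), (256 ^ y.val ||| 256 ^ n / 256 ^ y.val))) = true := hc
  rw [halfBit_eq hT, halfBit_eq hT] at hc
  have hc : ih (encS A ||| (256 ^ x.val ||| 256 ^ n / 256 ^ x.val))
    (encS B ||| (256 ^ y.val ||| 256 ^ n / 256 ^ y.val)) (encS cA) (encS cB)
    (encS Ah ||| (256 ^ (x * c).val ||| 256 ^ n / 256 ^ (x * c).val))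
    (encS Bh ||| (256 ^ (y * c).val ||| 256 ^ n / 256 ^ (y * c).val))
    (encS A2 ||| double((modulus n), (256 ^ x.val ||| 256 ^ n / 256 ^ x.val)))
    (encS B2 ||| double((modulus n), (256 ^ y.val ||| 256 ^ n / 256 ^ y.val))) = true := hc
  rw [e1, e3, e4, e5, encS_pair, encS_pair, encS_pair, encS_pair, double_eq (hne x hx0),
    double_eq (hne y hy0)] at hc
  simp only [encS_lor] at hc
  refine ⟨_, _, _, _, _, _, ?_, hc⟩
  exact {
    subA := union_pair_subset hF.neg_left h.subA hx
    subB := union_pair_subset hF.neg_right h.subB hy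
    supA := h.supA.trans (union_subset_union_left subset_union_left)
    supB := h.supB.trans (union_subset_union_left subset_union_left)
    negA := neg_mem_union_pair h.negA
    negB := neg_mem_union_pair h.negB
    fixA := fun z hz e => mem_union_left _ (h.fixA z hz e)
    fixB := fun z hz e => mem_union_left _ (h.fixB z hz e)
    half := half_mem_union_pair hc1 h.half
    half' := half_mem_union_pair hc1 h.half'
    dbl := double_mem_union_pair h.dbl
    dbl' := double_mem_union_pair h.dbl'
    unique := Or.inl hD }

end

/-! ### Soundness of the options and of the weight test. -/

section
variable {n : ℕ} [NeZero n] {X Y A B cA cB Ah Bh A2 B2 : Finset (ZMod n)}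

theorem conv_ind_singleton (f : ZMod n → ℕ) (g z : ZMod n) : conv f (ind {g}) z = f (z - g) := by
  unfold conv
  rw [sum_eq_single (z - g)]
  · simp [ind]
  · intro x _ hx
    have : z - x ≠ g := fun h => hx (by rw [← h]; ring)
    simp [ind, this]
  · simp

theorem pow_modEq_ind (g : ZMod n) : 256 ^ g.val ≡ enc (ind {g}) [MOD modulus n] := by
  rw [← encS_eq, encS_singleton]

theorem enc_mul_pow {v : ℕ} {f : ZMod n → ℕ} {g : ZMod n} (h : v ≡ 256 ^ g.val [MOD modulus n]) :
    enc f * v ≡ enc (fun z => f (z - g)) [MOD modulus n] := by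
  have := ((h.trans (pow_modEq_ind g)).mul_left (enc f)).trans (enc_mul _ _)
  simpa only [funext (conv_ind_singleton f g)] using this

theorem mul_eq_sums (hF : NearFactorization X Y) (hA : A ⊆ X) (hB : B ⊆ Y) :
    encS A * encS B % modulus n = encS (sums A B) := by
  rw [encS_eq, encS_eq, encS_eq, ← conv_eq_sums hF hA hB]
  apply mod_eq_enc _ (enc_mul _ _)
  intro z
  rw [conv_eq_sums hF hA hB]
  exact (ind_le _ _).trans (by norm_num)

theorem zero_not_mem_sums (hF : NearFactorization X Y) (hA : A ⊆ X) (hB : B ⊆ Y) :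
    0 ∉ sums A B := by
  intro h
  obtain ⟨a, ha, b, hb, e⟩ := mem_sums.1 h
  exact hF.add_ne_zero a (hA ha) b (hB hb) e

theorem opts_sound (hF : NearFactorization X Y) (hX : X.card ≤ 30) (hY : Y.card ≤ 30)
    (h : State X Y A B cA cB Ah Bh A2 B2) {T q : ℕ}
    (hT : DoubleUnique X Y → HalfTable n T q ∧ n % 2 = 1)
    (hdA : Disjoint A cA) (hdB : Disjoint B cB) {g : ZMod n} (hg : g ∉ sums A B) :
    ∃ O, opts((modulus n), (256 ^ n), (127 * enc (n := n) fun _ => 1), T, q, (encS A), (encS B),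
        (encS cA), (encS cB), (encS Ah), (encS Bh), (256 ^ g.val)) = encS O ∧
      ∀ x ∈ X, ∀ y ∈ Y, x + y = g → x ∈ O := by
  -- The inverse of 2 if n is odd. When doubles are not unique, the sets of halves are empty and the
  -- value of c does not matter.
  set c : ZMod n := (((n + 1) / 2 : ℕ) : ZMod n) with hcdef
  let fh : ZMod n → ℕ := fun z => conv (ind Ah) (ind Bh) (z - g * c)
  have cBh : Bh.card ≤ 30 := by
    rcases h.unique with hu | hu
    · refine le_trans ?_ ((card_le_card h.subB).trans hY)
      exact card_le_card_of_injOn (fun z => 2 * z) h.half' fun x _ y _ e => hu.inj x y e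
    · simp [hu.2.1]
  have e1 : encS Ah * encS Bh * halfBit(T, q, (256 ^ g.val)) ≡ enc fh [MOD modulus n] := by
    rcases h.unique with hu | hu
    · rw [halfBit_eq (hT hu).1]
      exact ((enc_mul _ _).mul_right _).trans (enc_mul_pow rfl)
    · have : fh = fun _ => 0 := by
        funext z; show conv (ind Ah) _ _ = 0; simp [hu.1, conv, ind]
      rw [this, hu.1, encS_empty]
      simp [enc, Nat.ModEq.refl]
  have e2 : encS B * (256 ^ n / 256 ^ g.val) ≡ enc (fun z => ind B (z + g)) [MOD modulus n] := by
    simpa only [sub_neg_eq_add, ← encS_eq] using enc_mul_pow (f := ind B) (pow_div_pow_modEq g)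
  have e3 : encS A * (256 ^ g.val * 256 ^ g.val) ≡ enc (fun z => ind A (z - (g + g)))
      [MOD modulus n] := enc_mul_pow (pow_val_add g g)
  let w : ZMod n → ℕ := fun z => fh z + (ind B (z + g) + ind A (z - (g + g)))
  have hw : ∀ z, w z ≤ 128 := by
    intro z
    have h1 : fh z ≤ Bh.card := conv_ind_le _ _ _
    have h2 := ind_le B (z + g)
    have h3 := ind_le A (z - (g + g))
    show _ + (_ + _) ≤ _
    omega
  have e4 : (encS Ah * encS Bh * halfBit(T, q, (256 ^ g.val)) + (encS B * (256 ^ n / 256 ^ g.val) +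
      encS A * (256 ^ g.val * 256 ^ g.val))) % modulus n = enc w := by
    apply mod_eq_enc (fun z => by have := hw z; omega)
    have : enc w = enc fh + (enc (fun z => ind B (z + g)) + enc fun z => ind A (z - (g + g))) := by
      rw [enc_add, enc_add]
    rw [this]
    exact e1.add (e2.add e3)
  let v : ZMod n → ℕ := fun z => ind (B ∪ cB) (z - g)
  have hv : ∀ z, v z ≤ 1 := fun z => ind_le _ _
  have e5 : encS (B ∪ cB) * 256 ^ g.val % modulus n = enc v :=
    mod_eq_enc (fun z => (hv z).trans (by norm_num)) (enc_mul_pow rfl)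
  refine ⟨((A ∪ cA).filter fun z => v z % 2 = 1).filter fun z => w z = 0, ?_, ?_⟩
  · rw [← encS_diff_supp _ hw, ← enc_land_ind _ (fun z => lt_of_le_of_lt (hv z) (by norm_num)),
      ← e4, ← e5, ← encS_add hdA, ← encS_add hdB]
    rfl
  · rintro x hx y hy rfl
    have key : ∀ a ∈ A, ∀ b ∈ B, x + y ≠ a + b := fun a ha b hb e =>
      hg (mem_sums.2 ⟨a, ha, b, hb, e.symm⟩)
    have g1 : fh x = 0 := by
      by_contra hc
      obtain ⟨a, ha, b, hb, e⟩ := conv_ind_ne_zero hc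
      have hu := h.unique.resolve_right (by rintro ⟨h0, _⟩; simp [h0] at ha)
      have h2c : 2 * c = 1 := by
        have : 2 * ((n + 1) / 2) = n + 1 := by have := (hT hu).2; omega
        rw [hcdef]
        have := congrArg (Nat.cast : ℕ → ZMod n) this
        push_cast at this ⊢
        rw [this]; simp
      have e' : x + -y = 2 * a + 2 * b := by linear_combination (-2) * e + (x + y) * h2c
      have i1 := hF.eq_left _ hx _ (hF.neg_right _ hy) _ (h.subA (h.half a ha)) _
        (h.subB (h.half' b hb)) e'
      refine key _ (h.half a ha) _ (h.negB _ (h.half' b hb)) ?_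
      linear_combination 2 * i1 - e'
    have g2 : ind B (x + (x + y)) = 0 := by
      by_contra hc
      have hb : x + (x + y) ∈ B := by by_contra h; simp [ind, h] at hc
      have i1 := hF.eq_left _ hx _ hy _ (hF.neg_left _ hx) _ (h.subB hb) (by ring)
      refine key x (h.fixA _ hx i1) _ hb ?_
      linear_combination i1.symm
    have g3 : ind A (x - (x + y + (x + y))) = 0 := by
      by_contra hc
      have ha : x - (x + y + (x + y)) ∈ A := by by_contra h; simp [ind, h] at hc
      have i1 := hF.eq_left _ hx _ hy _ (h.subA (h.negA _ ha)) _ (hF.neg_right _ hy) (by ring)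
      have i2 : y = -y := by linear_combination (-1) * i1
      refine key x ?_ _ (h.fixB _ hy i2) rfl
      rw [i1]; exact h.negA _ ha
    have g4 : v x = 1 := by
      show (if _ then 1 else 0) = 1
      rw [if_pos]
      have := h.supB (hF.neg_right _ hy)
      rwa [show x - (x + y) = -y by ring]
    refine mem_filter.2 ⟨mem_filter.2 ⟨h.supA hx, by rw [g4]⟩, ?_⟩
    show _ + (_ + _) = 0
    rw [g1, g2, g3]

theorem zero_check_sound (hn : n < 255) (hF : NearFactorization X Y)
    (h : State X Y A B cA cB Ah Bh A2 B2) (hdA : Disjoint A cA) (hdB : Disjoint B cB)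
    (hguard : Nat.ble (Nat.add (Nat.mod (Nat.add (encS A) (encS cA)) 255)
      (Nat.mul 3 (Nat.add (Nat.mod (encS A) 255) (Nat.mod (encS B) 255)))) 118 = true) :
    Nat.land (Nat.sub (128 * enc (n := n) fun _ => 1) weight((modulus n), (encS A), (encS B),
      (encS cA), (encS cB))) (128 * encS (univ \ (sums A B ∪ {0}))) = 0 := by
  have hcard : ∀ U : Finset (ZMod n), U.card < 255 := fun U =>
    lt_of_le_of_lt (card_le_univ U) (by rwa [ZMod.card])
  have hguard : A.card + cA.card + 3 * (A.card + B.card) ≤ 118 := by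
    have := Nat.le_of_ble_eq_true hguard
    change (encS A + encS cA) % 255 + 3 * (encS A % 255 + encS B % 255) ≤ 118 at this
    rwa [encS_add hdA, encS_mod_255 (hcard _), encS_mod_255 (hcard _), encS_mod_255 (hcard _),
      card_union_of_disjoint hdA] at this
  let fA : ZMod n → ℕ := fun x => 3 * ind A x + ind cA x
  let fB : ZMod n → ℕ := fun x => 3 * ind B x + ind cB x
  have hconv : ∀ z, conv fA fB z ≤ 127 := by
    intro z
    -- Known elements and candidates are disjoint, so each factor is 0, 1 or 3. Summing the bound
    -- gives 9 times a digit of A · B, which is at most 1, plus 3|A| + 3|B| + |cA|; this is at most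
    -- 9 + 118 = 127.
    have hb : ∀ x, fA x * fB (z - x) ≤
        9 * (ind A x * ind B (z - x)) + 3 * ind A x + 3 * ind B (z - x) + ind cA x := by
      intro x
      have i1 : ind A x + ind cA x ≤ 1 := by
        have : x ∈ A → x ∉ cA := fun h1 h2 => disjoint_left.1 hdA h1 h2
        unfold ind; split_ifs <;> simp_all
      have i2 : ind B (z - x) + ind cB (z - x) ≤ 1 := by
        have : z - x ∈ B → z - x ∉ cB := fun h1 h2 => disjoint_left.1 hdB h1 h2
        unfold ind; split_ifs <;> simp_all
      show (3 * ind A x + ind cA x) * (3 * ind B (z - x) + ind cB (z - x)) ≤ _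
      generalize ind A x = p at *
      generalize ind cA x = p' at *
      generalize ind B (z - x) = r at *
      generalize ind cB (z - x) = r' at *
      have : p ≤ 1 := by omega
      have : p' ≤ 1 := by omega
      have : r ≤ 1 := by omega
      have : r' ≤ 1 := by omega
      interval_cases p <;> interval_cases p' <;> interval_cases r <;> interval_cases r' <;> omega
    have hs : ∀ S : Finset (ZMod n), ∑ x, ind S x = S.card := fun S => by simp [ind]
    have hs' : ∑ x, ind B (z - x) = B.card := by
      rw [← hs B]
      exact Fintype.sum_equiv (Equiv.subLeft z) _ _ fun x => rfl
    calc conv fA fB z ≤ ∑ x, (9 * (ind A x * ind B (z - x)) + 3 * ind A x + 3 * ind B (z - x) +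
          ind cA x) := sum_le_sum fun x _ => hb x
      _ = 9 * conv (ind A) (ind B) z + 3 * A.card + 3 * B.card + cA.card := by
        rw [sum_add_distrib, sum_add_distrib, sum_add_distrib, ← mul_sum, ← mul_sum, ← mul_sum, hs,
          hs, hs']; rfl
      _ ≤ 127 := by
        rw [conv_eq_sums hF h.subA h.subB]
        have := ind_le (sums A B) z
        omega
  set w := conv fA fB
  have e2 : weight((modulus n), (encS A), (encS B), (encS cA), (encS cB)) = enc w := by
    show (3 * encS A + encS cA) * (3 * encS B + encS cB) % modulus n = _
    apply mod_eq_enc (fun z => (hconv z).trans (by norm_num))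
    rw [encS_eq, encS_eq, encS_eq, encS_eq, enc_smul, enc_smul, enc_add, enc_add]
    exact enc_mul _ _
  have e3 : (128 * enc (n := n) fun _ => 1) - enc w = enc fun z => 128 - w z := by
    rw [Nat.sub_eq_iff_eq_add, enc_add, ← enc_const_mul]
    · congr 1; funext z; have := hconv z; omega
    · rw [← enc_const_mul]; exact enc_mono fun z => by have := hconv z; omega
  rw [e2]
  show ((128 * enc (n := n) fun _ => 1) - enc w) &&& _ = 0
  rw [e3, encS_eq, enc_smul, enc_land (fun z => by omega) (fun z => by
    have := ind_le (univ \ (sums A B ∪ {0})) z; omega)]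
  have : (fun z => (128 - w z) &&& (128 * ind (univ \ (sums A B ∪ {0})) z)) =
      fun _ : ZMod n => 0 := by
    funext z
    by_cases hz : z ∈ sums A B ∪ {0}
    · have : ind (univ \ (sums A B ∪ {0})) z = 0 := by
        rw [ind, if_neg fun h => (mem_sdiff.1 h).2 hz]
      rw [this]; simp
    · have hz0 : z ≠ 0 := fun e => hz (mem_union_right _ (by simp [e]))
      obtain ⟨x, hx, y, hy, e⟩ := hF.exists_add z hz0
      have i1 : 1 ≤ fA x := by
        show 1 ≤ 3 * ind A x + ind cA x
        rcases mem_union.1 (h.supA hx) with hh | hh <;> simp [ind, hh] <;> omega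
      have i2 : 1 ≤ fB (z - x) := by
        show 1 ≤ 3 * ind B (z - x) + ind cB (z - x)
        rw [← e, add_sub_cancel_left]
        rcases mem_union.1 (h.supB hy) with hh | hh <;> simp [ind, hh] <;> omega
      have i3 : fA x * fB (z - x) ≤ w z :=
        single_le_sum (f := fun x => fA x * fB (z - x)) (fun _ _ => Nat.zero_le _) (mem_univ x)
      have hpos : 1 ≤ w z := by nlinarith
      have hlt : 128 - w z < 2 ^ 7 := by omega
      have : ind (univ \ (sums A B ∪ {0})) z = 1 := by
        rw [ind, if_pos (mem_sdiff.2 ⟨mem_univ z, hz⟩)]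
      rw [this]
      generalize 128 - w z = t at hlt
      rw [show 128 * 1 = 2 ^ 7 by norm_num, Nat.and_two_pow, Nat.testBit_lt_two_pow hlt]; simp
  rw [this]; simp [enc]

end

/-! ### Soundness of the search. -/

section
variable {n : ℕ} [NeZero n] {X Y A B cA cB Ah Bh A2 B2 : Finset (ZMod n)}

theorem branch_sound {ch : ChildStep} (hch : ChildSound X Y ch)
    (h : State X Y A B cA cB Ah Bh A2 B2) {ih : StateTest} {O : Finset (ZMod n)} {x y : ZMod n}
    (hx : x ∈ X) (hy : y ∈ Y) (hO : x ∈ O)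
    (hb : branch ch ih (encS A) (encS B) (encS cA) (encS cB) (encS Ah) (encS Bh) (encS A2)
      (encS B2) (256 ^ (x + y).val) (encS O) = true) :
    ∃ A' B' Ah' Bh' A2' B2', State X Y A' B' cA cB Ah' Bh' A2' B2' ∧
      ih (encS A') (encS B') (encS cA) (encS cB) (encS Ah') (encS Bh') (encS A2') (encS B2') =
        true :=
  hch A B cA cB Ah Bh A2 B2 h x hx y hy ih (allBits_sound _ hb x hO)

/-- The data of a search are suitable for finding `X` and `Y`. -/
structure SearchData (X Y : Finset (ZMod n)) (T q : ℕ) (ch : ChildStep)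
    (capA capB : CandidateStep) : Prop where
  lt : n < 255
  near : NearFactorization X Y
  card_left : X.card ≤ 30
  card_right : Y.card ≤ 30
  table : DoubleUnique X Y → HalfTable n T q ∧ n % 2 = 1
  child : ChildSound X Y ch
  caps_left : CandidateSound X capA
  caps_right : CandidateSound Y capB

variable {T q : ℕ} {ch : ChildStep} {capA capB : CandidateStep} {ts : List ℕ}
  {leaf : ℕ → ℕ → Bool}

theorem select_sound (hs : SearchData X Y T q ch capA capB) {ih : StateTest}
    (hih : ∀ A B cA cB Ah Bh A2 B2, State X Y A B cA cB Ah Bh A2 B2 →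
      ih (encS A) (encS B) (encS cA) (encS cB) (encS Ah) (encS Bh) (encS A2) (encS B2) = true →
      leaf (encS X) (encS Y) = true)
    (h : State X Y A B cA cB Ah Bh A2 B2) (hdA : Disjoint A cA) (hdB : Disjoint B cB) {G : ℕ}
    (hG : (univ \ (sums A B ∪ {0})).Nonempty → ∃ g : ZMod n, G = 256 ^ g.val)
    (hc : select (modulus n) (256 ^ n) (enc (n := n) fun _ => 1) (127 * enc (n := n) fun _ => 1)
      T q ch leaf ih (encS A) (encS B) (encS cA) (encS cB) (encS Ah) (encS Bh) (encS A2) (encS B2)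
      (encS (sums A B)) G = true) : leaf (encS X) (encS Y) = true := by
  have hF := hs.near
  have h0 := zero_not_mem_sums hF h.subA h.subB
  have e1 : encS (sums A B) + 1 = encS (sums A B ∪ {0}) := by
    rw [← encS_add (by simpa using h0), encS_singleton]; simp
  rcases bool_rec_true hc with ⟨h3, h4⟩ | ⟨hc1, h2⟩
  · have h3 : encS (sums A B) + 1 = enc (n := n) fun _ => 1 := Nat.eq_of_beq_eq_true h3
    have hu : sums A B ∪ {0} = univ := by
      apply encS_inj
      rw [← e1, h3, encS_eq]; congr 1; funext z; simp [ind]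
    have hcov : ∀ z, z ≠ 0 → z ∈ sums A B := fun z hz =>
      (mem_union.1 (hu ▸ mem_univ z)).resolve_right (by simpa using hz)
    -- For x in X and any y in Y, the nonzero residue x + y is a sum of known elements; uniqueness
    -- of the representation makes x one of them.
    have hA : A = X := by
      refine Subset.antisymm h.subA fun x hx => ?_
      obtain ⟨y, hy⟩ := hF.right_nonempty
      obtain ⟨a, ha, b, hb, e⟩ := mem_sums.1 (hcov _ (hF.add_ne_zero x hx y hy))
      rw [hF.eq_left x hx y hy a (h.subA ha) b (h.subB hb) e.symm]; exact ha
    have hB : B = Y := by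
      refine Subset.antisymm h.subB fun y hy => ?_
      obtain ⟨x, hx⟩ := hF.left_nonempty
      obtain ⟨a, ha, b, hb, e⟩ := mem_sums.1 (hcov _ (hF.add_ne_zero x hx y hy))
      have := hF.eq_left x hx y hy a (h.subA ha) b (h.subB hb) e.symm
      rw [this] at e
      rw [← add_left_cancel e]; exact hb
    rw [← hA, ← hB]; exact h4

  · have hc0 : encS (sums A B) + 1 ≠ enc (n := n) fun _ => 1 := fun e => by
      have : Nat.beq (encS (sums A B) + 1) (enc (n := n) fun _ => 1) = false := hc1
      rw [e, Nat.beq_refl] at this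
      exact absurd this (by simp)
    rcases bool_rec_true h2 with ⟨h3, h4⟩ | ⟨-, h4⟩
    · obtain ⟨g, rfl⟩ := hG (by
        by_contra hne
        rw [not_nonempty_iff_eq_empty, sdiff_eq_empty_iff_subset] at hne
        apply hc0
        rw [e1, univ_subset_iff.1 hne, encS_eq]; congr 1; funext z; simp [ind])
      have h3 : (encS (sums A B) + 1) &&& 256 ^ g.val = 0 := Nat.eq_of_beq_eq_true h3
      rw [e1, ← encS_singleton, encS_land, encS_eq_zero] at h3
      have hg : g ∉ sums A B ∪ {0} := fun hg => by
        have : g ∈ (sums A B ∪ {0}) ∩ {g} := mem_inter.2 ⟨hg, mem_singleton_self g⟩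
        rw [h3] at this; exact notMem_empty _ this
      have hg1 : g ∉ sums A B := fun h => hg (mem_union_left _ h)
      have hg0 : g ≠ 0 := fun h => hg (mem_union_right _ (by simp [h]))
      obtain ⟨O, hO, hmem⟩ := opts_sound hF hs.card_left hs.card_right h hs.table hdA hdB hg1
      rw [hO] at h4
      obtain ⟨x, hx, y, hy, e⟩ := hF.exists_add g hg0
      have hxO := hmem x hx y hy e
      rw [← e] at h4
      obtain ⟨A', B', Ah', Bh', A2', B2', h', hk⟩ := branch_sound hs.child h hx hy hxO h4
      exact hih _ _ _ _ _ _ _ _ h' hk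
    · exact absurd h4 (by simp)

theorem weigh_sound (hs : SearchData X Y T q ch capA capB) {ih : StateTest}
    (hih : ∀ A B cA cB Ah Bh A2 B2, State X Y A B cA cB Ah Bh A2 B2 →
      ih (encS A) (encS B) (encS cA) (encS cB) (encS Ah) (encS Bh) (encS A2) (encS B2) = true →
      leaf (encS X) (encS Y) = true)
    (h : State X Y A B cA cB Ah Bh A2 B2) (hdA : Disjoint A cA) (hdB : Disjoint B cB)
    (hc : afterCaps (modulus n) (256 ^ n) (enc (n := n) fun _ => 1)
      (127 * enc (n := n) fun _ => 1) (128 * enc (n := n) fun _ => 1) T q ts ch leaf ih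
      (encS A) (encS Ah) (encS Bh) (encS A2) (encS B2) (encS (sums A B)) (encS cA) (encS B)
      (encS cB) = true) : leaf (encS X) (encS Y) = true := by
  have hU : uncovered((128 * enc (n := n) fun _ => 1), (encS (sums A B))) =
      128 * encS (univ \ (sums A B ∪ {0})) := by
    have h0 := zero_not_mem_sums hs.near h.subA h.subB
    have e1 : encS (sums A B) + 1 = encS (sums A B ∪ {0}) := by
      rw [← encS_add (by simpa using h0), encS_singleton]; simp
    have e2 : encS (sums A B ∪ {0}) + encS (univ \ (sums A B ∪ {0})) =
        enc (n := n) fun _ => 1 := by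
      rw [encS_add disjoint_sdiff, union_sdiff_of_subset (subset_univ _), encS_eq]
      congr 1; funext z; simp [ind]
    have e3 : ∀ p r : ℕ, 128 * (p + r) - 128 * p = 128 * r := by omega
    simp only [Nat.sub_eq, Nat.mul_eq, Nat.add_eq]
    rw [e1, ← e2, e3]
  have key : ∀ W, select (modulus n) (256 ^ n) (enc (n := n) fun _ => 1)
      (127 * enc (n := n) fun _ => 1) T q ch leaf ih (encS A) (encS B) (encS cA) (encS cB)
      (encS Ah) (encS Bh) (encS A2) (encS B2) (encS (sums A B))
      (pickBit (128 * encS (univ \ (sums A B ∪ {0}))) W ts) = true → leaf (encS X) (encS Y) = true := by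
    intro W hW
    exact select_sound hs hih h hdA hdB (fun hV => pickBit_eq hV W ts) hW
  unfold afterCaps at hc
  rw [hU] at hc
  rcases bool_rec_true hc with ⟨h1, h2⟩ | ⟨-, h2⟩
  · have hz := zero_check_sound hs.lt hs.near h hdA hdB h1
    rw [hz] at h2
    exact key _ h2
  · exact key _ h2

theorem search_sound (hs : SearchData X Y T q ch capA capB) (fuel : ℕ) :
    ∀ A B cA cB Ah Bh A2 B2, State X Y A B cA cB Ah Bh A2 B2 →
      search (modulus n) (256 ^ n) (enc (n := n) fun _ => 1) (encS (univ.erase (0 : ZMod n)))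
        (127 * enc (n := n) fun _ => 1) (128 * enc (n := n) fun _ => 1) T q ts ch capA capB leaf
        fuel (encS A) (encS B) (encS cA) (encS cB) (encS Ah) (encS Bh) (encS A2) (encS B2) = true →
      leaf (encS X) (encS Y) = true := by
  induction fuel with
  | zero => intro A B cA cB Ah Bh A2 B2 _ hc; exact absurd hc (by simp [search])
  | succ fuel ih =>
    intro A B cA cB Ah Bh A2 B2 h hc
    have hF := hs.near
    have hC := mul_eq_sums hF h.subA h.subB
    have hC' : encS B * encS A % modulus n = encS (sums A B) := by rw [mul_comm, hC]
    change propagate _ _ _ _ _ _ _ _ _ _ _ _ _ (search _ _ _ _ _ _ _ _ _ _ _ _ _ fuel) _ _ _ _ _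
      _ _ _ (encS A * encS B % modulus n) = true at hc
    rw [hC] at hc
    rcases bool_rec_true hc with ⟨-, h2⟩ | ⟨h1, -⟩
    · obtain ⟨cA', hA', -, hdA, hXA⟩ := prune_sound hF hs.card_left hs.card_right h
      obtain ⟨cB', hB', -, hdB, hYB⟩ := prune_sound hF.symm hs.card_right hs.card_left h.symm
      have hsw : sums B A = sums A B := by
        ext z; rw [mem_sums, mem_sums]
        constructor <;> rintro ⟨a, ha, b, hb, e⟩ <;> exact ⟨b, hb, a, ha, by rw [add_comm, e]⟩
      rw [hsw] at hB'
      rw [hA', hB'] at h2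
      obtain ⟨cA'', hdA2, hXA2, h3⟩ := hs.caps_left A cA' h.subA hXA hdA _ h2
      obtain ⟨cB'', hdB2, hYB2, h4⟩ := hs.caps_right B cB' h.subB hYB hdB _ h3
      exact weigh_sound hs ih (h.of_candidates hXA2 hYB2) hdA2 hdB2 h4
    -- Parts of a near-factorization have distinct nonzero sums, so the consistency test cannot
    -- fail.
    · exfalso
      have : encS (sums A B) &&& encS (univ.erase (0 : ZMod n)) = encS (sums A B) := by
        rw [encS_land]; congr 1
        refine inter_eq_left.2 fun z hz => mem_erase.2 ⟨?_, mem_univ z⟩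
        rintro rfl
        exact zero_not_mem_sums hF h.subA h.subB hz
      have h1 : Nat.beq (encS (sums A B) &&& encS (univ.erase (0 : ZMod n)))
        (encS (sums A B)) = false := h1
      rw [this, Nat.beq_refl] at h1
      exact absurd h1 (by simp)

theorem encS_land_nat (O : Finset (ZMod n)) (m : ℕ) :
    encS O &&& m = encS (O.filter fun x => m.testBit (8 * x.val) = true) := by
  apply eq_of_testBit_digits
  intro i j hj
  rw [Nat.testBit_land, encS, encS, enc_testBit_nat (ind_lt O) _ _ hj,
    enc_testBit_nat (ind_lt _) _ _ hj]
  by_cases hi : i < n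
  · have hv : ((i : ZMod n)).val = i := ZMod.val_natCast_of_lt hi
    rcases Nat.eq_zero_or_pos j with rfl | hj0
    · by_cases hO : (i : ZMod n) ∈ O <;> by_cases hm : m.testBit (8 * i) = true <;>
        simp [hi, hO, mem_filter, hv, hm]
    · have : (1 : ℕ).testBit j = false := Nat.testBit_lt_two_pow (Nat.one_lt_two_pow hj0.ne')
      by_cases hO : (i : ZMod n) ∈ O <;> simp [hi, hO, mem_filter, hv, this] <;>
        split_ifs <;> simp [this]
  · simp [hi]

theorem searchChunk_sound (hs : SearchData X Y T q ch capA capB)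
    (h : State X Y A B cA cB Ah Bh A2 B2) (hdA : Disjoint A cA) (hdB : Disjoint B cB)
    {x y : ZMod n} (hx : x ∈ X) (hy : y ∈ Y) (hg : x + y ∉ sums A B) {mask : ℕ}
    (hm : mask.testBit (8 * x.val) = true)
    (hc : searchChunk (modulus n) (256 ^ n) (enc (n := n) fun _ => 1)
      (encS (univ.erase (0 : ZMod n))) (127 * enc (n := n) fun _ => 1)
      (128 * enc (n := n) fun _ => 1) T q ts ch capA capB leaf (encS A) (encS B) (encS cA) (encS cB)
      (encS Ah) (encS Bh) (encS A2) (encS B2) (256 ^ (x + y).val) mask = true) :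
    leaf (encS X) (encS Y) = true := by
  obtain ⟨O, hO, hmem⟩ := opts_sound hs.near hs.card_left hs.card_right h hs.table hdA hdB hg
  have hxO := hmem x hx y hy rfl
  change branch _ _ _ _ _ _ _ _ _ _ _ (Nat.land _ mask) = true at hc
  rw [hO] at hc
  rw [show Nat.land (encS O) mask = _ from encS_land_nat O mask] at hc
  obtain ⟨A', B', Ah', Bh', A2', B2', h', hk⟩ :=
    branch_sound hs.child h hx hy (mem_filter.2 ⟨hxO, hm⟩) hc
  exact search_sound hs 20 _ _ _ _ _ _ _ _ h' hk

end

/-! ### Running the search -/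

/-- Pass on an evaluated number: the kernel reduces `v + 1` to a literal. -/
noncomputable def forceNat (v : ℕ) (k : ℕ → Bool) : Bool :=
  Nat.rec (motive := fun _ => Bool) false (fun m _ => k m) (v + 1)

noncomputable def forceList : List ℕ → (List ℕ → Bool) → Bool :=
  List.rec (motive := fun _ => (List ℕ → Bool) → Bool) (fun k => k [])
    (fun v _ ih k => forceNat v fun m => ih fun l => k (m :: l))

theorem forceNat_eq (v : ℕ) (k : ℕ → Bool) : forceNat v k = k v := rfl

theorem forceList_eq (l : List ℕ) (k : List ℕ → Bool) : forceList l k = k l := by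
  induction l generalizing k with
  | nil => rfl
  | cons v l ih => exact ih _

/-- The encoding of the set of residues in a list. -/
def encL (n : ℕ) (l : List ℕ) : ℕ := l.foldr (fun i r => Nat.lor (Nat.pow 256 (Nat.mod i n)) r) 0

/-- The cardinality conditions given by lists of residues and their numbers of elements. -/
noncomputable def capsOf (n : ℕ) : List (List ℕ × ℕ) → CandidateStep
  | [] => fun k => k
  | p :: l => fun k => capStep (encL n p.1) p.2 (capsOf n l k)

noncomputable def forceCaps (n : ℕ) : List (List ℕ × ℕ) → (CandidateStep → Bool) → Bool
  | [], k => k fun k => k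
  | p :: l, k => forceNat (encL n p.1) fun m => forceNat p.2 fun c =>
      forceCaps n l fun cap => k fun k => capStep m c (cap k)

theorem forceCaps_eq (n : ℕ) (l : List (List ℕ × ℕ)) (k : CandidateStep → Bool) :
    forceCaps n l k = k (capsOf n l) := by
  induction l generalizing k with
  | nil => rfl
  | cons p l ih => exact ih _

/-- The residues `± i`. -/
def symL (n : ℕ) (l : List ℕ) : List ℕ := l.flatMap fun i => [i, n - i % n]

/-- Increasing thresholds for the choice of an element with few representations. -/
def thresholds (ones : ℕ) : List ℕ :=
  ((List.range 40).map (· + 1) ++ [44, 48, 56, 64, 80, 96, 127]).map fun t =>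
    Nat.mul ones (Nat.add 128 t)

def hasBits (n A u : ℕ) (l : List ℕ) : Bool :=
  l.all fun i => Nat.beq (Nat.mod (Nat.shiftRight A (Nat.mul 8 (Nat.mod (Nat.mul u i) n))) 2) 1

/-- `A, B` represent a unit multiple of one of the given pairs, possibly interchanged. -/
def leafCheck (n : ℕ) (rows : List (List ℕ × List ℕ)) (A B : ℕ) : Bool :=
  (List.range n).any fun u => Nat.beq (Nat.gcd u n) 1 && rows.any fun r =>
    (hasBits n A u r.1 && hasBits n B u r.2) || (hasBits n B u r.1 && hasBits n A u r.2)

noncomputable def runCore (ch : ℕ → ℕ → ℕ → ChildStep) (n T q : ℕ)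
    (capA capB : List (List ℕ × ℕ)) (rows : List (List ℕ × List ℕ))
    (A B Ah Bh A2 B2 g mask : ℕ) : Bool :=
  forceNat (Nat.pow 256 n) fun N => forceNat (Nat.sub N 1) fun M =>
  forceNat (Nat.div M 255) fun ones => forceNat (Nat.sub ones 1) fun ones1 =>
  forceNat (Nat.mul 127 ones) fun K => forceNat (Nat.mul 128 ones) fun K1 =>
  forceNat T fun T => forceNat A fun A => forceNat B fun B => forceNat Ah fun Ah =>
  forceNat Bh fun Bh => forceNat A2 fun A2 => forceNat B2 fun B2 =>
  forceNat diff(ones1, A) fun cA => forceNat diff(ones1, B) fun cB =>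
  forceNat (Nat.pow 256 g) fun G => forceNat mask fun mask =>
  forceNat (Nat.mod (Nat.mul A B) M) fun C =>
  forceList (thresholds ones) fun ts => forceCaps n capA fun capA => forceCaps n capB fun capB =>
  ifB(Nat.beq (Nat.land C G) 0,
    capA (fun _ cA => capB (fun _ cB => forceNat cA fun cA => forceNat cB fun cB =>
      searchChunk M N ones ones1 K K1 T q ts (ch M N T) capA capB (leafCheck n rows)
        A B cA cB Ah Bh A2 B2 G mask) B prune(M,K,cB,C,B,A,B2,A2,Bh,Ah))
      A prune(M,K,cA,C,A,B,A2,B2,Ah,Bh), false)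

/-- The residues modulo `n` that are `j` modulo `J`. -/
def residues (n J j : ℕ) : List ℕ := (List.range n).filter fun i => Nat.beq (Nat.mod i J) j

/-- A table of the exponents of the bits of the halves. -/
def halfTable (n q : ℕ) : ℕ :=
  (List.range n).foldr (fun i r => Nat.lor (Nat.shiftLeft (8 * (i * ((n + 1) / 2) % n))
    (Nat.mul 16 (Nat.mod (Nat.pow 256 i) q))) r) 0

/-- The part with index `j < J` of the search for `n` odd below `lA, lB`. -/
noncomputable def runOdd (n q : ℕ) (capA capB : List (List ℕ × ℕ))
    (rows : List (List ℕ × List ℕ)) (lA lB : List ℕ) (g J j : ℕ) : Bool :=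
  runCore (fun M N T => oddChild M N T q) n (halfTable n q) q capA capB rows
    (encL n (symL n lA)) (encL n (symL n lB))
    (encL n ((symL n lA).map (· * ((n + 1) / 2)))) (encL n ((symL n lB).map (· * ((n + 1) / 2))))
    (encL n ((symL n lA).map (2 * ·))) (encL n ((symL n lB).map (2 * ·))) g
    (encL n (residues n J j))

/-- The part with index `j < J` of the search for `n` even below `lA, lB`. -/
noncomputable def runEven (n : ℕ) (capA capB : List (List ℕ × ℕ))
    (rows : List (List ℕ × List ℕ)) (lA lB : List ℕ) (g J j : ℕ) : Bool :=
  runCore (fun M N _ => evenChild M N) n 0 1 capA capB rows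
    (encL n (symL n lA)) (encL n (symL n lB)) 0 0 0 0 g (encL n (residues n J j))

section
variable {n : ℕ} [NeZero n] {X Y A B cA cB Ah Bh A2 B2 : Finset (ZMod n)}

/-- The set of residues in a list. -/
def listSet (n : ℕ) (l : List ℕ) : Finset (ZMod n) := (l.map (Nat.cast : ℕ → ZMod n)).toFinset

omit [NeZero n] in
theorem mem_listSet {l : List ℕ} {x : ZMod n} : x ∈ listSet n l ↔ ∃ i ∈ l, (i : ZMod n) = x := by
  simp [listSet]

theorem encL_eq (l : List ℕ) : encL n l = encS (listSet n l) := by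
  induction l with
  | nil => simp [encL, listSet, encS_empty]
  | cons i l ih =>
    show 256 ^ (i % n) ||| encL n l = _
    rw [ih, ← ZMod.val_natCast, ← encS_singleton, encS_lor]
    congr 1; simp [listSet]

theorem testBit_encL (l : List ℕ) (x : ZMod n) :
    (encL n l).testBit (8 * x.val) = decide (x ∈ listSet n l) := by
  rw [encL_eq, encS]
  have := enc_testBit_nat (ind_lt (listSet n l)) x.val 0 (by norm_num)
  rw [add_zero] at this
  rw [this]
  by_cases h : x ∈ listSet n l <;> simp [h, ZMod.val_lt x]

omit [NeZero n] in
theorem mem_symL {l : List ℕ} {x : ZMod n} [NeZero n] :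
    x ∈ listSet n (symL n l) ↔ ∃ i ∈ l, x = i ∨ x = -(i : ZMod n) := by
  rw [mem_listSet]
  have key : ∀ i : ℕ, ((n - i % n : ℕ) : ZMod n) = -(i : ZMod n) := fun i => by
    rw [Nat.cast_sub (Nat.mod_lt _ (NeZero.pos n)).le]; simp
  simp only [symL, List.mem_flatMap, List.mem_cons, List.not_mem_nil, or_false]
  constructor
  · rintro ⟨k, ⟨i, hi, rfl | rfl⟩, rfl⟩
    · exact ⟨_, hi, Or.inl rfl⟩
    · exact ⟨_, hi, Or.inr (key i)⟩
  · rintro ⟨i, hi, rfl | rfl⟩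
    · exact ⟨i, ⟨i, hi, Or.inl rfl⟩, rfl⟩
    · exact ⟨_, ⟨i, hi, Or.inr rfl⟩, key i⟩

theorem neg_mem_symL {l : List ℕ} : ∀ x ∈ listSet n (symL n l), -x ∈ listSet n (symL n l) := by
  intro x hx
  obtain ⟨i, hi, h⟩ := mem_symL.1 hx
  refine mem_symL.2 ⟨i, hi, ?_⟩
  rcases h with rfl | rfl
  · exact Or.inr rfl
  · exact Or.inl (neg_neg _)

theorem symL_subset {l : List ℕ} (hX : ∀ x ∈ X, -x ∈ X) (hl : ∀ i ∈ l, (i : ZMod n) ∈ X) :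
    listSet n (symL n l) ⊆ X := by
  intro x hx
  obtain ⟨i, hi, rfl | rfl⟩ := mem_symL.1 hx
  · exact hl i hi
  · exact hX _ (hl i hi)

theorem capsOf_sound (hn : n < 255) {l : List (List ℕ × ℕ)}
    (h : ∀ p ∈ l, (X ∩ listSet n p.1).card = p.2) : CandidateSound X (capsOf n l) := by
  induction l with
  | nil => intro A cA _ hX hd k hk; exact ⟨cA, hd, hX, hk⟩
  | cons p l ih =>
    have h1 : CandidateSound X (capStep (encL n p.1) p.2) := by
      rw [encL_eq]; exact capStep_sound hn (h p (by simp))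
    exact h1.comp (ih fun p hp => h p (by simp [hp]))

theorem hasBits_sound {u : ℕ} {l : List ℕ} (h : hasBits n (encS X) u l = true) :
    ∀ i ∈ l, (u * i : ZMod n) ∈ X := by
  intro i hi
  have := List.all_eq_true.1 h i hi
  have h1 : (encS X >>> (8 * (u * i % n))) % 2 = 1 := Nat.eq_of_beq_eq_true this
  have h2 : (encS X).testBit (8 * (u * i % n)) = true := by
    rw [Nat.testBit_eq_decide_div_mod_eq, ← Nat.shiftRight_eq_div_pow, h1]; simp
  have h3 := enc_testBit_nat (ind_lt X) (u * i % n) 0 (by norm_num)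
  rw [add_zero, ← encS, h2] at h3
  by_contra hc
  rw [if_neg (by simpa using hc)] at h3
  simp at h3

/-- `X, Y` contain unit multiples of one of the given pairs, possibly interchanged. -/
def ContainsRow (X Y : Finset (ZMod n)) (rows : List (List ℕ × List ℕ)) : Prop :=
  ∃ u : ℕ, Nat.Coprime u n ∧ ∃ r ∈ rows,
    ((∀ i ∈ r.1, (u * i : ZMod n) ∈ X) ∧ ∀ i ∈ r.2, (u * i : ZMod n) ∈ Y) ∨
    ((∀ i ∈ r.1, (u * i : ZMod n) ∈ Y) ∧ ∀ i ∈ r.2, (u * i : ZMod n) ∈ X)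

theorem leafCheck_sound {rows : List (List ℕ × List ℕ)}
    (h : leafCheck n rows (encS X) (encS Y) = true) : ContainsRow X Y rows := by
  obtain ⟨u, -, hu⟩ := List.any_eq_true.1 h
  obtain ⟨h1, h2⟩ := Bool.and_eq_true_iff.1 hu
  obtain ⟨r, hr, h3⟩ := List.any_eq_true.1 h2
  refine ⟨u, Nat.eq_of_beq_eq_true h1, r, hr, ?_⟩
  rcases Bool.or_eq_true_iff.1 h3 with h | h <;> obtain ⟨ha, hb⟩ := Bool.and_eq_true_iff.1 h
  · exact Or.inl ⟨hasBits_sound ha, hasBits_sound hb⟩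
  · exact Or.inr ⟨hasBits_sound ha, hasBits_sound hb⟩

theorem ones_eq : (256 ^ n - 1) / 255 = enc (n := n) fun _ => 1 := by
  rw [show 256 ^ n - 1 = modulus n from rfl, modulus_eq, enc_const_mul,
    Nat.mul_div_cancel_left _ (by norm_num)]

theorem ones_sub_one : (enc (n := n) fun _ => 1) - 1 = encS (univ.erase (0 : ZMod n)) := by
  have : enc (n := n) (fun _ => 1) = encS (univ.erase (0 : ZMod n)) + 1 := by
    have e : encS {(0 : ZMod n)} = 1 := by rw [encS_singleton]; simp
    conv_rhs => rw [← e]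
    rw [encS_add (by simp), encS_eq]
    congr 1; funext z
    by_cases hz : z = 0 <;> simp [ind, hz]
  omega

theorem runCore_sound {T q : ℕ} {ch : ℕ → ℕ → ℕ → ChildStep} {capA capB : List (List ℕ × ℕ)}
    {rows : List (List ℕ × List ℕ)}
    (hs : SearchData X Y T q (ch (modulus n) (256 ^ n) T) (capsOf n capA) (capsOf n capB))
    (h : State X Y A B (univ.erase 0 \ A) (univ.erase 0 \ B) Ah Bh A2 B2) {g J : ℕ}
    (hJ : 0 < J) (hg0 : 0 < g) (hgn : g < n)
    (hc : ∀ j < J, runCore ch n T q capA capB rows (encS A) (encS B) (encS Ah) (encS Bh) (encS A2)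
      (encS B2) g (encL n (residues n J j)) = true) : ContainsRow X Y rows := by
  have hgv : ((g : ℕ) : ZMod n).val = g := ZMod.val_natCast_of_lt hgn
  have hgz : (g : ZMod n) ≠ 0 := fun e => by rw [e, ZMod.val_zero] at hgv; omega
  obtain ⟨x, hx, y, hy, e⟩ := hs.near.exists_add _ hgz
  -- The first summand of the residue represented first decides which of the J parts of the search
  -- concerns the given pair.
  have hj := hc (x.val % J) (Nat.mod_lt _ hJ)
  rw [← hgv, ← e] at hj
  unfold runCore at hj
  simp only [forceNat_eq, forceList_eq, forceCaps_eq] at hj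
  rcases bool_rec_true hj with ⟨h1, h2⟩ | ⟨-, h2⟩
  · have hC : (Nat.mul (encS A) (encS B)).mod (((256 : ℕ).pow n).sub 1) = encS (sums A B) :=
      mul_eq_sums hs.near h.subA h.subB
    rw [hC] at h1 h2
    have h1 : encS (sums A B) &&& 256 ^ (x + y).val = 0 := Nat.eq_of_beq_eq_true h1
    rw [← encS_singleton, encS_land, encS_eq_zero] at h1
    have hg : x + y ∉ sums A B := fun hg => by
      have : x + y ∈ sums A B ∩ {x + y} := mem_inter.2 ⟨hg, mem_singleton_self _⟩
      rw [h1] at this; exact notMem_empty _ this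
    have e1 : ((256 : ℕ).pow n).sub 1 = modulus n := rfl
    have e2 : (modulus n).div 255 = enc (n := n) fun _ => 1 := ones_eq
    have e3 : (enc (n := n) fun _ => 1).sub 1 = encS (univ.erase (0 : ZMod n)) := ones_sub_one
    rw [e1, e2, e3] at h2
    have e4 : ∀ S, (encS (univ.erase (0 : ZMod n))).xor ((encS (univ.erase (0 : ZMod n))).land
      (encS S)) = encS (univ.erase 0 \ S) := fun S => encS_xor_land _ _
    rw [e4, e4] at h2
    have hF := hs.near
    obtain ⟨cA', hA', -, hdA, hXA⟩ := prune_sound hF hs.card_left hs.card_right h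
    obtain ⟨cB', hB', -, hdB, hYB⟩ := prune_sound hF.symm hs.card_right hs.card_left h.symm
    have hsw : sums B A = sums A B := by
      ext z; rw [mem_sums, mem_sums]
      constructor <;> rintro ⟨a, ha, b, hb, e⟩ <;> exact ⟨b, hb, a, ha, by rw [add_comm, e]⟩
    rw [hsw] at hB'
    have e5 : Nat.mul 127 (enc (n := n) fun _ => 1) = 127 * enc (n := n) fun _ => 1 := rfl
    rw [e5, hA', hB'] at h2
    obtain ⟨cA'', hdA2, hXA2, h3⟩ := hs.caps_left A cA' h.subA hXA hdA _ h2
    obtain ⟨cB'', hdB2, hYB2, h4⟩ := hs.caps_right B cB' h.subB hYB hdB _ h3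
    refine leafCheck_sound (searchChunk_sound hs (h.of_candidates hXA2 hYB2) hdA2 hdB2 hx hy hg
      ?_ h4)
    rw [testBit_encL, decide_eq_true_iff, mem_listSet]
    refine ⟨x.val, List.mem_filter.2 ⟨List.mem_range.2 (ZMod.val_lt x), ?_⟩, ZMod.natCast_zmod_val x⟩
    exact Nat.beq_refl _
  · exact absurd h2 (by simp)

theorem subset_union_erase_sdiff (h : ∀ x ∈ X, x = -x → x ∈ A) : X ⊆ A ∪ (univ.erase 0 \ A) := by
  intro x hx
  by_cases hA : x ∈ A
  · exact mem_union_left _ hA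
  · refine mem_union_right _ (mem_sdiff.2 ⟨mem_erase.2 ⟨?_, mem_univ x⟩, hA⟩)
    rintro rfl
    exact hA (h 0 hx (by simp))

theorem runOdd_sound (hF : NearFactorization X Y) (hD : DoubleUnique X Y) {q : ℕ}
    (hn : n < 255) (hX : X.card ≤ 30) (hY : Y.card ≤ 30) (hodd : n % 2 = 1)
    (hT : HalfTable n (halfTable n q) q) {capA capB : List (List ℕ × ℕ)}
    (hA : ∀ p ∈ capA, (X ∩ listSet n p.1).card = p.2)
    (hB : ∀ p ∈ capB, (Y ∩ listSet n p.1).card = p.2) {lA lB : List ℕ}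
    (hlA : ∀ i ∈ lA, (i : ZMod n) ∈ X) (hlB : ∀ i ∈ lB, (i : ZMod n) ∈ Y)
    (hX0 : 0 ∉ X) (hY0 : 0 ∉ Y) {rows : List (List ℕ × List ℕ)} {g J : ℕ}
    (hJ : 0 < J) (hg0 : 0 < g) (hgn : g < n)
    (hc : ∀ j < J, runOdd n q capA capB rows lA lB g J j = true) : ContainsRow X Y rows := by
  have h2 : (2 : ZMod n) * (((n + 1) / 2 : ℕ) : ZMod n) = 1 := by
    have : 2 * ((n + 1) / 2) = n + 1 := by omega
    have := congrArg (Nat.cast : ℕ → ZMod n) this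
    push_cast at this ⊢
    rw [this]; simp
  have hfix : ∀ Z : Finset (ZMod n), 0 ∉ Z → ∀ A : Finset (ZMod n), ∀ x ∈ Z, x = -x → x ∈ A := by
    intro Z h0 A x hx e
    have : x = 0 := hD.inj _ _ (by linear_combination e)
    exact absurd (this ▸ hx) h0
  have hhalf : ∀ l : List ℕ, ∀ z ∈ listSet n ((symL n l).map (· * ((n + 1) / 2))),
      2 * z ∈ listSet n (symL n l) := by
    intro l z hz
    obtain ⟨i, hi, rfl⟩ := mem_listSet.1 hz
    obtain ⟨k, hk, rfl⟩ := List.mem_map.1 hi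
    refine mem_listSet.2 ⟨k, hk, ?_⟩
    rw [Nat.cast_mul]; linear_combination (-(k : ZMod n)) * h2
  have hdbl : ∀ l : List ℕ, ∀ z ∈ listSet n ((symL n l).map (2 * ·)),
      ∃ x ∈ listSet n (symL n l), z = 2 * x := by
    intro l z hz
    obtain ⟨i, hi, rfl⟩ := mem_listSet.1 hz
    obtain ⟨k, hk, rfl⟩ := List.mem_map.1 hi
    exact ⟨k, mem_listSet.2 ⟨k, hk, rfl⟩, by push_cast; ring⟩
  simp only [runOdd, encL_eq (symL n _), encL_eq (List.map _ _)] at hc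
  refine runCore_sound (ch := fun M N T => oddChild M N T q)
    ⟨hn, hF, hX, hY, fun _ => ⟨hT, hodd⟩, oddChild_sound hF hD hT hodd hX0 hY0,
      capsOf_sound hn hA, capsOf_sound hn hB⟩ ?_ hJ hg0 hgn hc
  exact {
    subA := symL_subset hF.neg_left hlA
    subB := symL_subset hF.neg_right hlB
    supA := subset_union_erase_sdiff (hfix X hX0 _)
    supB := subset_union_erase_sdiff (hfix Y hY0 _)
    negA := neg_mem_symL
    negB := neg_mem_symL
    fixA := hfix X hX0 _
    fixB := hfix Y hY0 _
    half := hhalf lA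
    half' := hhalf lB
    dbl := hdbl lA
    dbl' := hdbl lB
    unique := Or.inl hD }

theorem runEven_sound (hF : NearFactorization X Y) (hD : ¬ DoubleUnique X Y)
    (hn : n < 255) (hX : X.card ≤ 30) (hY : Y.card ≤ 30) {capA capB : List (List ℕ × ℕ)}
    (hA : ∀ p ∈ capA, (X ∩ listSet n p.1).card = p.2)
    (hB : ∀ p ∈ capB, (Y ∩ listSet n p.1).card = p.2) {lA lB : List ℕ}
    (hlA : ∀ i ∈ lA, (i : ZMod n) ∈ X) (hlB : ∀ i ∈ lB, (i : ZMod n) ∈ Y)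
    (hfixA : ∀ x ∈ X, x = -x → x ∈ listSet n (symL n lA))
    (hfixB : ∀ x ∈ Y, x = -x → x ∈ listSet n (symL n lB))
    {rows : List (List ℕ × List ℕ)} {g J : ℕ}
    (hJ : 0 < J) (hg0 : 0 < g) (hgn : g < n)
    (hc : ∀ j < J, runEven n capA capB rows lA lB g J j = true) : ContainsRow X Y rows := by
  -- Writing the zero encodings as `encS ∅` also rewrites the unused table 0, which explains the
  -- value of `T` below.
  simp only [runEven, encL_eq (symL n _), ← encS_empty (n := n)] at hc
  refine runCore_sound (ch := fun M N _ => evenChild M N) (T := encS (∅ : Finset (ZMod n)))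
    ⟨hn, hF, hX, hY, fun h => absurd h hD, evenChild_sound hF,
      capsOf_sound hn hA, capsOf_sound hn hB⟩ ?_ hJ hg0 hgn hc
  exact {
    subA := symL_subset hF.neg_left hlA
    subB := symL_subset hF.neg_right hlB
    supA := subset_union_erase_sdiff hfixA
    supB := subset_union_erase_sdiff hfixB
    negA := neg_mem_symL
    negB := neg_mem_symL
    fixA := hfixA
    fixB := hfixB
    half := by simp
    half' := by simp
    dbl := by simp
    dbl' := by simp
    unique := Or.inr ⟨rfl, rfl, rfl, rfl⟩ }

end

/-! ### Near-factorizations -/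

section
variable {n : ℕ} [NeZero n] {X Y : Finset (ZMod n)}

theorem NearFactorization.eq_right (hF : NearFactorization X Y) {x y x' y' : ZMod n} (hx : x ∈ X)
    (hy : y ∈ Y) (hx' : x' ∈ X) (hy' : y' ∈ Y) (e : x + y = x' + y') : y = y' := by
  have := hF.eq_left x hx y hy x' hx' y' hy' e
  subst this; exact add_left_cancel e

theorem NearFactorization.card_filter (hF : NearFactorization X Y) (g : ZMod n) :
    ((X ×ˢ Y).filter fun p => p.1 + p.2 = g).card = if g = 0 then 0 else 1 := by
  split_ifs with hg
  · rw [card_eq_zero, filter_eq_empty_iff]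
    rintro ⟨x, y⟩ hp e
    obtain ⟨hx, hy⟩ := mem_product.1 hp
    exact hF.add_ne_zero x hx y hy (e.trans hg)
  · obtain ⟨x, hx, y, hy, e⟩ := hF.exists_add g hg
    rw [card_eq_one]
    refine ⟨(x, y), ext fun p => ?_⟩
    rw [mem_filter, mem_product, mem_singleton]
    constructor
    · rintro ⟨⟨h1, h2⟩, h3⟩
      rw [← e] at h3
      exact Prod.ext (hF.eq_left _ h1 _ h2 _ hx _ hy h3) (hF.eq_right h1 h2 hx hy h3)
    · rintro rfl; exact ⟨⟨hx, hy⟩, e⟩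

theorem NearFactorization.sub_card_filter (hF : NearFactorization X Y) (g : ZMod n) :
    ((X ×ˢ Y).filter fun p => p.1 - p.2 = g).card = if g = 0 then 0 else 1 := by
  rw [← hF.card_filter g]
  refine card_bij' (fun p _ => (p.1, -p.2)) (fun p _ => (p.1, -p.2)) ?_ ?_ ?_ ?_
  · rintro ⟨x, y⟩ h
    obtain ⟨h1, h2⟩ := mem_filter.1 h
    obtain ⟨hx, hy⟩ := mem_product.1 h1
    exact mem_filter.2 ⟨mem_product.2 ⟨hx, hF.neg_right y hy⟩, by rw [← h2]; ring⟩
  · rintro ⟨x, y⟩ h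
    obtain ⟨h1, h2⟩ := mem_filter.1 h
    obtain ⟨hx, hy⟩ := mem_product.1 h1
    exact mem_filter.2 ⟨mem_product.2 ⟨hx, hF.neg_right y hy⟩, by rw [← h2]; ring⟩
  · intros; simp
  · intros; simp

/-- The image of a set under multiplication by a unit. -/
def scale (u : (ZMod n)ˣ) (X : Finset (ZMod n)) : Finset (ZMod n) := X.image fun x => (u : ZMod n) * x

theorem mem_scale {u : (ZMod n)ˣ} {x : ZMod n} : x ∈ scale u X ↔ (u⁻¹ : (ZMod n)ˣ) * x ∈ X := by
  rw [scale, mem_image]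
  constructor
  · rintro ⟨y, hy, rfl⟩; rwa [Units.inv_mul_cancel_left]
  · intro h; exact ⟨_, h, Units.mul_inv_cancel_left u x⟩

theorem mul_mem_scale {u : (ZMod n)ˣ} {x : ZMod n} (h : x ∈ X) : (u : ZMod n) * x ∈ scale u X :=
  mem_image_of_mem _ h

theorem card_scale (u : (ZMod n)ˣ) (X : Finset (ZMod n)) : (scale u X).card = X.card :=
  card_image_of_injective _ u.isUnit.mul_right_injective

theorem NearFactorization.scale (hF : NearFactorization X Y) (u : (ZMod n)ˣ) :
    NearFactorization (scale u X) (scale u Y) where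
  neg_left x hx := by
    rw [mem_scale] at hx ⊢
    rw [mul_neg]; exact hF.neg_left _ hx
  neg_right x hx := by
    rw [mem_scale] at hx ⊢
    rw [mul_neg]; exact hF.neg_right _ hx
  eq_left x hx y hy x' hx' y' hy' e := by
    rw [mem_scale] at hx hy hx' hy'
    have := hF.eq_left _ hx _ hy _ hx' _ hy' (by rw [← mul_add, e, mul_add])
    exact u⁻¹.isUnit.mul_right_injective this
  add_ne_zero x hx y hy e := by
    rw [mem_scale] at hx hy
    exact hF.add_ne_zero _ hx _ hy (by rw [← mul_add, e, mul_zero])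
  exists_add g hg := by
    obtain ⟨x, hx, y, hy, e⟩ := hF.exists_add ((u⁻¹ : (ZMod n)ˣ) * g) (by simpa using hg)
    exact ⟨_, mul_mem_scale hx, _, mul_mem_scale hy, by
      rw [← mul_add, e, Units.mul_inv_cancel_left]⟩
  left_nonempty := hF.left_nonempty.image _
  right_nonempty := hF.right_nonempty.image _

theorem ContainsRow.symm {rows : List (List ℕ × List ℕ)} (h : ContainsRow Y X rows) :
    ContainsRow X Y rows := by
  obtain ⟨u, hu, r, hr, h⟩ := h
  exact ⟨u, hu, r, hr, h.symm⟩

theorem ContainsRow.of_scale {rows : List (List ℕ × List ℕ)} {u : (ZMod n)ˣ}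
    (h : ContainsRow (scale u X) (scale u Y) rows) : ContainsRow X Y rows := by
  obtain ⟨v, hv, r, hr, h⟩ := h
  set w : ZMod n := (u⁻¹ : (ZMod n)ˣ) * (v : ZMod n)
  have hw : ((w.val : ℕ) : ZMod n) = w := ZMod.natCast_zmod_val w
  refine ⟨w.val, ?_, r, hr, ?_⟩
  · rw [← ZMod.isUnit_iff_coprime, hw]
    exact u⁻¹.isUnit.mul ((ZMod.isUnit_iff_coprime _ _).2 hv)
  · rw [hw]
    have key : ∀ (Z : Finset (ZMod n)) (i : ℕ), (v * i : ZMod n) ∈ _root_.scale u Z → w * i ∈ Z := by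
      intro Z i hi
      rw [mem_scale, ← mul_assoc] at hi; exact hi
    exact h.imp (fun h => ⟨fun i hi => key _ i (h.1 i hi), fun i hi => key _ i (h.2 i hi)⟩)
      (fun h => ⟨fun i hi => key _ i (h.1 i hi), fun i hi => key _ i (h.2 i hi)⟩)

/-- All near-factorizations with two factors of size `a` contain a multiple of a given pair. -/
def Classified (n a : ℕ) [NeZero n] (rows : List (List ℕ × List ℕ)) : Prop :=
  ∀ X Y : Finset (ZMod n), NearFactorization X Y → X.card = a → Y.card = a → ContainsRow X Y rows

omit [NeZero n] in
-- A map of order dividing the prime p acts on S with orbits of size 1 or p.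
theorem card_modEq_card_fixed {α : Type*} [DecidableEq α] {p : ℕ} [Fact p.Prime] (S : Finset α)
    (f : α → α) (hf : ∀ x ∈ S, f x ∈ S) (hp : ∀ x ∈ S, f^[p] x = x) :
    S.card ≡ (S.filter fun x => f x = x).card [MOD p] := by
  let g : Function.End S := fun x => ⟨f x, hf x x.2⟩
  have hg : ∀ k, ∀ x : S, ((g ^ k : Function.End S) x : α) = f^[k] x := by
    intro k
    induction k with
    | zero => intro x; rfl
    | succ k ih =>
      intro x
      rw [pow_succ', Function.iterate_succ_apply']
      show f ((g ^ k : Function.End S) x : α) = _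
      rw [ih]
  have h1 : g ^ p ^ 1 = 1 := by
    rw [pow_one]; funext x
    exact Subtype.ext ((hg p x).trans (hp x x.2))
  have := Equiv.Perm.card_fixedPoints_modEq (p := p) (n := 1) h1
  rw [Fintype.card_coe] at this
  refine this.trans (congrArg (· % p) ?_)
  rw [← Fintype.card_coe]
  refine Fintype.card_congr ⟨fun x => ⟨x.1.1, mem_filter.2 ⟨x.1.2, congrArg Subtype.val x.2⟩⟩,
    fun x => ⟨⟨x.1, (mem_filter.1 x.2).1⟩, Subtype.ext (mem_filter.1 x.2).2⟩, fun x => rfl,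
    fun x => rfl⟩

theorem card_mod_two (hneg : ∀ x ∈ X, -x ∈ X) :
    X.card % 2 = (X.filter fun x => x = -x).card % 2 := by
  have := card_modEq_card_fixed (p := 2) X (fun x => -x) hneg fun x _ => by simp
  refine this.trans ?_
  congr 2; ext x; simp only [mem_filter, eq_comm]

/-- The fixed points of negation for `n` odd. -/
theorem eq_zero_of_eq_neg (hn : n % 2 = 1) {x : ZMod n} (h : x = -x) : x = 0 := by
  have h2 : IsUnit ((2 : ℕ) : ZMod n) :=
    (ZMod.isUnit_iff_coprime 2 n).2 (Nat.coprime_two_left.2 (Nat.odd_iff.2 hn))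
  refine h2.mul_left_eq_zero.1 ?_
  push_cast; linear_combination h

theorem NearFactorization.zero_not_mem (hF : NearFactorization X Y) (hn : n % 2 = 1)
    (hX : X.card % 2 = 0) : 0 ∉ X := by
  intro h0
  have := card_mod_two hF.neg_left
  have e : (X.filter fun x => x = -x) = {0} := by
    ext x
    rw [mem_filter, mem_singleton]
    exact ⟨fun h => eq_zero_of_eq_neg hn h.2, fun h => by subst h; exact ⟨h0, by simp⟩⟩
  rw [e, card_singleton] at this
  omega

/-- For `n` even, there is exactly one nonzero fixed point of negation. -/
theorem eq_neg_iff {m : ℕ} (hn : n = 2 * m) (x : ZMod n) : x = -x ↔ x = 0 ∨ x = (m : ZMod n) := by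
  have h2m : (m : ZMod n) + m = 0 := by
    have : ((2 * m : ℕ) : ZMod n) = 0 := by rw [← hn]; simp
    rw [← this]; push_cast; ring
  constructor
  · intro h
    have h2 : ((2 * x.val : ℕ) : ZMod n) = 0 := by
      push_cast; rw [ZMod.natCast_zmod_val]; linear_combination h
    rw [ZMod.natCast_eq_zero_iff] at h2
    obtain ⟨k, hk⟩ := h2
    have hx := ZMod.val_lt x
    have hk' : x.val = m * k := by
      have : 2 * x.val = 2 * (m * k) := by rw [hk]; nth_rw 1 [hn]; ring
      omega
    have hk2 : k < 2 := by
      by_contra hc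
      have : m * 2 ≤ m * k := Nat.mul_le_mul_left m (by omega)
      omega
    rw [← ZMod.natCast_zmod_val x, hk']
    interval_cases k
    · left; simp
    · right; simp
  · rintro (rfl | rfl)
    · simp
    · linear_combination h2m

/-- A symmetric set of odd size contains 0 or m, the only fixed points of negation. As 0 + 0 = m + m
= 0 is not a sum, neither can lie in both factors, so each factor contains exactly one of them. -/
theorem NearFactorization.zero_mem_or (hF : NearFactorization X Y) {m : ℕ} (hn : n = 2 * m)
    (hX : X.card % 2 = 1) (hY : Y.card % 2 = 1) :
    (0 ∈ X ∧ (m : ZMod n) ∈ Y ∧ (m : ZMod n) ∉ X ∧ 0 ∉ Y) ∨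
      (0 ∈ Y ∧ (m : ZMod n) ∈ X ∧ (m : ZMod n) ∉ Y ∧ 0 ∉ X) := by
  have hm : (m : ZMod n) = -(m : ZMod n) := (eq_neg_iff hn _).2 (Or.inr rfl)
  have hm0 : (m : ZMod n) + m = 0 := by linear_combination hm
  have h00 : ¬ (0 ∈ X ∧ 0 ∈ Y) := fun h => hF.add_ne_zero 0 h.1 0 h.2 (by simp)
  have hmm : ¬ ((m : ZMod n) ∈ X ∧ (m : ZMod n) ∈ Y) := fun h => hF.add_ne_zero _ h.1 _ h.2 hm0
  have hfix : ∀ Z : Finset (ZMod n), (∀ x ∈ Z, -x ∈ Z) → Z.card % 2 = 1 → 0 ∈ Z ∨ (m : ZMod n) ∈ Z := by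
    intro Z hneg hc
    rw [card_mod_two hneg] at hc
    obtain ⟨x, hx⟩ : (Z.filter fun x => x = -x).Nonempty := by
      rw [← card_pos]; omega
    obtain ⟨h1, h2⟩ := mem_filter.1 hx
    rcases (eq_neg_iff hn x).1 h2 with rfl | rfl
    · exact Or.inl h1
    · exact Or.inr h1
  have h1 := hfix X hF.neg_left hX
  have h2 := hfix Y hF.neg_right hY
  tauto

/-- Count the triples in X with sum in Y. For given second and third entries with nonzero sum there
is exactly one first entry, and none if the sum is 0, by symmetry of Y; this gives |X|² - |X| ≡ 2
modulo 3. Rotation of triples has order 3, so some triple (x, x, x) occurs. -/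
theorem NearFactorization.exists_three_mul (hF : NearFactorization X Y)
    (hX : X.card % 3 = 2) : ∃ x ∈ X, 3 * x ∈ Y := by
  haveI : Fact (Nat.Prime 3) := ⟨by norm_num⟩
  let S := (X ×ˢ X ×ˢ X).filter fun p => p.1 + (p.2.1 + p.2.2) ∈ Y
  have h1 := card_modEq_card_fixed (p := 3) S (fun p => (p.2.1, p.2.2, p.1))
    (by
      rintro ⟨x, y, z⟩ h
      simp only [S, mem_filter, mem_product] at h ⊢
      refine ⟨⟨h.1.2.1, h.1.2.2, h.1.1⟩, ?_⟩
      have e : y + (z + x) = x + (y + z) := by ring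
      rw [e]; exact h.2)
    (by rintro ⟨x, y, z⟩ _; rfl)
  have h2 : S.card = X.card * X.card - X.card := by
    have e : S.card = ∑ q ∈ X ×ˢ X, ((X ×ˢ Y).filter fun p => p.1 - p.2 = -(q.1 + q.2)).card := by
      rw [card_eq_sum_card_fiberwise (f := fun p => (p.2.1, p.2.2)) (t := X ×ˢ X)]
      · refine sum_congr rfl fun q hq => ?_
        obtain ⟨q1, q2⟩ := q
        refine card_bij' (fun p _ => (p.1, p.1 + (q1 + q2))) (fun p _ => (p.1, q1, q2)) ?_ ?_ ?_ ?_
        · rintro ⟨x, y, z⟩ h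
          simp only [S, mem_filter, mem_product, Prod.mk.injEq] at h ⊢
          obtain ⟨⟨⟨a, b, c⟩, d⟩, rfl, rfl⟩ := h
          exact ⟨⟨a, d⟩, by ring⟩
        · rintro ⟨x, y⟩ h
          simp only [S, mem_filter, mem_product] at h hq ⊢
          refine ⟨⟨⟨h.1.1, hq.1, hq.2⟩, ?_⟩, trivial⟩
          rw [show x + (q1 + q2) = y by linear_combination h.2]; exact h.1.2
        · rintro ⟨x, y, z⟩ h
          simp only [S, mem_filter, mem_product, Prod.mk.injEq] at h
          obtain ⟨-, rfl, rfl⟩ := h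
          rfl
        · rintro ⟨x, y⟩ h
          simp only [mem_filter, mem_product] at h
          refine Prod.ext rfl ?_
          show x + (q1 + q2) = y
          linear_combination h.2
      · rintro ⟨x, y, z⟩ h
        have h : (x, y, z) ∈ S := h
        simp only [S, mem_filter, mem_product] at h
        exact mem_coe.2 (mem_product.2 h.1.2)
    rw [e]
    simp_rw [hF.sub_card_filter]
    have hc : ((X ×ˢ X).filter fun q => q.1 + q.2 = 0).card = X.card := by
      refine card_bij' (fun p _ => p.1) (fun x _ => (x, -x)) ?_ ?_ ?_ ?_
      · rintro ⟨x, y⟩ h; exact (mem_product.1 (mem_filter.1 h).1).1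
      · intro x hx; exact mem_filter.2 ⟨mem_product.2 ⟨hx, hF.neg_left x hx⟩, by simp⟩
      · rintro ⟨x, y⟩ h
        have := (mem_filter.1 h).2
        exact Prod.ext rfl (neg_eq_of_add_eq_zero_right this)
      · intros; rfl
    have hc' := card_filter_add_card_filter_not (s := X ×ˢ X) (fun q => q.1 + q.2 = 0)
    rw [hc, card_product] at hc'
    rw [← hc', Nat.add_sub_cancel_left, Finset.card_filter]
    refine sum_congr rfl fun q _ => ?_
    simp only [neg_eq_zero]
    by_cases h : q.1 + q.2 = 0 <;> simp [h]
  by_contra hne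
  push Not at hne
  have h3 : (S.filter fun p => (p.2.1, p.2.2, p.1) = p) = ∅ := by
    rw [filter_eq_empty_iff]
    rintro ⟨x, y, z⟩ h e
    simp only [Prod.mk.injEq] at e
    obtain ⟨rfl, rfl, -⟩ := e
    simp only [S, mem_filter, mem_product] at h
    exact hne _ h.1.1 (by rw [show 3 * z = z + (z + z) by ring]; exact h.2)
  rw [h2, h3, card_empty] at h1
  have h4 : (X.card * X.card - X.card) % 3 = 0 := h1
  obtain ⟨k, hk⟩ : ∃ k, X.card = 3 * k + 2 := ⟨X.card / 3, by omega⟩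
  have : X.card * X.card - X.card = 3 * (3 * k * k + 3 * k) + 2 := by
    rw [hk, Nat.sub_eq_iff_eq_add (by nlinarith)]; ring
  omega

/-- Fix x in X and count pairs (y, z) in X × X with x - y - z in Y. Each y ≠ x admits one z and y =
x none, so there are |X| - 1 pairs, an odd number. The fixed points of the swap correspond to the y
with x - 2y in Y, so the number of these is odd and at least 1. Summed over x it is |X|, because 2y
≠ 0 is a difference x - b exactly once. So it is 1 for each x. -/
theorem NearFactorization.doubleUnique_left (hF : NearFactorization X Y) (hn : n % 2 = 1)
    (hX : X.card % 2 = 0) : ∀ x ∈ X, ∀ y ∈ X, ∀ b ∈ Y, ∀ y' ∈ X, ∀ b' ∈ Y,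
      x = 2 * y + b → x = 2 * y' + b' → y = y' := by
  let N : ZMod n → Finset (ZMod n) := fun x => X.filter fun y => x - 2 * y ∈ Y
  have h0 := hF.zero_not_mem hn hX
  have hodd : ∀ x ∈ X, (N x).card % 2 = 1 := by
    intro x hx
    let S := (X ×ˢ X).filter fun p => x - (p.1 + p.2) ∈ Y
    have h1 := card_modEq_card_fixed (p := 2) S (fun p => (p.2, p.1))
      (by
        rintro ⟨y, z⟩ h
        simp only [S, mem_filter, mem_product] at h ⊢
        exact ⟨⟨h.1.2, h.1.1⟩, by rw [add_comm]; exact h.2⟩)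
      (by rintro ⟨y, z⟩ _; rfl)
    have h2 : (S.filter fun p => (p.2, p.1) = p).card = (N x).card := by
      refine card_bij' (fun p _ => p.1) (fun y _ => (y, y)) ?_ ?_ ?_ ?_
      · rintro ⟨y, z⟩ h
        simp only [S, mem_filter, mem_product, Prod.mk.injEq] at h
        obtain ⟨⟨a, b⟩, rfl, -⟩ := h
        exact mem_filter.2 ⟨a.1, by rw [two_mul]; exact b⟩
      · intro y hy
        obtain ⟨a, b⟩ := mem_filter.1 hy
        simp only [S, mem_filter, mem_product]
        exact ⟨⟨⟨a, a⟩, by rw [← two_mul]; exact b⟩, trivial⟩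
      · rintro ⟨y, z⟩ h
        simp only [mem_filter, Prod.mk.injEq] at h
        obtain ⟨-, rfl, -⟩ := h
        rfl
      · intros; rfl
    have h3 : S.card = X.card - 1 := by
      have e : S.card = ∑ y ∈ X, ((X ×ˢ Y).filter fun p => p.1 + p.2 = x - y).card := by
        rw [card_eq_sum_card_fiberwise (f := fun p => p.1) (t := X)]
        · refine sum_congr rfl fun y hy => ?_
          refine card_bij' (fun p _ => (p.2, x - (p.1 + p.2))) (fun p _ => (y, p.1)) ?_ ?_ ?_ ?_
          · rintro ⟨y', z⟩ h
            simp only [S, mem_filter, mem_product] at h ⊢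
            obtain ⟨⟨⟨a, b⟩, c⟩, rfl⟩ := h
            exact ⟨⟨b, c⟩, by ring⟩
          · rintro ⟨z, b⟩ h
            simp only [S, mem_filter, mem_product] at h ⊢
            refine ⟨⟨⟨hy, h.1.1⟩, ?_⟩, trivial⟩
            rw [show x - (y + z) = b by linear_combination -h.2]; exact h.1.2
          · rintro ⟨y', z⟩ h
            simp only [mem_filter] at h
            obtain ⟨-, rfl⟩ := h
            rfl
          · rintro ⟨z, b⟩ h
            simp only [mem_filter] at h
            refine Prod.ext rfl ?_
            show x - (y + z) = b
            linear_combination -h.2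
        · rintro ⟨y, z⟩ h
          exact mem_coe.2 (mem_product.1 (mem_filter.1 (mem_coe.1 h)).1).1
      rw [e]
      simp_rw [hF.card_filter]
      rw [← card_erase_of_mem hx, card_eq_sum_ones, ← sum_erase X (a := x) (by simp)]
      refine sum_congr rfl fun y hy => ?_
      rw [if_neg]
      exact sub_ne_zero.2 (ne_of_mem_erase hy).symm
    have hpos : 0 < X.card := card_pos.2 ⟨x, hx⟩
    rw [h2, h3] at h1
    have h1 : (X.card - 1) % 2 = (N x).card % 2 := h1
    omega
  have hsum : ∑ x ∈ X, (N x).card = X.card := by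
    have e : ∑ x ∈ X, (N x).card = ∑ y ∈ X, ((X ×ˢ Y).filter fun p => p.1 - p.2 = 2 * y).card := by
      simp only [N, Finset.card_filter]
      rw [sum_comm]
      refine sum_congr rfl fun y _ => ?_
      rw [← Finset.card_filter, ← Finset.card_filter]
      refine card_bij' (fun x _ => (x, x - 2 * y)) (fun p _ => p.1) ?_ ?_ ?_ ?_
      · intro x hx
        obtain ⟨a, b⟩ := mem_filter.1 hx
        exact mem_filter.2 ⟨mem_product.2 ⟨a, b⟩, by ring⟩
      · rintro ⟨x, b⟩ h
        obtain ⟨a, c⟩ := mem_filter.1 h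
        obtain ⟨a1, a2⟩ := mem_product.1 a
        refine mem_filter.2 ⟨a1, ?_⟩
        rw [show x - 2 * y = b by linear_combination c]; exact a2
      · intros; rfl
      · rintro ⟨x, b⟩ h
        have := (mem_filter.1 h).2
        refine Prod.ext rfl ?_
        show x - 2 * y = b
        linear_combination this
    rw [e, card_eq_sum_ones]
    refine sum_congr rfl fun y hy => ?_
    rw [hF.sub_card_filter, if_neg]
    intro h2
    exact h0 (by rw [← eq_zero_of_eq_neg hn (x := y) (by linear_combination h2)]; exact hy)
  have hone : ∀ x ∈ X, (N x).card = 1 := by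
    have hle : ∀ x ∈ X, 1 ≤ (N x).card := fun x hx => by have := hodd x hx; omega
    have := (sum_eq_sum_iff_of_le hle).1 (by rw [hsum, card_eq_sum_ones])
    exact fun x hx => (this x hx).symm
  intro x hx y hy b hb y' hy' b' hb' e e'
  obtain ⟨z, hz⟩ := card_eq_one.1 (hone x hx)
  have m1 : y ∈ N x := mem_filter.2 ⟨hy, by rw [e, add_sub_cancel_left]; exact hb⟩
  have m2 : y' ∈ N x := mem_filter.2 ⟨hy', by rw [e', add_sub_cancel_left]; exact hb'⟩
  rw [hz, mem_singleton] at m1 m2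
  rw [m1, m2]

theorem NearFactorization.doubleUnique (hF : NearFactorization X Y) (hn : n % 2 = 1)
    (hX : X.card % 2 = 0) (hY : Y.card % 2 = 0) : DoubleUnique X Y where
  left := hF.doubleUnique_left hn hX
  right := hF.symm.doubleUnique_left hn hY
  inj x y h := by
    refine sub_eq_zero.1 (eq_zero_of_eq_neg hn ?_)
    linear_combination h

/-- For even order m and 0 have the same double. The requirement of a table of halves in
`SearchData` then holds vacuously. -/
theorem not_doubleUnique {m : ℕ} (hn : n = 2 * m) (hm : 0 < m) : ¬ DoubleUnique X Y := by
  intro h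
  have h2 := (eq_neg_iff hn (m : ZMod n)).2 (Or.inr rfl)
  have : (m : ZMod n) = 0 := h.inj _ _ (by linear_combination h2)
  rw [ZMod.natCast_eq_zero_iff] at this
  have := Nat.le_of_dvd hm this
  omega

/-! ### Distribution over residue classes -/

/-- The number of elements in a residue class modulo a divisor `d` of `n`. -/
def classCard (d : ℕ) (X : Finset (ZMod n)) (r : ZMod d) : ℕ :=
  (X.filter fun x => (x.cast : ZMod d) = r).card

/-- The identity X · Y = G - 1 of the group ring, projected to ℤ/d. -/
theorem NearFactorization.sum_classCard (hF : NearFactorization X Y) {d : ℕ} [NeZero d]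
    (hd : d ∣ n) (s : ZMod d) :
    ∑ r, classCard d X r * classCard d Y (s - r) =
      ((univ.erase (0 : ZMod n)).filter fun x => (x.cast : ZMod d) = s).card := by
  have e : ∀ r, classCard d X r * classCard d Y (s - r) = (((X ×ˢ Y).filter
      fun p => ((p.1 + p.2 : ZMod n).cast : ZMod d) = s).filter
        fun p => (p.1.cast : ZMod d) = r).card := by
    intro r
    rw [classCard, classCard, ← card_product]
    congr 1; ext ⟨x, y⟩
    simp only [mem_filter, mem_product, ZMod.cast_add hd]
    constructor
    · rintro ⟨⟨a, rfl⟩, b, h⟩; exact ⟨⟨⟨a, b⟩, by rw [h]; ring⟩, rfl⟩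
    · rintro ⟨⟨⟨a, b⟩, rfl⟩, rfl⟩; exact ⟨⟨a, rfl⟩, b, by ring⟩
  simp_rw [e]
  rw [← card_eq_sum_card_fiberwise fun _ _ => mem_coe.2 (mem_univ _)]
  refine card_bij (fun p _ => p.1 + p.2) ?_ ?_ ?_
  · rintro ⟨x, y⟩ h
    obtain ⟨h1, h2⟩ := mem_filter.1 h
    obtain ⟨hx, hy⟩ := mem_product.1 h1
    exact mem_filter.2 ⟨mem_erase.2 ⟨hF.add_ne_zero x hx y hy, mem_univ _⟩, h2⟩
  · rintro ⟨x, y⟩ h ⟨x', y'⟩ h' e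
    obtain ⟨hx, hy⟩ := mem_product.1 (mem_filter.1 h).1
    obtain ⟨hx', hy'⟩ := mem_product.1 (mem_filter.1 h').1
    exact Prod.ext (hF.eq_left _ hx _ hy _ hx' _ hy' e) (hF.eq_right hx hy hx' hy' e)
  · intro g hg
    obtain ⟨h1, h2⟩ := mem_filter.1 hg
    obtain ⟨x, hx, y, hy, e⟩ := hF.exists_add g (ne_of_mem_erase h1)
    exact ⟨(x, y), mem_filter.2 ⟨mem_product.2 ⟨hx, hy⟩, by rw [e]; exact h2⟩, e⟩

theorem classCard_neg {d : ℕ} (hd : d ∣ n) (hneg : ∀ x ∈ X, -x ∈ X) (r : ZMod d) :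
    classCard d X (-r) = classCard d X r := by
  refine card_bij' (fun x _ => -x) (fun x _ => -x) ?_ ?_ ?_ ?_
  · intro x hx
    obtain ⟨a, b⟩ := mem_filter.1 hx
    exact mem_filter.2 ⟨hneg x a, by rw [ZMod.cast_neg hd, b, neg_neg]⟩
  · intro x hx
    obtain ⟨a, b⟩ := mem_filter.1 hx
    exact mem_filter.2 ⟨hneg x a, by rw [ZMod.cast_neg hd, b]⟩
  · intros; simp
  · intros; simp

theorem sum_classCard_eq {d : ℕ} [NeZero d] (X : Finset (ZMod n)) :
    ∑ r, classCard d X r = X.card :=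
  (card_eq_sum_card_fiberwise fun _ _ => mem_coe.2 (mem_univ _)).symm

theorem classCard_scale {d : ℕ} (hd : d ∣ n) (u : (ZMod n)ˣ) (r : ZMod d) :
    classCard d (scale u X) (((u : ZMod n).cast : ZMod d) * r) = classCard d X r := by
  have hu : IsUnit ((u : ZMod n).cast : ZMod d) := u.isUnit.map (ZMod.castHom hd (ZMod d))
  have : (scale u X).filter (fun x => (x.cast : ZMod d) = ((u : ZMod n).cast : ZMod d) * r) =
      scale u (X.filter fun x => (x.cast : ZMod d) = r) := by
    ext x
    rw [mem_filter, mem_scale, mem_scale, mem_filter]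
    refine and_congr_right fun _ => ?_
    have : (x.cast : ZMod d) = ((u : ZMod n).cast : ZMod d) *
        ((u⁻¹ : (ZMod n)ˣ) * x : ZMod n).cast := by
      rw [← ZMod.cast_mul hd, Units.mul_inv_cancel_left]
    rw [this, hu.mul_right_inj]
  rw [classCard, this, card_scale]; rfl

end

/-! ### From strong external difference families to near-factorizations -/

section
variable {n : ℕ} [NeZero n] {X Y : Finset (ZMod n)}

theorem sum_ite_add {P Q : Finset (ZMod n)}
    (hinj : ∀ x ∈ P, ∀ y ∈ Q, ∀ x' ∈ P, ∀ y' ∈ Q, x + y = x' + y' → x = x')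
    (hne : ∀ x ∈ P, ∀ y ∈ Q, x + y ≠ 0) (hex : ∀ g, g ≠ 0 → ∃ x ∈ P, ∃ y ∈ Q, x + y = g)
    (g : ZMod n) :
    ∑ x ∈ P, ∑ y ∈ Q, (if x + y = g then 1 else 0) = if g = 0 then 0 else 1 := by
  split_ifs with hg
  · refine sum_eq_zero fun x hx => sum_eq_zero fun y hy => if_neg ?_
    rw [hg]; exact hne x hx y hy
  · obtain ⟨x, hx, y, hy, e⟩ := hex g hg
    rw [sum_eq_single_of_mem x hx, sum_eq_single_of_mem y hy, if_pos e]
    · intro y' _ hy'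
      exact if_neg fun h => hy' (add_left_cancel (h.trans e.symm))
    · intro x' hx' hxx
      refine sum_eq_zero fun y' hy' => if_neg fun h => hxx ?_
      exact hinj _ hx' _ hy' _ hx _ hy (h.trans e.symm)

/-- A complementary factor in a near-factorization is unique. -/
theorem factor_unique {P Q Q' : Finset (ZMod n)}
    (h : ∀ g : ZMod n, ∑ x ∈ P, ∑ y ∈ Q, (if x + y = g then 1 else 0) = if g = 0 then 0 else 1)
    (h' : ∀ g : ZMod n, ∑ x ∈ P, ∑ y ∈ Q', (if x + y = g then 1 else 0) = if g = 0 then 0 else 1)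
    (hc : Q.card = Q'.card) : Q = Q' := by
  have key : ∀ (R : Finset (ZMod n)) (z : ZMod n),
      ∑ q ∈ R, (if z - q = 0 then 0 else 1) + (if z ∈ R then 1 else 0) = R.card := by
    intro R z
    have : (if z ∈ R then 1 else 0) = ∑ q ∈ R, if z - q = 0 then 1 else 0 := by
      simp [sub_eq_zero, sum_ite_eq]
    rw [this, ← sum_add_distrib, card_eq_sum_ones]
    exact sum_congr rfl fun q _ => by split_ifs <;> rfl
  ext z
  -- The coefficient of z in Q' · P · Q, computed as Q' · (P · Q) and as Q · (P · Q'). Both products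
  -- in parentheses are G - 1, so Q and Q' of equal size agree.
  have e : ∑ q' ∈ Q', (if z - q' = 0 then 0 else 1) = ∑ q ∈ Q, if z - q = 0 then 0 else 1 := by
    rw [sum_congr rfl fun q' _ => (h (z - q')).symm, sum_congr rfl fun q _ => (h' (z - q)).symm,
      sum_comm, sum_comm (s := Q)]
    refine sum_congr rfl fun x _ => ?_
    rw [sum_comm]
    refine sum_congr rfl fun q _ => sum_congr rfl fun q' _ => ?_
    have : x + q = z - q' ↔ x + q' = z - q :=
      ⟨fun h => by linear_combination h, fun h => by linear_combination h⟩
    simp only [this]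
  have h1 := key Q z
  have h2 := key Q' z
  by_cases hz : z ∈ Q <;> by_cases hz' : z ∈ Q' <;> simp only [hz, hz', if_true, if_false] at h1 h2 ⊢ <;>
    omega

variable {a : ℕ} {A : Fin 2 → Finset (ZMod n)}

theorem IsSEDF.map_sub_eq (h : IsSEDF n 2 a 1 A) (i : Fin 2) :
    (A i ×ˢ A (1 - i)).val.map (fun p => p.1 - p.2) = (univ.erase (0 : ZMod n)).val := by
  have := h.differences_eq i
  rw [one_smul] at this
  rw [← this]
  have e : (univ.erase i : Finset (Fin 2)) = {1 - i} := by
    fin_cases i <;> rfl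
  rw [e, sum_singleton]; rfl

theorem IsSEDF.sub_inj (h : IsSEDF n 2 a 1 A) (i : Fin 2) {x y x' y' : ZMod n} (hx : x ∈ A i)
    (hy : y ∈ A (1 - i)) (hx' : x' ∈ A i) (hy' : y' ∈ A (1 - i)) (e : x - y = x' - y') :
    x = x' ∧ y = y' := by
  have hnd : ((A i ×ˢ A (1 - i)).val.map fun p => p.1 - p.2).Nodup := by
    rw [h.map_sub_eq]; exact (univ.erase 0).nodup
  have := Multiset.inj_on_of_nodup_map hnd (x, y) (mem_product.2 ⟨hx, hy⟩) (x', y')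
    (mem_product.2 ⟨hx', hy'⟩) e
  exact Prod.ext_iff.1 this

theorem IsSEDF.sub_ne (h : IsSEDF n 2 a 1 A) (i : Fin 2) {x y : ZMod n} (hx : x ∈ A i)
    (hy : y ∈ A (1 - i)) : x - y ≠ 0 := by
  have : x - y ∈ (A i ×ˢ A (1 - i)).val.map fun p => p.1 - p.2 :=
    Multiset.mem_map_of_mem (fun p : ZMod n × ZMod n => p.1 - p.2) (a := (x, y))
      (mem_product.2 ⟨hx, hy⟩)
  rw [h.map_sub_eq] at this
  exact ne_of_mem_erase this

theorem IsSEDF.exists_sub (h : IsSEDF n 2 a 1 A) (i : Fin 2) {g : ZMod n} (hg : g ≠ 0) :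
    ∃ x ∈ A i, ∃ y ∈ A (1 - i), x - y = g := by
  have : g ∈ (A i ×ˢ A (1 - i)).val.map fun p => p.1 - p.2 := by
    rw [h.map_sub_eq]; exact mem_erase.2 ⟨hg, mem_univ g⟩
  obtain ⟨⟨x, y⟩, hp, e⟩ := Multiset.mem_map.1 this
  obtain ⟨hx, hy⟩ := mem_product.1 hp
  exact ⟨x, hx, y, hy, e⟩

theorem IsSEDF.add_inj (h : IsSEDF n 2 a 1 A) (i : Fin 2) {x y x' y' : ZMod n} (hx : x ∈ A i)
    (hy : y ∈ A (1 - i)) (hx' : x' ∈ A i) (hy' : y' ∈ A (1 - i)) (e : x + y = x' + y') :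
    x = x' ∧ y = y' := by
  obtain ⟨h1, h2⟩ := h.sub_inj i hx hy' hx' hy (by linear_combination e)
  exact ⟨h1, h2.symm⟩

/-- The sums of the elements of the two sets miss exactly one element. -/
theorem IsSEDF.exists_missing (h : IsSEDF n 2 a 1 A) (hn : n = a ^ 2 + 1) :
    ∃ c : ZMod n, (∀ x ∈ A 0, ∀ y ∈ A 1, x + y ≠ c) ∧
      ∀ g, g ≠ c → ∃ x ∈ A 0, ∃ y ∈ A 1, x + y = g := by
  have hcard : ((A 0 ×ˢ A 1).image fun p => p.1 + p.2).card = a ^ 2 := by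
    rw [card_image_of_injOn, card_product, h.card_eq, h.card_eq, sq]
    rintro ⟨x, y⟩ hp ⟨x', y'⟩ hp' e
    obtain ⟨hx, hy⟩ := mem_product.1 (mem_coe.1 hp)
    obtain ⟨hx', hy'⟩ := mem_product.1 (mem_coe.1 hp')
    obtain ⟨h1, h2⟩ := h.add_inj 0 hx hy hx' hy' e
    exact Prod.ext h1 h2
  have hcompl : (univ \ (A 0 ×ˢ A 1).image fun p => p.1 + p.2).card = 1 := by
    rw [card_sdiff_of_subset (subset_univ _), hcard, card_univ, ZMod.card]; omega
  obtain ⟨c, hc⟩ := card_eq_one.1 hcompl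
  refine ⟨c, fun x hx y hy e => ?_, fun g hg => ?_⟩
  · have : c ∈ univ \ (A 0 ×ˢ A 1).image fun p => p.1 + p.2 := by rw [hc]; simp
    exact (mem_sdiff.1 this).2 (mem_image.2 ⟨(x, y), mem_product.2 ⟨hx, hy⟩, e⟩)
  · by_contra hne
    have : g ∈ univ \ (A 0 ×ˢ A 1).image fun p => p.1 + p.2 := by
      refine mem_sdiff.2 ⟨mem_univ g, fun hm => hne ?_⟩
      obtain ⟨⟨x, y⟩, hp, e⟩ := mem_image.1 hm
      obtain ⟨hx, hy⟩ := mem_product.1 hp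
      exact ⟨x, hx, y, hy, e⟩
    rw [hc, mem_singleton] at this
    exact hg this

/-- Both -A' and A' - c complement A in G - 1, where A, A' are the two sets: the first because of
the differences, the second because the sums miss only c. Uniqueness of the complement gives -A' =
A' - c. -/
theorem IsSEDF.sub_mem (h : IsSEDF n 2 a 1 A) (i : Fin 2) {c : ZMod n}
    (h1 : ∀ x ∈ A i, ∀ y ∈ A (1 - i), x + y ≠ c)
    (h2 : ∀ g, g ≠ c → ∃ x ∈ A i, ∃ y ∈ A (1 - i), x + y = g) :
    ∀ x ∈ A (1 - i), c - x ∈ A (1 - i) := by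
  have e : (A (1 - i)).image (fun y => -y) = (A (1 - i)).image fun y => y - c := by
    refine factor_unique (P := A i) (sum_ite_add ?_ ?_ ?_) (sum_ite_add ?_ ?_ ?_) ?_
    · intro x hx y hy x' hx' y' hy' e
      obtain ⟨z, hz, rfl⟩ := mem_image.1 hy
      obtain ⟨z', hz', rfl⟩ := mem_image.1 hy'
      exact (h.sub_inj i hx hz hx' hz' (by linear_combination e)).1
    · intro x hx y hy e
      obtain ⟨z, hz, rfl⟩ := mem_image.1 hy
      exact h.sub_ne i hx hz (by linear_combination e)
    · intro g hg
      obtain ⟨x, hx, y, hy, e⟩ := h.exists_sub i hg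
      exact ⟨x, hx, -y, mem_image_of_mem _ hy, by rw [← e]; ring⟩
    · intro x hx y hy x' hx' y' hy' e
      obtain ⟨z, hz, rfl⟩ := mem_image.1 hy
      obtain ⟨z', hz', rfl⟩ := mem_image.1 hy'
      exact (h.add_inj i hx hz hx' hz' (by linear_combination e)).1
    · intro x hx y hy e
      obtain ⟨z, hz, rfl⟩ := mem_image.1 hy
      exact h1 x hx z hz (by linear_combination e)
    · intro g hg
      obtain ⟨x, hx, y, hy, e⟩ := h2 (g + c) (by simpa using hg)
      exact ⟨x, hx, y - c, mem_image_of_mem _ hy, by linear_combination e⟩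
    · rw [card_image_of_injective _ neg_injective, card_image_of_injective _ sub_left_injective]
  intro x hx
  have : -x ∈ (A (1 - i)).image fun y => y - c := by rw [← e]; exact mem_image_of_mem _ hx
  obtain ⟨y, hy, e⟩ := mem_image.1 this
  rw [show c - x = y by linear_combination -e]; exact hy

theorem affineImage_one (β : ZMod n) (Z : Finset (ZMod n)) {x : ZMod n} :
    x ∈ affineImage 1 β Z ↔ x - β ∈ Z := by
  rw [affineImage, mem_image]
  constructor
  · rintro ⟨y, hy, rfl⟩; simpa using hy
  · intro hx; exact ⟨_, hx, by ring⟩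

/-- A translate of a strong external difference family is a symmetric near-factorization. -/
theorem IsSEDF.exists_nearFactorization (h : IsSEDF n 2 a 1 A) (hn : n = a ^ 2 + 1) (ha : 0 < a) :
    ∃ β : ZMod n, NearFactorization (affineImage 1 β (A 0)) (affineImage 1 β (A 1)) := by
  obtain ⟨c, h1, h2⟩ := h.exists_missing hn
  have hs1 : ∀ x ∈ A 1, c - x ∈ A 1 := h.sub_mem 0 h1 h2
  have hs0 : ∀ x ∈ A 0, c - x ∈ A 0 :=
    h.sub_mem 1 (fun x hx y hy => by rw [add_comm]; exact h1 y hy x hx) fun g hg => by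
      obtain ⟨x, hx, y, hy, e⟩ := h2 g hg
      exact ⟨y, hy, x, hx, by rw [add_comm, e]⟩
  -- For a even, n is odd and c (n + 1)/2 works. For a odd, the involution x ↦ c - x of a set of odd
  -- size has a fixed point.
  obtain ⟨d, hd⟩ : ∃ d, c = 2 * d := by
    rcases Nat.mod_two_eq_zero_or_one a with ha2 | ha2
    · refine ⟨c * (((n + 1) / 2 : ℕ) : ZMod n), ?_⟩
      have : 2 * ((n + 1) / 2) = n + 1 := by
        have : a ^ 2 % 2 = 0 := by rw [Nat.pow_mod, ha2]
        omega
      have := congrArg (Nat.cast : ℕ → ZMod n) this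
      push_cast at this
      rw [ZMod.natCast_self, zero_add] at this
      linear_combination (-c) * this
    · haveI : Fact (Nat.Prime 2) := ⟨by norm_num⟩
      have := card_modEq_card_fixed (p := 2) (A 0) (fun x => c - x) hs0 fun x _ => by simp
      rw [h.card_eq] at this
      have hne : ((A 0).filter fun x => c - x = x).Nonempty := by
        rw [← card_pos]
        have : a % 2 = _ % 2 := this
        omega
      obtain ⟨x, hx⟩ := hne
      exact ⟨x, by linear_combination (mem_filter.1 hx).2⟩
  refine ⟨-d, ?_⟩
  have hmem : ∀ (Z : Finset (ZMod n)) {x : ZMod n}, x ∈ affineImage 1 (-d) Z ↔ x + d ∈ Z := by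
    intro Z x; rw [affineImage_one, sub_neg_eq_add]
  have hneg : ∀ Z : Finset (ZMod n), (∀ x ∈ Z, c - x ∈ Z) → ∀ x ∈ affineImage 1 (-d) Z,
      -x ∈ affineImage 1 (-d) Z := by
    intro Z hZ x hx
    rw [hmem] at hx ⊢
    have := hZ _ hx
    rwa [show c - (x + d) = -x + d by linear_combination hd] at this
  have hpos : ∀ i, (A i).Nonempty := fun i => card_pos.1 (by rw [h.card_eq]; exact ha)
  exact {
    neg_left := hneg _ hs0
    neg_right := hneg _ hs1
    eq_left := by
      intro x hx y hy x' hx' y' hy' e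
      rw [hmem] at hx hy hx' hy'
      exact add_right_cancel (h.add_inj 0 hx hy hx' hy' (by linear_combination e)).1
    add_ne_zero := by
      intro x hx y hy e
      rw [hmem] at hx hy
      exact h1 _ hx _ hy (by linear_combination e - hd)
    exists_add := by
      intro g hg
      obtain ⟨x, hx, y, hy, e⟩ := h2 (g + c) (by simpa using hg)
      refine ⟨x - d, (hmem _).2 (by simpa using hx), y - d, (hmem _).2 (by simpa using hy), ?_⟩
      linear_combination e + hd
    left_nonempty := (hpos 0).image _
    right_nonempty := (hpos 1).image _ }

/-! ### Affine equivalence -/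

omit [NeZero n] in
theorem affineImage_affineImage (α β α' β' : ZMod n) (Z : Finset (ZMod n)) :
    affineImage α' β' (affineImage α β Z) = affineImage (α' * α) (α' * β + β') Z := by
  rw [affineImage, affineImage, image_image, affineImage]
  congr 1; funext x; simp only [Function.comp]; ring

omit [NeZero n] in
theorem AffineEquivalent.trans {A B C : Fin 2 → Finset (ZMod n)} (h : AffineEquivalent A B)
    (h' : AffineEquivalent B C) : AffineEquivalent A C := by
  obtain ⟨α, β, h⟩ := h
  obtain ⟨α', β', h'⟩ := h'
  refine ⟨α' * α, (α' : ZMod n) * β + β', ?_⟩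
  have key : ∀ Z, affineImage (α' : ZMod n) β' (affineImage (α : ZMod n) β Z) =
      affineImage ((α' * α : (ZMod n)ˣ) : ZMod n) (α' * β + β') Z := fun Z => by
    rw [affineImage_affineImage, Units.val_mul]
  rcases h with h | h <;> rcases h' with h' | h'
  · exact Or.inl fun i => by rw [h', h, key]
  · exact Or.inr fun i => by rw [h', h, key]
  · exact Or.inr fun i => by rw [h', h, key]
  · exact Or.inl fun i => by rw [h', h, key, sub_sub_cancel]

omit [NeZero n] in
theorem AffineEquivalent.symm {A B : Fin 2 → Finset (ZMod n)} (h : AffineEquivalent A B) :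
    AffineEquivalent B A := by
  obtain ⟨α, β, h⟩ := h
  refine ⟨α⁻¹, -((α⁻¹ : (ZMod n)ˣ) * β), ?_⟩
  have key : ∀ Z, affineImage ((α⁻¹ : (ZMod n)ˣ) : ZMod n) (-((α⁻¹ : (ZMod n)ˣ) * β))
      (affineImage (α : ZMod n) β Z) = Z := fun Z => by
    rw [affineImage_affineImage, Units.inv_mul, affineImage]
    simp
  refine h.imp (fun h i => ?_) fun h i => ?_
  · rw [h, key]
  · rw [h, key, sub_sub_cancel]

/-- If the pair of symmetric sets given by two lists is large enough, then the sets that contain a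
multiple of it are equivalent to it. -/
theorem ContainsRow.affineEquivalent {rows : List TableRow} (hF : NearFactorization X Y)
    (h : ContainsRow X Y (rows.map fun r => (r.symFirst, r.symSecond)))
    (hc : ∀ r ∈ rows, ∀ i, (r.symmetricPair n i).card = X.card) (hXY : X.card = Y.card) :
    ∃ r ∈ rows, AffineEquivalent (r.symmetricPair n) ![X, Y] := by
  obtain ⟨u, hu, p, hp, h⟩ := h
  obtain ⟨r, hr, rfl⟩ := List.mem_map.1 hp
  obtain ⟨α, hα⟩ := (ZMod.isUnit_iff_coprime u n).2 hu
  refine ⟨r, hr, α, 0, ?_⟩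
  have key : ∀ (l : List ℕ) (Z : Finset (ZMod n)), (∀ x ∈ Z, -x ∈ Z) →
      (l.toFinset.biUnion (orbitP n)).card = Z.card → (∀ i ∈ l, (u * i : ZMod n) ∈ Z) →
      Z = affineImage (α : ZMod n) 0 (l.toFinset.biUnion (orbitP n)) := by
    intro l Z hneg hcard hl
    refine (eq_of_subset_of_card_le ?_ ?_).symm
    · intro x hx
      obtain ⟨y, hy, rfl⟩ := mem_image.1 hx
      obtain ⟨i, hi, hy⟩ := mem_biUnion.1 hy
      have hi := hl i (List.mem_toFinset.1 hi)
      rw [add_zero, hα]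
      rcases mem_insert.1 hy with rfl | hy
      · exact hi
      · rw [mem_singleton.1 hy, mul_neg]; exact hneg _ hi
    · rw [affineImage, card_image_of_injective, hcard]
      intro x y e
      exact α.isUnit.mul_right_injective (by simpa using e)
  have h0 := hc r hr 0
  have h1 := hc r hr 1
  rcases h with ⟨ha, hb⟩ | ⟨ha, hb⟩
  · left
    intro i; fin_cases i
    · exact key _ _ hF.neg_left h0 ha
    · exact key _ _ hF.neg_right (h1.trans hXY) hb
  · right
    intro i; fin_cases i
    · exact key _ _ hF.neg_left h1 hb
    · exact key _ _ hF.neg_right (h0.trans hXY) ha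

theorem Classified.exists_row {rows : List TableRow} (hn : n = a ^ 2 + 1) (ha : 0 < a)
    (hcl : Classified n a (rows.map fun r => (r.symFirst, r.symSecond)))
    (hc : ∀ r ∈ rows, ∀ i, (r.symmetricPair n i).card = a) (h : IsSEDF n 2 a 1 A) :
    ∃ r ∈ rows, AffineEquivalent A (r.symmetricPair n) := by
  obtain ⟨β, hF⟩ := h.exists_nearFactorization hn ha
  have hcard : ∀ i, (affineImage 1 β (A i)).card = a := fun i => by
    rw [affineImage, card_image_of_injective, h.card_eq]
    intro x y e; simpa using e
  obtain ⟨r, hr, hA⟩ := (hcl _ _ hF (hcard 0) (hcard 1)).affineEquivalent hF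
    (fun r hr i => (hc r hr i).trans (hcard 0).symm) ((hcard 0).trans (hcard 1).symm)
  refine ⟨r, hr, AffineEquivalent.trans ⟨1, β, Or.inl fun i => ?_⟩ hA.symm⟩
  fin_cases i <;> rfl

end

/-! ### Classification -/

section
variable {n : ℕ} [NeZero n] {X Y : Finset (ZMod n)}

/-- Allows a chosen element to be normalized to a divisor of n, leaving few starting positions. -/
theorem exists_scale_mem (x : ZMod n) :
    ∃ d, d ∣ n ∧ ∃ u : (ZMod n)ˣ, (u : ZMod n) * x = (d : ZMod n) := by
  obtain ⟨d, hd, v, ⟨u, rfl⟩, e⟩ := ZMod.eq_unit_mul_divisor x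
  exact ⟨d, hd, u⁻¹, by rw [e, Units.inv_mul_cancel_left]⟩

theorem mem_scale_of_mul_eq {u : (ZMod n)ˣ} {x y : ZMod n} (hx : x ∈ X) (h : (u : ZMod n) * x = y) :
    y ∈ scale u X := h ▸ mul_mem_scale hx

/-- The condition that there are `a` elements. -/
def fullCap (n a : ℕ) : List (List ℕ × ℕ) := [(List.range n, a)]

theorem fullCap_sound {a : ℕ} (hX : X.card = a) :
    ∀ p ∈ fullCap n a, (X ∩ listSet n p.1).card = p.2 := by
  intro p hp
  rw [List.mem_singleton.1 hp]
  rw [inter_eq_left.2, hX]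
  intro x _
  exact mem_listSet.2 ⟨x.val, List.mem_range.2 (ZMod.val_lt x), ZMod.natCast_zmod_val x⟩

/-- The condition that there are `p.2` elements in the residue classes `± p.1` modulo `d`,
for each `p`. -/
def classCaps (n d : ℕ) (l : List (ℕ × ℕ)) : List (List ℕ × ℕ) :=
  l.map fun p => ((List.range n).filter fun i => i % d == p.1 || (i + p.1) % d == 0, p.2)

theorem classCaps_sound {d : ℕ} (hd : d ∣ n) (hneg : ∀ x ∈ X, -x ∈ X) {l : List (ℕ × ℕ)}
    (hl : ∀ p ∈ l, p.1 < d ∧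
      p.2 = if 2 * p.1 % d = 0 then classCard d X p.1 else 2 * classCard d X p.1) :
    ∀ p ∈ classCaps n d l, (X ∩ listSet n p.1).card = p.2 := by
  intro p hp
  obtain ⟨⟨r, c⟩, hr, rfl⟩ := List.mem_map.1 hp
  obtain ⟨hrd, hc⟩ := hl _ hr
  simp only at hrd hc ⊢
  have e : X ∩ listSet n ((List.range n).filter fun i => i % d == r || (i + r) % d == 0) =
      (X.filter fun x => (x.cast : ZMod d) = r) ∪ X.filter fun x => (x.cast : ZMod d) = -(r : ZMod d) := by
    ext x
    have h1 : (x.cast : ZMod d) = (x.val : ZMod d) := by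
      rw [ZMod.natCast_val]
    have h2 : (x.val : ZMod d) = r ↔ x.val % d = r := by
      rw [ZMod.natCast_eq_natCast_iff, Nat.ModEq, Nat.mod_eq_of_lt hrd]
    have h3 : (x.val : ZMod d) = -(r : ZMod d) ↔ (x.val + r) % d = 0 := by
      rw [← Nat.dvd_iff_mod_eq_zero, ← ZMod.natCast_eq_zero_iff, Nat.cast_add, ← sub_eq_zero,
        sub_neg_eq_add]
    rw [mem_inter, mem_union, mem_filter, mem_filter, ← and_or_left, h1, h2, h3, mem_listSet]
    refine and_congr_right fun _ => ?_
    simp only [List.mem_filter, List.mem_range, Bool.or_eq_true, beq_iff_eq]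
    constructor
    · rintro ⟨i, ⟨hi, h⟩, rfl⟩
      rwa [ZMod.val_natCast_of_lt hi]
    · exact fun h => ⟨x.val, ⟨ZMod.val_lt x, h⟩, ZMod.natCast_zmod_val x⟩
  have hneg' : classCard d X (-(r : ZMod d)) = classCard d X r := classCard_neg hd hneg _
  have h2r : 2 * r % d = 0 ↔ (r : ZMod d) = -(r : ZMod d) := by
    rw [← Nat.dvd_iff_mod_eq_zero, ← ZMod.natCast_eq_zero_iff, ← sub_eq_zero (b := -(r : ZMod d)),
      sub_neg_eq_add, ← two_mul]
    push_cast; rfl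
  rw [e, hc]
  split_ifs with h
  · rw [← h2r.1 h, union_self]; rfl
  · rw [card_union_of_disjoint, two_mul]
    · conv_rhs => rw [← hneg']
      rw [hneg']
      exact congrArg _ hneg'
    · rw [disjoint_filter]
      intro x _ h1 h1'
      exact h (h2r.2 (h1.symm.trans h1'))

theorem NearFactorization.containsRow_of_runOdd (hF : NearFactorization X Y) {a q : ℕ}
    (hX : X.card = a) (hY : Y.card = a) (ha : a % 2 = 0) (ha30 : a ≤ 30) (hn : n < 255)
    (hodd : n % 2 = 1) (hT : HalfTable n (halfTable n q) q) {capA capB : List (List ℕ × ℕ)}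
    (hA : ∀ p ∈ capA, (X ∩ listSet n p.1).card = p.2)
    (hB : ∀ p ∈ capB, (Y ∩ listSet n p.1).card = p.2) {lA lB : List ℕ}
    (hlA : ∀ i ∈ lA, (i : ZMod n) ∈ X) (hlB : ∀ i ∈ lB, (i : ZMod n) ∈ Y)
    {rows : List (List ℕ × List ℕ)} {g J : ℕ} (hg : 0 < g ∧ g < n) (hJ : 0 < J)
    (hc : ∀ j < J, runOdd n q capA capB rows lA lB g J j = true) : ContainsRow X Y rows :=
  runOdd_sound hF (hF.doubleUnique hodd (by omega) (by omega)) hn (by omega) (by omega) hodd hT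
    hA hB hlA hlB (hF.zero_not_mem hodd (by omega)) (hF.symm.zero_not_mem hodd (by omega)) hJ
    hg.1 hg.2 hc

theorem NearFactorization.containsRow_of_runEven (hF : NearFactorization X Y) {a m : ℕ}
    (hX : X.card = a) (hY : Y.card = a) (ha30 : a ≤ 30) (hn : n < 255)
    (hm : n = 2 * m) (h0 : 0 ∈ X ∧ (m : ZMod n) ∈ Y ∧ (m : ZMod n) ∉ X ∧ 0 ∉ Y)
    {capA capB : List (List ℕ × ℕ)} (hA : ∀ p ∈ capA, (X ∩ listSet n p.1).card = p.2)
    (hB : ∀ p ∈ capB, (Y ∩ listSet n p.1).card = p.2) {lA lB : List ℕ}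
    (hlA : ∀ i ∈ lA, (i : ZMod n) ∈ X) (hlB : ∀ i ∈ lB, (i : ZMod n) ∈ Y)
    {rows : List (List ℕ × List ℕ)} {g J : ℕ} (hg : 0 < g ∧ g < n) (hJ : 0 < J)
    (hc : ∀ j < J, runEven n capA capB rows (0 :: lA) (m :: lB) g J j = true) :
    ContainsRow X Y rows := by
  obtain ⟨hX0, hYm, hXm, hY0⟩ := h0
  have hm0 : 0 < m := by have := NeZero.pos n; omega
  refine runEven_sound hF (not_doubleUnique hm hm0) hn (by omega) (by omega) hA hB
    (List.forall_mem_cons.2 ⟨by simpa using hX0, hlA⟩) (List.forall_mem_cons.2 ⟨hYm, hlB⟩) ?_ ?_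
    hJ hg.1 hg.2 hc
  · intro x hx e
    rcases (eq_neg_iff hm x).1 e with rfl | rfl
    · exact mem_symL.2 ⟨0, by simp, by simp⟩
    · exact absurd hx hXm
  · intro x hx e
    rcases (eq_neg_iff hm x).1 e with rfl | rfl
    · exact absurd hx hY0
    · exact mem_symL.2 ⟨m, by simp, Or.inl rfl⟩

/-- For `n` even it suffices to consider pairs with `0` in the first factor. -/
theorem Classified.of_even {a m : ℕ} (hm : n = 2 * m) (ha : a % 2 = 1)
    {rows : List (List ℕ × List ℕ)}
    (h : ∀ X Y : Finset (ZMod n), NearFactorization X Y → X.card = a → Y.card = a →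
      (0 ∈ X ∧ (m : ZMod n) ∈ Y ∧ (m : ZMod n) ∉ X ∧ 0 ∉ Y) → ContainsRow X Y rows) :
    Classified n a rows := by
  intro X Y hF hX hY
  rcases hF.zero_mem_or hm (hX ▸ ha) (hY ▸ ha) with h0 | h0
  · exact h X Y hF hX hY h0
  · exact (h Y X hF.symm hY hX h0).symm

theorem mem_scale_natCast_of_even {m : ℕ} (hm : n = 2 * m) (u : (ZMod n)ˣ) :
    (m : ZMod n) ∈ scale u X ↔ (m : ZMod n) ∈ X := by
  rw [mem_scale]
  have key : ((u⁻¹ : (ZMod n)ˣ) : ZMod n) * m = m := by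
    have h : ((u⁻¹ : (ZMod n)ˣ) : ZMod n) * m = -(((u⁻¹ : (ZMod n)ˣ) : ZMod n) * m) := by
      have := (eq_neg_iff hm (m : ZMod n)).2 (Or.inr rfl)
      linear_combination ((u⁻¹ : (ZMod n)ˣ) : ZMod n) * this
    rcases (eq_neg_iff hm _).1 h with h | h
    · have h' : (m : ZMod n) = 0 := u⁻¹.isUnit.mul_right_eq_zero.1 h
      rw [h', mul_zero]
    · exact h
  rw [key]

theorem zero_mem_scale (u : (ZMod n)ˣ) : 0 ∈ scale u X ↔ 0 ∈ X := by
  rw [mem_scale, mul_zero]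

theorem halves_scale {m : ℕ} (hm : n = 2 * m)
    (h0 : 0 ∈ X ∧ (m : ZMod n) ∈ Y ∧ (m : ZMod n) ∉ X ∧ 0 ∉ Y) (u : (ZMod n)ˣ) :
    0 ∈ scale u X ∧ (m : ZMod n) ∈ scale u Y ∧ (m : ZMod n) ∉ scale u X ∧ 0 ∉ scale u Y := by
  rw [zero_mem_scale, zero_mem_scale, mem_scale_natCast_of_even hm, mem_scale_natCast_of_even hm]
  exact h0

end

/-- The pairs of lists of a table, for the symmetric representations. -/
def symmetricLists (a : ℕ) : List (List ℕ × List ℕ) :=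
  (sedfTable a).map fun r => (r.symFirst, r.symSecond)

set_option maxRecDepth 100000

/-! ### The orders 2 to 122. -/

theorem classified_one : Classified 2 1 (symmetricLists 1) := by
  refine Classified.of_even (m := 1) rfl rfl fun X Y hF hX hY h0 => ?_
  refine ⟨1, by norm_num, _, List.mem_cons_self, Or.inl ⟨?_, ?_⟩⟩
  · intro i hi
    rw [List.mem_singleton.1 hi]; simpa using h0.1
  · intro i hi
    rw [List.mem_singleton.1 hi]; simpa using h0.2.1

theorem classified_two : Classified 5 2 (symmetricLists 2) := by
  intro X Y hF hX hY
  -- Here q separates the powers 256^i for i < n, as the table test confirms. Any nonzero uncovered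
  -- residue could serve as g, the one represented first.
  refine hF.containsRow_of_runOdd (q := 11) (lA := []) (lB := []) (g := 1) (J := 1) hX hY rfl
    (by norm_num) (by norm_num) rfl (by unfold HalfTable; decide +kernel) (fullCap_sound hX)
    (fullCap_sound hY) (by simp) (by simp) (by norm_num) one_pos ?_
  intro j hj; interval_cases j; decide +kernel

theorem classified_three : Classified 10 3 (symmetricLists 3) := by
  refine Classified.of_even (m := 5) rfl rfl fun X Y hF hX hY h0 => ?_
  refine hF.containsRow_of_runEven (lA := []) (lB := []) (g := 1) (J := 1) hX hY (by norm_num)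
    (by norm_num) rfl h0 (fullCap_sound hX) (fullCap_sound hY) (by simp) (by simp) (by norm_num)
    one_pos ?_
  intro j hj; interval_cases j; decide +kernel

theorem classified_four : Classified 17 4 (symmetricLists 4) := by
  intro X Y hF hX hY
  refine hF.containsRow_of_runOdd (q := 47) (lA := []) (lB := []) (g := 5) (J := 1) hX hY rfl
    (by norm_num) (by norm_num) rfl (by unfold HalfTable; decide +kernel) (fullCap_sound hX)
    (fullCap_sound hY) (by simp) (by simp) (by norm_num) one_pos ?_
  intro j hj; interval_cases j; decide +kernel

theorem classified_five : Classified 26 5 (symmetricLists 5) := by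
  refine Classified.of_even (m := 13) rfl rfl fun X Y hF hX hY h0 => ?_
  refine hF.containsRow_of_runEven (lA := []) (lB := []) (g := 2) (J := 1) hX hY (by norm_num)
    (by norm_num) rfl h0 (fullCap_sound hX) (fullCap_sound hY) (by simp) (by simp) (by norm_num)
    one_pos ?_
  intro j hj; interval_cases j; decide +kernel

theorem classified_six : Classified 37 6 (symmetricLists 6) := by
  intro X Y hF hX hY
  refine hF.containsRow_of_runOdd (q := 79) (lA := []) (lB := []) (g := 3) (J := 1) hX hY rfl
    (by norm_num) (by norm_num) rfl (by unfold HalfTable; decide +kernel) (fullCap_sound hX)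
    (fullCap_sound hY) (by simp) (by simp) (by norm_num) one_pos ?_
  intro j hj; interval_cases j; decide +kernel

theorem classified_seven : Classified 50 7 (symmetricLists 7) := by
  refine Classified.of_even (m := 25) rfl rfl fun X Y hF hX hY h0 => ?_
  refine hF.containsRow_of_runEven (lA := []) (lB := []) (g := 3) (J := 1) hX hY (by norm_num)
    (by norm_num) rfl h0 (fullCap_sound hX) (fullCap_sound hY) (by simp) (by simp) (by norm_num)
    one_pos ?_
  intro j hj; interval_cases j; decide +kernel

theorem halfTable_sixtyFive : HalfTable 65 (halfTable 65 131) 131 := by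
  unfold HalfTable; decide +kernel

/-- The entries are (d, 3d, g) with d a proper divisor of 65, for starting positions with d in X and
3d in Y, where g is represented first. -/
theorem run_sixtyFive : ∀ p ∈ [(1, 3, 6), (5, 15, 30), (13, 39, 15)], ∀ j < 1,
    runOdd 65 131 (fullCap 65 8) (fullCap 65 8) (symmetricLists 8) [p.1] [p.2.1] p.2.2 1 j = true := by
  intro p hp j hj
  interval_cases j
  revert p
  refine List.forall_mem_cons.2 ⟨by decide +kernel, List.forall_mem_cons.2 ⟨by decide +kernel,
    List.forall_mem_cons.2 ⟨by decide +kernel, List.forall_mem_nil _⟩⟩⟩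

/-- As 8 ≡ 2 modulo 3, some x in X has 3x in Y, and x can be scaled to a divisor d of 65. The case d
= 65 is x = 0, which is impossible for |X| even. -/
theorem classified_eight : Classified 65 8 (symmetricLists 8) := by
  intro X Y hF hX hY
  obtain ⟨x, hx, hx3⟩ := hF.exists_three_mul (by omega)
  obtain ⟨d, hd, u, hu⟩ := exists_scale_mem x
  have h1 : (d : ZMod 65) ∈ scale u X := mem_scale_of_mul_eq hx hu
  have h2 : ((3 * d : ℕ) : ZMod 65) ∈ scale u Y :=
    mem_scale_of_mul_eq hx3 (by push_cast; linear_combination 3 * hu)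
  have hF' := hF.scale u
  have hX' := (card_scale u X).trans hX
  have hY' := (card_scale u Y).trans hY
  have hd' : d ∈ Nat.divisors 65 := Nat.mem_divisors.2 ⟨hd, by norm_num⟩
  rw [show Nat.divisors 65 = {1, 5, 13, 65} by decide +kernel] at hd'
  have key : ∀ p ∈ [(1, 3, 6), (5, 15, 30), (13, 39, 15)], d = p.1 → ContainsRow X Y (symmetricLists 8) := by
    intro p hp e
    refine ContainsRow.of_scale (u := u) (hF'.containsRow_of_runOdd hX' hY' rfl (by norm_num)
      (by norm_num) rfl halfTable_sixtyFive (fullCap_sound hX') (fullCap_sound hY') (lA := [p.1])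
      (lB := [p.2.1]) ?_ ?_ ?_ one_pos (run_sixtyFive p hp))
    · simpa [← e] using h1
    · have e' : p.2.1 = 3 * p.1 := by clear e; revert p; decide
      simpa [e', ← e] using h2
    · clear e; revert p; decide
  simp only [mem_insert, mem_singleton] at hd'
  rcases hd' with rfl | rfl | rfl | rfl
  · exact key (1, 3, 6) (by simp) rfl
  · exact key (5, 15, 30) (by simp) rfl
  · exact key (13, 39, 15) (by simp) rfl
  · exact absurd h1 (hF'.zero_not_mem rfl (by omega))

theorem run_eightyTwo : ∀ j < 1,
    runEven 82 (fullCap 82 9) (fullCap 82 9) (symmetricLists 9) [0, 1] [41] 18 1 j = true := by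
  intro j hj; interval_cases j; decide +kernel

theorem classified_nine : Classified 82 9 (symmetricLists 9) := by
  refine Classified.of_even (m := 41) rfl rfl fun X Y hF hX hY h0 => ?_
  -- If all elements of X were even, the 40 nonzero even residues would be 9 times the number of
  -- even elements of Y. An odd element scales to 1 or 41, and 41 is not in X.
  obtain ⟨x, hx, hx1⟩ : ∃ x ∈ X, x.val % 2 = 1 := by
    by_contra hne
    push Not at hne
    have e : ∀ s : ZMod 2, _ := fun s => hF.sum_classCard (d := 2) (by norm_num) s
    have hev : ∀ x ∈ X, (x.cast : ZMod 2) = 0 := by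
      intro x hx
      have := hne x hx
      rw [← ZMod.natCast_val, ZMod.natCast_eq_zero_iff]
      omega
    have h1 : classCard 2 X 1 = 0 := by
      rw [classCard, card_eq_zero, filter_eq_empty_iff]
      intro x hx h; rw [hev x hx] at h; exact absurd h (by decide)
    have h2 : classCard 2 X 0 = 9 := by
      rw [classCard, filter_true_of_mem hev, hX]
    have := e 0
    rw [show (univ : Finset (ZMod 2)) = {0, 1} from rfl] at this
    rw [sum_pair (by decide), h1, h2] at this
    rw [show ((univ.erase (0 : ZMod 82)).filter fun x => (x.cast : ZMod 2) = 0).card = 40 by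
      decide +kernel] at this
    omega
  obtain ⟨d, hd, u, hu⟩ := exists_scale_mem x
  have h1 : (d : ZMod 82) ∈ scale u X := mem_scale_of_mul_eq hx hu
  have hF' := hF.scale u
  have hX' := (card_scale u X).trans hX
  have hY' := (card_scale u Y).trans hY
  have hd' : d ∈ Nat.divisors 82 := Nat.mem_divisors.2 ⟨hd, by norm_num⟩
  rw [show Nat.divisors 82 = {1, 2, 41, 82} by decide +kernel] at hd'
  have h0' : 0 ∈ scale u X ∧ ((41 : ℕ) : ZMod 82) ∈ scale u Y ∧
      ((41 : ℕ) : ZMod 82) ∉ scale u X ∧ 0 ∉ scale u Y :=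
    halves_scale rfl h0 u
  have hpar : d % 2 = 1 := by
    have h2 : (x.cast : ZMod 2) = 1 := by
      rw [← ZMod.natCast_val, ← Nat.cast_one, ZMod.natCast_eq_natCast_iff]; exact hx1
    have := congrArg (ZMod.cast : ZMod 82 → ZMod 2) hu
    rw [ZMod.cast_mul (by norm_num), h2, mul_one, ZMod.cast_natCast (by norm_num)] at this
    have hu2 : IsUnit ((u : ZMod 82).cast : ZMod 2) :=
      u.isUnit.map (ZMod.castHom (by norm_num : 2 ∣ 82) (ZMod 2))
    rw [this] at hu2
    exact Nat.odd_iff.1 ((Nat.coprime_two_right).1 ((ZMod.isUnit_iff_coprime d 2).1 hu2))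
  simp only [mem_insert, mem_singleton] at hd'
  rcases hd' with rfl | rfl | rfl | rfl
  · exact ContainsRow.of_scale (hF'.containsRow_of_runEven (lA := [1]) (lB := []) hX' hY'
      (by norm_num) (by norm_num) rfl h0' (fullCap_sound hX') (fullCap_sound hY') (by simpa using h1)
      (by simp) (by norm_num) one_pos run_eightyTwo)
  · omega
  · exact absurd h1 h0'.2.2.1
  · omega

theorem halfTable_oneHundredOne : HalfTable 101 (halfTable 101 211) 211 := by
  unfold HalfTable; decide +kernel

set_option maxHeartbeats 0 in
theorem run_oneHundredOne : ∀ j < 12,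
    runOdd 101 211 (fullCap 101 10) (fullCap 101 10) (symmetricLists 10) [1] [] 2 12 j = true := by
  intro j hj
  interval_cases j <;> decide +kernel

/-- The order is prime, so an element of X scales to 1. As 10 ≡ 1 modulo 3, no pair x, 3x is
available and the search starts from 1 alone. -/
theorem classified_ten : Classified 101 10 (symmetricLists 10) := by
  intro X Y hF hX hY
  obtain ⟨x, hx⟩ := hF.left_nonempty
  obtain ⟨d, hd, u, hu⟩ := exists_scale_mem x
  have h1 : (d : ZMod 101) ∈ scale u X := mem_scale_of_mul_eq hx hu
  have hF' := hF.scale u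
  have hX' := (card_scale u X).trans hX
  have hY' := (card_scale u Y).trans hY
  rcases (Nat.dvd_prime (by norm_num)).1 hd with rfl | rfl
  · exact ContainsRow.of_scale (hF'.containsRow_of_runOdd (lA := [1]) (lB := []) hX' hY' rfl
      (by norm_num) (by norm_num) rfl halfTable_oneHundredOne (fullCap_sound hX')
      (fullCap_sound hY') (by simpa using h1) (by simp) (by norm_num) (by norm_num)
      run_oneHundredOne)
  · exact absurd h1 (hF'.zero_not_mem rfl (by omega))

set_option maxHeartbeats 0 in
theorem run_oneHundredTwentyTwo : ∀ p ∈ [(1, 3, 29), (2, 6, 60)], ∀ j < 2,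
    runEven 122 (fullCap 122 11) (fullCap 122 11) (symmetricLists 11) [0, p.1] [61, p.2.1] p.2.2 2 j
      = true := by
  simp only [List.forall_mem_cons]
  refine ⟨?_, ?_, List.forall_mem_nil _⟩
  all_goals intro j hj
  all_goals interval_cases j <;> decide +kernel

/-- Again 11 ≡ 2 modulo 3. Of the divisors of 122, the case d = 61 fails because 61 is not in X, and
d = 122 because 3d = 0 is not in Y. -/
theorem classified_eleven : Classified 122 11 (symmetricLists 11) := by
  refine Classified.of_even (m := 61) rfl rfl fun X Y hF hX hY h0 => ?_
  obtain ⟨x, hx, hx3⟩ := hF.exists_three_mul (by omega)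
  obtain ⟨d, hd, u, hu⟩ := exists_scale_mem x
  have h1 : (d : ZMod 122) ∈ scale u X := mem_scale_of_mul_eq hx hu
  have h2 : ((3 * d : ℕ) : ZMod 122) ∈ scale u Y :=
    mem_scale_of_mul_eq hx3 (by push_cast; linear_combination 3 * hu)
  have hF' := hF.scale u
  have hX' := (card_scale u X).trans hX
  have hY' := (card_scale u Y).trans hY
  have h0' : 0 ∈ scale u X ∧ ((61 : ℕ) : ZMod 122) ∈ scale u Y ∧
      ((61 : ℕ) : ZMod 122) ∉ scale u X ∧ 0 ∉ scale u Y :=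
    halves_scale rfl h0 u
  have hd' : d ∈ Nat.divisors 122 := Nat.mem_divisors.2 ⟨hd, by norm_num⟩
  rw [show Nat.divisors 122 = {1, 2, 61, 122} by decide +kernel] at hd'
  have key : ∀ p ∈ [(1, 3, 29), (2, 6, 60)], d = p.1 → ContainsRow X Y (symmetricLists 11) := by
    intro p hp e
    refine ContainsRow.of_scale (u := u) (hF'.containsRow_of_runEven hX' hY' (by norm_num)
      (by norm_num) rfl h0' (fullCap_sound hX') (fullCap_sound hY') (lA := [p.1])
      (lB := [p.2.1]) ?_ ?_ ?_ two_pos (run_oneHundredTwentyTwo p hp))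
    · simpa [← e] using h1
    · have e' : p.2.1 = 3 * p.1 := by clear e; revert p; decide
      simpa [e', ← e] using h2
    · clear e; revert p; decide
  simp only [mem_insert, mem_singleton] at hd'
  rcases hd' with rfl | rfl | rfl | rfl
  · exact key (1, 3, 29) (by simp) rfl
  · exact key (2, 6, 60) (by simp) rfl
  · exact absurd h1 h0'.2.2.1
  · exact absurd h2 h0'.2.2.2

/-! ### Order 145 -/

theorem halfTable_oneHundredFortyFive : HalfTable 145 (halfTable 145 311) 311 := by
  unfold HalfTable; decide +kernel

/-- The numbers of elements in the classes `{0}, {± 1}, {± 2}` modulo 5. -/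
def classCapsFive (c : ℕ × ℕ × ℕ) : List (List ℕ × ℕ) :=
  classCaps 145 5 [(0, c.1), (1, c.2.1), (2, c.2.2)]

set_option maxHeartbeats 0 in
-- The first entries represent the k modulo 29 other than 0 and ±1, up to sign and inversion.
theorem run_oneHundredFortyFive : ∀ p ∈ [(2, 20), (3, 30), (4, 40), (5, 10), (8, 65), (9, 55), (12, 25)],
    ∀ j < 4, runOdd 145 311 (classCapsFive (2, 4, 6)) (classCapsFive (2, 6, 4)) (symmetricLists 12)
      [5] [5 * p.1] p.2 4 j = true := by
  simp only [List.forall_mem_cons]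
  refine ⟨?_, ?_, ?_, ?_, ?_, ?_, ?_, List.forall_mem_nil _⟩
  all_goals intro j hj
  all_goals interval_cases j <;> decide +kernel

set_option maxHeartbeats 0 in
theorem run_oneHundredFortyFive' : ∀ p ∈ [(1, 2), (29, 45)],
    ∀ j < 12, runOdd 145 311 (classCapsFive (4, 2, 6)) (classCapsFive (4, 6, 2)) (symmetricLists 12)
      [p.1] [] p.2 12 j = true := by
  simp only [List.forall_mem_cons]
  refine ⟨?_, ?_, List.forall_mem_nil _⟩
  all_goals intro j hj
  all_goals interval_cases j <;> decide +kernel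

def HasClassCountsFive (X : Finset (ZMod 145)) (c : ℕ × ℕ × ℕ) : Prop :=
  classCard 5 X 0 = c.1 ∧ 2 * classCard 5 X 1 = c.2.1 ∧ 2 * classCard 5 X 2 = c.2.2

theorem HasClassCountsFive.caps {X : Finset (ZMod 145)} {c : ℕ × ℕ × ℕ}
    (h : HasClassCountsFive X c) (hneg : ∀ x ∈ X, -x ∈ X) :
    ∀ p ∈ classCapsFive c, (X ∩ listSet 145 p.1).card = p.2 := by
  obtain ⟨h0, h1, h2⟩ := h
  refine classCaps_sound (by norm_num) hneg ?_
  intro p hp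
  simp only [List.mem_cons, List.not_mem_nil, or_false] at hp
  rcases hp with rfl | rfl | rfl
  · simpa using h0.symm
  · simpa using h1.symm
  · simpa using h2.symm

theorem class_equations_five {x1 x2 y1 y2 : ℕ} (hx : x1 + x2 ≤ 6) (hy : y1 + y2 ≤ 6)
    (h0 : (12 - 2 * x1 - 2 * x2) * (12 - 2 * y1 - 2 * y2) + 2 * x1 * y1 + 2 * x2 * y2 = 28)
    (h1 : (12 - 2 * x1 - 2 * x2) * y1 + x1 * (12 - 2 * y1 - 2 * y2) + x2 * y1 + x2 * y2 + x1 * y2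
      = 29)
    (h2 : (12 - 2 * x1 - 2 * x2) * y2 + x1 * y1 + x2 * (12 - 2 * y1 - 2 * y2) + x2 * y1 + x1 * y2
      = 29) :
    [x1, x2, y1, y2] ∈ [[2, 3, 3, 2], [3, 2, 2, 3], [1, 3, 3, 1], [3, 1, 1, 3]] := by
  have key : ∀ p ∈ ((List.range 7).flatMap fun x1 => (List.range 7).flatMap fun x2 =>
      (List.range 7).flatMap fun y1 => (List.range 7).map fun y2 => (x1, x2, y1, y2)).filter
      fun p => decide (
        (12 - 2 * p.1 - 2 * p.2.1) * (12 - 2 * p.2.2.1 - 2 * p.2.2.2) + 2 * p.1 * p.2.2.1 +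
          2 * p.2.1 * p.2.2.2 = 28 ∧
        (12 - 2 * p.1 - 2 * p.2.1) * p.2.2.1 + p.1 * (12 - 2 * p.2.2.1 - 2 * p.2.2.2) +
          p.2.1 * p.2.2.1 + p.2.1 * p.2.2.2 + p.1 * p.2.2.2 = 29 ∧
        (12 - 2 * p.1 - 2 * p.2.1) * p.2.2.2 + p.1 * p.2.2.1 +
          p.2.1 * (12 - 2 * p.2.2.1 - 2 * p.2.2.2) + p.2.1 * p.2.2.1 + p.1 * p.2.2.2 = 29),
      p.1 + p.2.1 ≤ 6 → p.2.2.1 + p.2.2.2 ≤ 6 → [p.1, p.2.1, p.2.2.1, p.2.2.2] ∈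
        [[2, 3, 3, 2], [3, 2, 2, 3], [1, 3, 3, 1], [3, 1, 1, 3]] := by
    decide +kernel
  refine key (x1, x2, y1, y2) (List.mem_filter.2 ⟨?_, decide_eq_true ⟨h0, h1, h2⟩⟩) hx hy
  simp only [List.mem_flatMap, List.mem_map, List.mem_range]
  exact ⟨x1, by omega, x2, by omega, y1, by omega, y2, by omega, rfl⟩

theorem sum_zmod_five (f : ZMod 5 → ℕ) : ∑ r, f r = f 0 + f 1 + f 2 + f 3 + f 4 :=
  Fin.sum_univ_five f

theorem classEquations_five {f g : ZMod 5 → ℕ} {c : ZMod 5 → ℕ} (hf4 : f 4 = f 1) (hf3 : f 3 = f 2)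
    (hg4 : g 4 = g 1) (hg3 : g 3 = g 2) (h : ∀ s, ∑ r, f r * g (s - r) = c s) :
    f 0 * g 0 + 2 * f 1 * g 1 + 2 * f 2 * g 2 = c 0 ∧
    f 0 * g 1 + f 1 * g 0 + f 2 * g 1 + f 2 * g 2 + f 1 * g 2 = c 1 ∧
    f 0 * g 2 + f 1 * g 1 + f 2 * g 0 + f 2 * g 1 + f 1 * g 2 = c 2 := by
  refine ⟨?_, ?_, ?_⟩
  · rw [← h 0, sum_zmod_five]
    change _ = f 0 * g 0 + f 1 * g 4 + f 2 * g 3 + f 3 * g 2 + f 4 * g 1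
    rw [hf4, hf3, hg4, hg3]; ring
  · rw [← h 1, sum_zmod_five]
    change _ = f 0 * g 1 + f 1 * g 0 + f 2 * g 4 + f 3 * g 3 + f 4 * g 2
    rw [hf4, hf3, hg4, hg3]
  · rw [← h 2, sum_zmod_five]
    change _ = f 0 * g 2 + f 1 * g 1 + f 2 * g 0 + f 3 * g 4 + f 4 * g 3
    rw [hf4, hf3, hg4, hg3]

/-- Symmetry leaves three counts for each factor. Their convolution must give 28 in the class of 0
and 29 in the others, since only 0 is missed; a finite enumeration finds four solutions, two up to
interchange. -/
theorem NearFactorization.classCounts_five {X Y : Finset (ZMod 145)} (hF : NearFactorization X Y)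
    (hX : X.card = 12) (hY : Y.card = 12) :
    (HasClassCountsFive X (2, 4, 6) ∧ HasClassCountsFive Y (2, 6, 4)) ∨
    (HasClassCountsFive Y (2, 4, 6) ∧ HasClassCountsFive X (2, 6, 4)) ∨
    (HasClassCountsFive X (4, 2, 6) ∧ HasClassCountsFive Y (4, 6, 2)) ∨
    (HasClassCountsFive Y (4, 2, 6) ∧ HasClassCountsFive X (4, 6, 2)) := by
  have hneg : ∀ Z : Finset (ZMod 145), (∀ z ∈ Z, -z ∈ Z) →
      classCard 5 Z 4 = classCard 5 Z 1 ∧ classCard 5 Z 3 = classCard 5 Z 2 := fun Z hZ =>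
    ⟨classCard_neg (by norm_num) hZ 1, classCard_neg (by norm_num) hZ 2⟩
  obtain ⟨hX4, hX3⟩ := hneg X hF.neg_left
  obtain ⟨hY4, hY3⟩ := hneg Y hF.neg_right
  have hsX := sum_classCard_eq (d := 5) X
  have hsY := sum_classCard_eq (d := 5) Y
  rw [sum_zmod_five, hX3, hX4, hX] at hsX
  rw [sum_zmod_five, hY3, hY4, hY] at hsY
  obtain ⟨h0, h1, h2⟩ := classEquations_five hX4 hX3 hY4 hY3
    (fun s => hF.sum_classCard (d := 5) (by norm_num) s)
  rw [show ((univ.erase (0 : ZMod 145)).filter fun x => (x.cast : ZMod 5) = 0).card = 28 by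
    decide +kernel] at h0
  rw [show ((univ.erase (0 : ZMod 145)).filter fun x => (x.cast : ZMod 5) = 1).card = 29 by
    decide +kernel] at h1
  rw [show ((univ.erase (0 : ZMod 145)).filter fun x => (x.cast : ZMod 5) = 2).card = 29 by
    decide +kernel] at h2
  unfold HasClassCountsFive
  generalize classCard 5 X 0 = x0 at *
  generalize classCard 5 X 1 = x1 at *
  generalize classCard 5 X 2 = x2 at *
  generalize classCard 5 Y 0 = y0 at *
  generalize classCard 5 Y 1 = y1 at *
  generalize classCard 5 Y 2 = y2 at *
  obtain rfl : x0 = 12 - 2 * x1 - 2 * x2 := by omega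
  obtain rfl : y0 = 12 - 2 * y1 - 2 * y2 := by omega
  have := class_equations_five (by omega) (by omega) h0 h1 h2
  simp only [List.mem_cons, List.cons.injEq, List.not_mem_nil, or_false, and_true] at this
  clear h0 h1 h2
  rcases this with ⟨rfl, rfl, rfl, rfl⟩ | ⟨rfl, rfl, rfl, rfl⟩ | ⟨rfl, rfl, rfl, rfl⟩ |
    ⟨rfl, rfl, rfl, rfl⟩ <;> simp

/-- A unit ≡ 1 modulo 5 preserves the classes, and a unit ≡ 2 interchanges ±1 and ±2. -/
theorem HasClassCountsFive.scale {X : Finset (ZMod 145)} {c c' : ℕ × ℕ × ℕ} {u : (ZMod 145)ˣ}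
    (h : HasClassCountsFive X c) (hneg : ∀ x ∈ X, -x ∈ X)
    (hc : ((u : ZMod 145).cast = (1 : ZMod 5) ∧ c' = c) ∨
      ((u : ZMod 145).cast = (2 : ZMod 5) ∧ c' = (c.1, c.2.2, c.2.1))) :
    HasClassCountsFive (scale u X) c' := by
  have key : ∀ r, classCard 5 (_root_.scale u X) (((u : ZMod 145).cast : ZMod 5) * r) =
      classCard 5 X r := classCard_scale (by norm_num) u
  obtain ⟨h0, h1, h2⟩ := h
  rcases hc with ⟨hu, rfl⟩ | ⟨hu, rfl⟩
  · simp only [hu, one_mul] at key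
    exact ⟨(key 0).trans h0, by rw [key]; exact h1, by rw [key]; exact h2⟩
  · rw [hu] at key
    refine ⟨(key 0).trans h0, ?_, ?_⟩
    · have e := key (-2)
      rw [show (2 : ZMod 5) * -2 = 1 by decide] at e
      rw [e, classCard_neg (by norm_num) hneg]; exact h2
    · have e : classCard 5 (_root_.scale u X) 2 = classCard 5 X 1 := key 1
      rw [e]; exact h1

theorem exists_unit_of_coprime {u : ℕ} {n : ℕ} (hu : Nat.gcd u n = 1) :
    ∃ v : (ZMod n)ˣ, (v : ZMod n) = u := (ZMod.isUnit_iff_coprime u n).2 hu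

set_option synthInstance.maxSize 1000 in
set_option synthInstance.maxHeartbeats 100000 in
-- Each factor has just two multiples of 5, say ±5k. A unit ≡ 1 modulo 5 normalizes those of X to
-- ±5. A unit ≡ 2 combined with interchange of the factors restores the class counts and replaces
-- the k of Y by its inverse modulo 29, up to sign.
theorem containsRow_of_classCounts_two {X Y : Finset (ZMod 145)} (hF : NearFactorization X Y)
    (hX : X.card = 12) (hY : Y.card = 12) (hcX : HasClassCountsFive X (2, 4, 6))
    (hcY : HasClassCountsFive Y (2, 6, 4)) : ContainsRow X Y (symmetricLists 12) := by
  have hex : ∀ Z : Finset (ZMod 145), classCard 5 Z 0 = 2 → 0 ∉ Z →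
      ∃ k < 29, k ≠ 0 ∧ ((5 * k : ℕ) : ZMod 145) ∈ Z := by
    intro Z hc h0
    have : (Z.filter fun x => (x.cast : ZMod 5) = 0).Nonempty := by
      rw [← card_pos]
      have : 0 < classCard 5 Z 0 := by omega
      exact this
    obtain ⟨z, hz⟩ := this
    obtain ⟨hz, hz5⟩ := mem_filter.1 hz
    rw [← ZMod.natCast_val, ZMod.natCast_eq_zero_iff] at hz5
    obtain ⟨k, hk⟩ := hz5
    have e : ((5 * k : ℕ) : ZMod 145) = z := by rw [← hk]; exact ZMod.natCast_zmod_val z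
    refine ⟨k, ?_, ?_, e ▸ hz⟩
    · have := ZMod.val_lt z; omega
    · rintro rfl; exact h0 (by rw [← e] at hz; simpa using hz)
  have run : ∀ X Y : Finset (ZMod 145), NearFactorization X Y → X.card = 12 → Y.card = 12 →
      HasClassCountsFive X (2, 4, 6) → HasClassCountsFive Y (2, 6, 4) →
      ∀ p ∈ [(2, 20), (3, 30), (4, 40), (5, 10), (8, 65), (9, 55), (12, 25)],
      ((5 : ℕ) : ZMod 145) ∈ X → ((5 * p.1 : ℕ) : ZMod 145) ∈ Y →
      ContainsRow X Y (symmetricLists 12) := by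
    intro X Y hF hX hY hcX hcY p hp h1 h2
    refine hF.containsRow_of_runOdd (lA := [5]) (lB := [5 * p.1]) hX hY rfl (by norm_num)
      (by norm_num) rfl halfTable_oneHundredFortyFive (hcX.caps hF.neg_left)
      (hcY.caps hF.neg_right) (by simpa using h1) (by simpa using h2) ?_ (by norm_num)
      (run_oneHundredFortyFive p hp)
    clear h2; revert p; decide
  obtain ⟨k, hk, hk0, hkX⟩ := hex X hcX.1 (hF.zero_not_mem rfl (by omega))
  obtain ⟨u, -, hu, hu5, huk⟩ : ∃ u < 145, Nat.gcd u 145 = 1 ∧ u % 5 = 1 ∧ u * (5 * k) % 145 = 5 := by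
    have : ∀ k < 29, k ≠ 0 → ∃ u < 145, Nat.gcd u 145 = 1 ∧ u % 5 = 1 ∧ u * (5 * k) % 145 = 5 := by
      decide +kernel
    exact this k hk hk0
  have cast5 : ∀ u : ℕ, ((u : ZMod 145).cast : ZMod 5) = ((u % 5 : ℕ) : ZMod 5) := fun u => by
    rw [ZMod.cast_natCast (by norm_num), ZMod.natCast_mod]
  have cast145 : ∀ {a b : ℕ}, a % 145 = b % 145 → (a : ZMod 145) = b := fun h =>
    (ZMod.natCast_eq_natCast_iff _ _ _).2 h
  obtain ⟨v, hv⟩ := exists_unit_of_coprime hu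
  refine ContainsRow.of_scale (u := v) ?_
  have h5 : ((5 : ℕ) : ZMod 145) ∈ scale v X := mem_scale_of_mul_eq hkX (by
    rw [hv, ← Nat.cast_mul]; exact cast145 (by rw [huk]))
  have hv1 : ((v : ZMod 145).cast : ZMod 5) = 1 := by rw [hv, cast5, hu5]; rfl
  replace hcX := hcX.scale hF.neg_left (Or.inl ⟨hv1, rfl⟩)
  replace hcY := hcY.scale hF.neg_right (Or.inl ⟨hv1, rfl⟩)
  replace hX := (card_scale v X).trans hX
  replace hY := (card_scale v Y).trans hY
  replace hF := hF.scale v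
  generalize scale v X = X at *
  generalize scale v Y = Y at *
  clear hkX
  obtain ⟨k, hk, hk0, hkY⟩ := hex Y hcY.1 (hF.symm.zero_not_mem rfl (by omega))
  have hneg : ∀ {a b : ℕ}, (a + b) % 145 = 0 → (b : ZMod 145) = -(a : ZMod 145) := fun {a b} h => by
    rw [eq_neg_iff_add_eq_zero, add_comm, ← Nat.cast_add, ZMod.natCast_eq_zero_iff]
    exact Nat.dvd_of_mod_eq_zero h
  -- The values k = ±1 would make 0 a sum.
  have hk1 : k ≠ 28 := by
    rintro rfl
    exact hF.add_ne_zero _ h5 _ hkY (by rw [hneg (a := 5) (b := 5 * 28) rfl]; simp)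
  have hk2 : k ≠ 1 := by
    rintro rfl
    exact hF.add_ne_zero _ h5 _ (hF.neg_right _ hkY) (by simp)
  have key : ∀ k < 29, k ≠ 0 → k ≠ 28 → k ≠ 1 →
      ∃ p ∈ [(2, 20), (3, 30), (4, 40), (5, 10), (8, 65), (9, 55), (12, 25)], k = p.1 ∨ 29 - k = p.1 ∨
      ∃ u < 145, Nat.gcd u 145 = 1 ∧ u % 5 = 2 ∧ u * (5 * k) % 145 = 5 ∧
        (u * 5 % 145 = 5 * p.1 ∨ (u * 5 + 5 * p.1) % 145 = 0) := by
    decide +kernel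
  obtain ⟨p, hp, rfl | h | ⟨u, -, hu, hu5, huk, hp5⟩⟩ := key k hk hk0 hk1 hk2
  · exact run X Y hF hX hY hcX hcY p hp h5 hkY
  · refine run X Y hF hX hY hcX hcY p hp h5 ?_
    rw [hneg (a := 5 * k) (by omega)]
    exact hF.neg_right _ hkY
  · obtain ⟨v, hv⟩ := exists_unit_of_coprime hu
    refine (ContainsRow.of_scale (u := v) ?_).symm
    have hv2 : ((v : ZMod 145).cast : ZMod 5) = 2 := by rw [hv, cast5, hu5]; rfl
    have hF' := hF.symm.scale v
    refine run _ _ hF' ((card_scale v Y).trans hY) ((card_scale v X).trans hX)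
      (hcY.scale hF.neg_right (Or.inr ⟨hv2, rfl⟩)) (hcX.scale hF.neg_left (Or.inr ⟨hv2, rfl⟩)) p hp
      (mem_scale_of_mul_eq hkY (by rw [hv, ← Nat.cast_mul]; exact cast145 (by rw [huk]))) ?_
    have h5' : ((u * 5 : ℕ) : ZMod 145) ∈ scale v X := mem_scale_of_mul_eq h5 (by
      rw [hv, ← Nat.cast_mul])
    rcases hp5 with h | h
    · rw [← cast145 (a := u * 5) (b := 5 * p.1) (by omega)]; exact h5'
    · rw [hneg h]; exact hF'.neg_right _ h5'

/-- X has an element ≡ 1 modulo 5. If it is a unit modulo 29, a unit ≡ 1 modulo 5 takes it to 1. The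
only other such residue is -29, and then 29 is in X by symmetry. -/
theorem containsRow_of_classCounts_four {X Y : Finset (ZMod 145)} (hF : NearFactorization X Y)
    (hX : X.card = 12) (hY : Y.card = 12) (hcX : HasClassCountsFive X (4, 2, 6))
    (hcY : HasClassCountsFive Y (4, 6, 2)) : ContainsRow X Y (symmetricLists 12) := by
  have run : ∀ X Y : Finset (ZMod 145), NearFactorization X Y → X.card = 12 → Y.card = 12 →
      HasClassCountsFive X (4, 2, 6) → HasClassCountsFive Y (4, 6, 2) →
      ∀ p ∈ [(1, 2), (29, 45)], ((p.1 : ℕ) : ZMod 145) ∈ X →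
      ContainsRow X Y (symmetricLists 12) := by
    intro X Y hF hX hY hcX hcY p hp h1
    refine hF.containsRow_of_runOdd (lA := [p.1]) (lB := []) hX hY rfl (by norm_num)
      (by norm_num) rfl halfTable_oneHundredFortyFive (hcX.caps hF.neg_left)
      (hcY.caps hF.neg_right) (by simpa using h1) (by simp) ?_ (by norm_num)
      (run_oneHundredFortyFive' p hp)
    clear h1; revert p; decide
  obtain ⟨x, hx⟩ : (X.filter fun x => (x.cast : ZMod 5) = 1).Nonempty := by
    rw [← card_pos]
    have h := hcX.2.1
    unfold classCard at h
    simp only at h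
    omega
  obtain ⟨hx, hx5⟩ := mem_filter.1 hx
  have key : ∀ x : ZMod 145, (x.cast : ZMod 5) = 1 → x = -29 ∨
      ∃ u < 145, Nat.gcd u 145 = 1 ∧ u % 5 = 1 ∧ (u : ZMod 145) * x = 1 := by
    decide +kernel
  rcases key x hx5 with rfl | ⟨u, -, hu, hu5, hux⟩
  · exact run X Y hF hX hY hcX hcY (29, 45) (by simp) (by simpa using hF.neg_left _ hx)
  · obtain ⟨v, hv⟩ := exists_unit_of_coprime hu
    have hv1 : ((v : ZMod 145).cast : ZMod 5) = 1 := by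
      rw [hv, ZMod.cast_natCast (by norm_num), ← ZMod.natCast_mod, hu5]; rfl
    refine ContainsRow.of_scale (u := v) ?_
    exact run _ _ (hF.scale v) ((card_scale v X).trans hX) ((card_scale v Y).trans hY)
      (hcX.scale hF.neg_left (Or.inl ⟨hv1, rfl⟩)) (hcY.scale hF.neg_right (Or.inl ⟨hv1, rfl⟩))
      (1, 2) (by simp) (mem_scale_of_mul_eq hx (by rw [hv, hux]; simp))

theorem classified_twelve : Classified 145 12 (symmetricLists 12) := by
  intro X Y hF hX hY
  rcases hF.classCounts_five hX hY with ⟨h1, h2⟩ | ⟨h1, h2⟩ | ⟨h1, h2⟩ | ⟨h1, h2⟩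
  · exact containsRow_of_classCounts_two hF hX hY h1 h2
  · exact (containsRow_of_classCounts_two hF.symm hY hX h1 h2).symm
  · exact containsRow_of_classCounts_four hF hX hY h1 h2
  · exact (containsRow_of_classCounts_four hF.symm hY hX h1 h2).symm

/-! ### Order 170 -/

theorem sum_zmod_ten (f : ZMod 10 → ℕ) :
    ∑ r, f r = f 0 + f 1 + f 2 + f 3 + f 4 + f 5 + f 6 + f 7 + f 8 + f 9 := by
  have h : ∀ f : Fin 10 → ℕ,
      ∑ r, f r = f 0 + f 1 + f 2 + f 3 + f 4 + f 5 + f 6 + f 7 + f 8 + f 9 := fun f => by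
    simp only [Fin.sum_univ_castSucc, univ_eq_empty, sum_empty, zero_add]
    rfl
  exact h f

/-- Numbers of elements in the classes `0, ± 1, ± 2, ± 3, ± 4, 5` modulo 10. -/
structure ClassCountsTen where
  (c0 c1 c2 c3 c4 c5 : ℕ)

def HasClassCountsTen (X : Finset (ZMod 170)) (c : ClassCountsTen) : Prop :=
  classCard 10 X 0 = c.c0 ∧ classCard 10 X 1 = c.c1 ∧ classCard 10 X 2 = c.c2 ∧
    classCard 10 X 3 = c.c3 ∧ classCard 10 X 4 = c.c4 ∧ classCard 10 X 5 = c.c5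

/-- The number of ways to represent a class modulo 10. -/
def ClassCountsTen.reps (x y : ClassCountsTen) : List ℕ :=
  [x.c0 * y.c0 + x.c1 * y.c1 + x.c2 * y.c2 + x.c3 * y.c3 + x.c4 * y.c4 + x.c5 * y.c5 + x.c4 *
      y.c4 + x.c3 * y.c3 + x.c2 * y.c2 + x.c1 * y.c1,
    x.c0 * y.c1 + x.c1 * y.c0 + x.c2 * y.c1 + x.c3 * y.c2 + x.c4 * y.c3 + x.c5 * y.c4 + x.c4 *
      y.c5 + x.c3 * y.c4 + x.c2 * y.c3 + x.c1 * y.c2,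
    x.c0 * y.c2 + x.c1 * y.c1 + x.c2 * y.c0 + x.c3 * y.c1 + x.c4 * y.c2 + x.c5 * y.c3 + x.c4 *
      y.c4 + x.c3 * y.c5 + x.c2 * y.c4 + x.c1 * y.c3,
    x.c0 * y.c3 + x.c1 * y.c2 + x.c2 * y.c1 + x.c3 * y.c0 + x.c4 * y.c1 + x.c5 * y.c2 + x.c4 *
      y.c3 + x.c3 * y.c4 + x.c2 * y.c5 + x.c1 * y.c4,
    x.c0 * y.c4 + x.c1 * y.c3 + x.c2 * y.c2 + x.c3 * y.c1 + x.c4 * y.c0 + x.c5 * y.c1 + x.c4 *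
      y.c2 + x.c3 * y.c3 + x.c2 * y.c4 + x.c1 * y.c5,
    x.c0 * y.c5 + x.c1 * y.c4 + x.c2 * y.c3 + x.c3 * y.c2 + x.c4 * y.c1 + x.c5 * y.c0 + x.c4 *
      y.c1 + x.c3 * y.c2 + x.c2 * y.c3 + x.c1 * y.c4]

theorem reps_classCard {X Y : Finset (ZMod 170)} (hF : NearFactorization X Y) {x y : ClassCountsTen}
    (hx : HasClassCountsTen X x) (hy : HasClassCountsTen Y y) : x.reps y = [16, 17, 17, 17, 17, 17] := by
  have hneg : ∀ Z : Finset (ZMod 170), (∀ z ∈ Z, -z ∈ Z) →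
      classCard 10 Z 9 = classCard 10 Z 1 ∧ classCard 10 Z 8 = classCard 10 Z 2 ∧
      classCard 10 Z 7 = classCard 10 Z 3 ∧ classCard 10 Z 6 = classCard 10 Z 4 := fun Z hZ =>
    ⟨classCard_neg (by norm_num) hZ 1, classCard_neg (by norm_num) hZ 2,
      classCard_neg (by norm_num) hZ 3, classCard_neg (by norm_num) hZ 4⟩
  obtain ⟨x0, x1, x2, x3, x4, x5⟩ := hx
  obtain ⟨y0, y1, y2, y3, y4, y5⟩ := hy
  obtain ⟨x9, x8, x7, x6⟩ := hneg X hF.neg_left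
  obtain ⟨y9, y8, y7, y6⟩ := hneg Y hF.neg_right
  rw [x1] at x9; rw [x2] at x8; rw [x3] at x7; rw [x4] at x6
  rw [y1] at y9; rw [y2] at y8; rw [y3] at y7; rw [y4] at y6
  have h : ∀ s : ZMod 10, _ := fun s => hF.sum_classCard (d := 10) (by norm_num) s
  have hs : ∀ s : ZMod 10, ((univ.erase (0 : ZMod 170)).filter fun x => (x.cast : ZMod 10) = s).card =
      if s = 0 then 16 else 17 := by decide +kernel
  simp only [hs, sum_zmod_ten] at h
  generalize classCard 10 X = f at *
  generalize classCard 10 Y = g at *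
  unfold ClassCountsTen.reps
  rw [List.cons.injEq, List.cons.injEq, List.cons.injEq, List.cons.injEq, List.cons.injEq,
    List.cons.injEq]
  refine ⟨?_, ?_, ?_, ?_, ?_, ?_, rfl⟩
  · have e : f 0 * g 0 + f 1 * g 9 + f 2 * g 8 + f 3 * g 7 + f 4 * g 6 + f 5 * g 5 + f 6 * g 4 + f 7
        * g 3 + f 8 * g 2 + f 9 * g 1 = 16 := h 0
    rwa [x0, x1, x2, x3, x4, x5, x6, x7, x8, x9, y0, y1, y2, y3, y4, y5, y6, y7, y8, y9] at e
  · have e : f 0 * g 1 + f 1 * g 0 + f 2 * g 9 + f 3 * g 8 + f 4 * g 7 + f 5 * g 6 + f 6 * g 5 + f 7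
        * g 4 + f 8 * g 3 + f 9 * g 2 = 17 := h 1
    rwa [x0, x1, x2, x3, x4, x5, x6, x7, x8, x9, y0, y1, y2, y3, y4, y5, y6, y7, y8, y9] at e
  · have e : f 0 * g 2 + f 1 * g 1 + f 2 * g 0 + f 3 * g 9 + f 4 * g 8 + f 5 * g 7 + f 6 * g 6 + f 7
        * g 5 + f 8 * g 4 + f 9 * g 3 = 17 := h 2
    rwa [x0, x1, x2, x3, x4, x5, x6, x7, x8, x9, y0, y1, y2, y3, y4, y5, y6, y7, y8, y9] at e
  · have e : f 0 * g 3 + f 1 * g 2 + f 2 * g 1 + f 3 * g 0 + f 4 * g 9 + f 5 * g 8 + f 6 * g 7 + f 7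
        * g 6 + f 8 * g 5 + f 9 * g 4 = 17 := h 3
    rwa [x0, x1, x2, x3, x4, x5, x6, x7, x8, x9, y0, y1, y2, y3, y4, y5, y6, y7, y8, y9] at e
  · have e : f 0 * g 4 + f 1 * g 3 + f 2 * g 2 + f 3 * g 1 + f 4 * g 0 + f 5 * g 9 + f 6 * g 8 + f 7
        * g 7 + f 8 * g 6 + f 9 * g 5 = 17 := h 4
    rwa [x0, x1, x2, x3, x4, x5, x6, x7, x8, x9, y0, y1, y2, y3, y4, y5, y6, y7, y8, y9] at e
  · have e : f 0 * g 5 + f 1 * g 4 + f 2 * g 3 + f 3 * g 2 + f 4 * g 1 + f 5 * g 0 + f 6 * g 9 + f 7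
        * g 8 + f 8 * g 7 + f 9 * g 6 = 17 := h 5
    rwa [x0, x1, x2, x3, x4, x5, x6, x7, x8, x9, y0, y1, y2, y3, y4, y5, y6, y7, y8, y9] at e

theorem HasClassCountsTen.sum_eq {X : Finset (ZMod 170)} {x : ClassCountsTen}
    (h : HasClassCountsTen X x) (hneg : ∀ z ∈ X, -z ∈ X) :
    x.c0 + 2 * x.c1 + 2 * x.c2 + 2 * x.c3 + 2 * x.c4 + x.c5 = X.card := by
  have h9 : classCard 10 X 9 = classCard 10 X 1 := classCard_neg (by norm_num) hneg 1
  have h8 : classCard 10 X 8 = classCard 10 X 2 := classCard_neg (by norm_num) hneg 2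
  have h7 : classCard 10 X 7 = classCard 10 X 3 := classCard_neg (by norm_num) hneg 3
  have h6 : classCard 10 X 6 = classCard 10 X 4 := classCard_neg (by norm_num) hneg 4
  obtain ⟨x0, x1, x2, x3, x4, x5⟩ := h
  rw [← sum_classCard_eq (d := 10) X, sum_zmod_ten, h9, h8, h7, h6, x0, x1, x2, x3, x4, x5]
  ring

/-- The class counts with `7` elements in even classes and `6` elements in odd classes. -/
def countCandidates : List ClassCountsTen :=
  (List.range 4).flatMap fun c1 => (List.range (4 - c1)).flatMap fun c3 =>
    (List.range 4).flatMap fun c2 => (List.range (4 - c2)).map fun c4 =>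
      ⟨7 - 2 * c2 - 2 * c4, c1, c2, c3, c4, 6 - 2 * c1 - 2 * c3⟩

def ClassCountsTen.toList (x : ClassCountsTen) : List ℕ := [x.c0, x.c1, x.c2, x.c3, x.c4, x.c5]

/-- Class counts of the sets obtained by multiplication by 3. -/
def ClassCountsTen.triple (x : ClassCountsTen) : ClassCountsTen :=
  ⟨x.c0, x.c3, x.c4, x.c1, x.c2, x.c5⟩

/-- Class counts of the sets obtained by adding 5. -/
def ClassCountsTen.reverse (x : ClassCountsTen) : ClassCountsTen :=
  ⟨x.c5, x.c4, x.c3, x.c2, x.c1, x.c0⟩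

theorem ClassCountsTen.ext_toList {x y : ClassCountsTen} (h : x.toList = y.toList) : x = y := by
  cases x; cases y
  simpa [ClassCountsTen.toList] using h

theorem mem_countCandidates {x : ClassCountsTen} (he : x.c0 + 2 * x.c2 + 2 * x.c4 = 7)
    (ho : x.c5 + 2 * x.c1 + 2 * x.c3 = 6) : x ∈ countCandidates := by
  obtain ⟨c0, c1, c2, c3, c4, c5⟩ := x
  simp only at he ho
  simp only [countCandidates, List.mem_flatMap, List.mem_map, List.mem_range,
    ClassCountsTen.mk.injEq]
  exact ⟨c1, by omega, c3, by omega, c2, by omega, c4, by omega, by omega, rfl, rfl, rfl, rfl,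
    by omega⟩

/-- The possible class counts, up to multiplication by 3. -/
def classCountCases : List (ClassCountsTen × ClassCountsTen) :=
  [(⟨1, 1, 1, 1, 2, 2⟩, ⟨2, 1, 1, 2, 1, 1⟩), (⟨1, 1, 2, 2, 1, 0⟩, ⟨0, 2, 1, 1, 2, 1⟩),
    (⟨3, 1, 0, 2, 2, 0⟩, ⟨0, 0, 1, 2, 2, 3⟩)]

/-- The counts of the second factor are enumerated in reversed form, so that both factors run over
the same list. Comparing the first entry alone is a cheap filter. -/
theorem classCountCases_check : (countCandidates.all fun x => countCandidates.all fun y =>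
    !(Nat.beq ((x.reps y.reverse).getD 0 0) 16) || !(x.reps y.reverse == [16, 17, 17, 17, 17, 17]) ||
      classCountCases.any fun p =>
        (x.toList == p.1.toList && y.reverse.toList == p.2.toList) ||
        (x.triple.toList == p.1.toList && y.reverse.triple.toList == p.2.toList)) = true := by
  decide +kernel

/-- Projection to parity first shows that X has 7 even and 6 odd elements and Y has 6 and 7, which
leaves a short list of class counts to enumerate. -/
theorem mem_classCountCases {x y : ClassCountsTen} (h : x.reps y = [16, 17, 17, 17, 17, 17])
    (hx : x.c0 + 2 * x.c1 + 2 * x.c2 + 2 * x.c3 + 2 * x.c4 + x.c5 = 13)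
    (hy : y.c0 + 2 * y.c1 + 2 * y.c2 + 2 * y.c3 + 2 * y.c4 + y.c5 = 13)
    (hx5 : x.c5 % 2 = 0) (hy0 : y.c0 % 2 = 0) :
    (x, y) ∈ classCountCases ∨ (x.triple, y.triple) ∈ classCountCases := by
  have key : ∀ P Q R S : ℕ, P * R + Q * S = 84 → P + Q = 13 → R + S = 13 → P % 2 = 1 →
      R % 2 = 0 → P = 7 ∧ R = 6 := by
    intro P Q R S e h1 h2 h3 h4
    obtain rfl : Q = 13 - P := by omega
    obtain rfl : S = 13 - R := by omega
    have hP : P ≤ 13 := by omega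
    have hR : R ≤ 13 := by omega
    interval_cases P <;> interval_cases R <;> omega
  have hP : x.c0 + 2 * x.c2 + 2 * x.c4 = 7 ∧ y.c0 + 2 * y.c2 + 2 * y.c4 = 6 := by
    have h' := h
    simp only [ClassCountsTen.reps, List.cons.injEq, and_true] at h'
    obtain ⟨h0, -, h2, -, h4, -⟩ := h'
    obtain ⟨P, hP⟩ : ∃ P, x.c0 + 2 * x.c2 + 2 * x.c4 = P := ⟨_, rfl⟩
    obtain ⟨Q, hQ⟩ : ∃ Q, x.c5 + 2 * x.c1 + 2 * x.c3 = Q := ⟨_, rfl⟩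
    obtain ⟨R, hR⟩ : ∃ R, y.c0 + 2 * y.c2 + 2 * y.c4 = R := ⟨_, rfl⟩
    obtain ⟨S, hS⟩ : ∃ S, y.c5 + 2 * y.c1 + 2 * y.c3 = S := ⟨_, rfl⟩
    -- There are 84 nonzero even residues modulo 170; the equations for the classes 0, ±2, ±4 add up
    -- to this one.
    have e : P * R + Q * S = 84 := by
      rw [← hP, ← hQ, ← hR, ← hS]
      linear_combination h0 + 2 * h2 + 2 * h4
    rw [hP, hR]
    exact key P Q R S e (by omega) (by omega) (by omega) (by omega)
  have hx' : x ∈ countCandidates := mem_countCandidates hP.1 (by omega)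
  have hy' : y.reverse ∈ countCandidates :=
    mem_countCandidates (by simp only [ClassCountsTen.reverse]; omega)
      (by simp only [ClassCountsTen.reverse]; omega)
  have := List.all_eq_true.1 (List.all_eq_true.1 classCountCases_check x hx') _ hy'
  have e : y.reverse.reverse = y := rfl
  rw [e, h] at this
  simp only [List.getD_cons_zero, Nat.beq_refl, Bool.not_true, Bool.false_or, beq_self_eq_true,
    List.any_eq_true, Bool.or_eq_true, Bool.and_eq_true, beq_iff_eq] at this
  obtain ⟨p, hp, ⟨h1, h2⟩ | ⟨h1, h2⟩⟩ := this
  · left; rw [ClassCountsTen.ext_toList h1, ClassCountsTen.ext_toList h2]; exact hp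
  · right; rw [ClassCountsTen.ext_toList h1, ClassCountsTen.ext_toList h2]; exact hp

def ClassCountsTen.caps (x : ClassCountsTen) : List (List ℕ × ℕ) :=
  classCaps 170 10 [(0, x.c0), (1, 2 * x.c1), (2, 2 * x.c2), (3, 2 * x.c3), (4, 2 * x.c4), (5, x.c5)]

theorem HasClassCountsTen.caps {X : Finset (ZMod 170)} {x : ClassCountsTen}
    (h : HasClassCountsTen X x) (hneg : ∀ z ∈ X, -z ∈ X) :
    ∀ p ∈ x.caps, (X ∩ listSet 170 p.1).card = p.2 := by
  obtain ⟨x0, x1, x2, x3, x4, x5⟩ := h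
  refine classCaps_sound (by norm_num) hneg ?_
  intro p hp
  simp only [List.mem_cons, List.not_mem_nil, or_false] at hp
  rcases hp with rfl | rfl | rfl | rfl | rfl | rfl
  · simp [x0]
  · simp [x1]
  · simp [x2]
  · simp [x3]
  · simp [x4]
  · simp [x5]

theorem HasClassCountsTen.scale_one {X : Finset (ZMod 170)} {x : ClassCountsTen} {u : (ZMod 170)ˣ}
    (h : HasClassCountsTen X x) (hu : (u : ZMod 170).cast = (1 : ZMod 10)) :
    HasClassCountsTen (scale u X) x := by
  have key : ∀ r, classCard 10 (_root_.scale u X) (((u : ZMod 170).cast : ZMod 10) * r) =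
      classCard 10 X r := classCard_scale (by norm_num) u
  simp only [hu, one_mul] at key
  unfold HasClassCountsTen
  simp only [key]
  exact h

theorem HasClassCountsTen.scale_three {X : Finset (ZMod 170)} {x : ClassCountsTen} {u : (ZMod 170)ˣ}
    (h : HasClassCountsTen X x) (hneg : ∀ z ∈ X, -z ∈ X)
    (hu : (u : ZMod 170).cast = (3 : ZMod 10)) : HasClassCountsTen (scale u X) x.triple := by
  have key : ∀ r, classCard 10 (_root_.scale u X) (((u : ZMod 170).cast : ZMod 10) * r) =
      classCard 10 X r := classCard_scale (by norm_num) u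
  rw [hu] at key
  have key' : ∀ r s : ZMod 10, 3 * -r = s → classCard 10 (scale u X) s = classCard 10 X r := by
    rintro r _ rfl
    rw [key, classCard_neg (by norm_num) hneg]
  obtain ⟨x0, x1, x2, x3, x4, x5⟩ := h
  exact ⟨(key' 0 0 (by decide)).trans x0, (key' 3 1 (by decide)).trans x3,
    (key' (-4) 2 (by decide)).trans ((classCard_neg (by norm_num) hneg 4).trans x4),
    (key' (-1) 3 (by decide)).trans ((classCard_neg (by norm_num) hneg 1).trans x1),
    (key' 2 4 (by decide)).trans x2, (key' 5 5 (by decide)).trans x5⟩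

/-- Class counts, an element of the first factor, and an element to be represented first. -/
def searchesTen : List (ClassCountsTen × ClassCountsTen × ℕ × ℕ) :=
  [(⟨1, 1, 1, 1, 2, 2⟩, ⟨2, 1, 1, 2, 1, 1⟩, 1, 1), (⟨1, 1, 1, 1, 2, 2⟩, ⟨2, 1, 1, 2, 1, 1⟩, 51, 36),
    (⟨1, 1, 2, 2, 1, 0⟩, ⟨0, 2, 1, 1, 2, 1⟩, 1, 83), (⟨1, 1, 2, 2, 1, 0⟩, ⟨0, 2, 1, 1, 2, 1⟩, 51, 17),
    (⟨3, 1, 0, 2, 2, 0⟩, ⟨0, 0, 1, 2, 2, 3⟩, 1, 75), (⟨3, 1, 0, 2, 2, 0⟩, ⟨0, 0, 1, 2, 2, 3⟩, 51, 45)]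

set_option maxHeartbeats 0 in
theorem run_oneHundredSeventy : ∀ p ∈ searchesTen, ∀ j < 12,
    runEven 170 p.1.caps p.2.1.caps (symmetricLists 13) [0, p.2.2.1] [85] p.2.2.2 12 j = true := by
  simp only [searchesTen, List.forall_mem_cons]
  refine ⟨?_, ?_, ?_, ?_, ?_, ?_, List.forall_mem_nil _⟩
  all_goals intro j hj
  all_goals interval_cases j <;> decide +kernel

/-- In every case X has an element ≡ 1 modulo 10. A unit ≡ 1 modulo 10 takes it to 1 unless it is a
multiple of 17, and then it is 51. -/
theorem containsRow_of_classCountsTen {X Y : Finset (ZMod 170)} (hF : NearFactorization X Y)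
    (hX : X.card = 13) (hY : Y.card = 13)
    (h0 : 0 ∈ X ∧ ((85 : ℕ) : ZMod 170) ∈ Y ∧ ((85 : ℕ) : ZMod 170) ∉ X ∧ 0 ∉ Y)
    {x y : ClassCountsTen} (hx : HasClassCountsTen X x) (hy : HasClassCountsTen Y y)
    (hxy : (x, y) ∈ classCountCases) : ContainsRow X Y (symmetricLists 13) := by
  have run : ∀ X Y : Finset (ZMod 170), NearFactorization X Y → X.card = 13 → Y.card = 13 →
      0 ∈ X ∧ ((85 : ℕ) : ZMod 170) ∈ Y ∧ ((85 : ℕ) : ZMod 170) ∉ X ∧ 0 ∉ Y →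
      HasClassCountsTen X x → HasClassCountsTen Y y → ∀ i g : ℕ, (x, y, i, g) ∈ searchesTen →
      (i : ZMod 170) ∈ X → ContainsRow X Y (symmetricLists 13) := by
    intro X Y hF hX hY h0 hx hy i g hp h1
    have hg : ∀ p ∈ searchesTen, 0 < p.2.2.2 ∧ p.2.2.2 < 170 := by simp [searchesTen]
    have hc : ∀ j < 12, runEven 170 x.caps y.caps (symmetricLists 13) [0, i] [85] g 12 j = true :=
      run_oneHundredSeventy (x, y, i, g) hp
    exact hF.containsRow_of_runEven (lA := [i]) (lB := []) hX hY (by norm_num) (by norm_num) rfl h0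
      (hx.caps hF.neg_left) (hy.caps hF.neg_right) (by simpa using h1) (by simp)
      (hg (x, y, i, g) hp) (by norm_num) hc
  have hcov : ∀ q ∈ classCountCases, (∃ g, (q.1, q.2, 1, g) ∈ searchesTen) ∧
      ∃ g, (q.1, q.2, 51, g) ∈ searchesTen := by
    simp [classCountCases, searchesTen]
  obtain ⟨⟨g, hg⟩, g', hg'⟩ := hcov _ hxy
  obtain ⟨z, hz⟩ : (X.filter fun x => (x.cast : ZMod 10) = 1).Nonempty := by
    rw [← card_pos]
    have h1 : classCard 10 X 1 = x.c1 := hx.2.1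
    have hpos : ∀ p ∈ classCountCases, 0 < p.1.c1 := by simp [classCountCases]
    have := hpos _ hxy
    rw [← h1] at this
    exact this
  obtain ⟨hz, hz10⟩ := mem_filter.1 hz
  have key : ∀ x : ZMod 170, (x.cast : ZMod 10) = 1 → x = 51 ∨
      ∃ u < 170, Nat.gcd u 170 = 1 ∧ u % 10 = 1 ∧ (u : ZMod 170) * x = 1 := by
    decide +kernel
  rcases key z hz10 with rfl | ⟨u, -, hu, hu10, hux⟩
  · exact run X Y hF hX hY h0 hx hy _ _ hg' hz
  · obtain ⟨v, hv⟩ := exists_unit_of_coprime hu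
    have hv1 : ((v : ZMod 170).cast : ZMod 10) = 1 := by
      rw [hv, ZMod.cast_natCast (by norm_num), ← ZMod.natCast_mod, hu10]; rfl
    exact ContainsRow.of_scale (u := v) (run _ _ (hF.scale v) ((card_scale v X).trans hX)
      ((card_scale v Y).trans hY) (halves_scale (n := 170) (m := 85) rfl h0 v) (hx.scale_one hv1)
      (hy.scale_one hv1) _ _ hg (mem_scale_of_mul_eq hz (by rw [hv, hux]; simp)))

theorem classified_thirteen : Classified 170 13 (symmetricLists 13) := by
  refine Classified.of_even (m := 85) rfl rfl fun X Y hF hX hY h0 => ?_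
  -- Negation acts on the classes 0 and 5 modulo 10, with 0 and 85 as only possible fixed points. A
  -- class avoiding them has an even number of elements; this applies to 5 for X and to 0 for Y.
  have hpar : ∀ Z : Finset (ZMod 170), (∀ z ∈ Z, -z ∈ Z) → ∀ r : ZMod 10, r = -r →
      (0 ∈ Z → r ≠ 0) → (((85 : ℕ) : ZMod 170) ∈ Z → r ≠ 5) → classCard 10 Z r % 2 = 0 := by
    intro Z hZ r hr h0 h85
    rw [classCard, card_mod_two]
    · rw [filter_filter, filter_eq_empty_iff.2]
      · rfl
      · rintro z hz ⟨h1, h2⟩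
        rcases (eq_neg_iff (m := 85) rfl z).1 h2 with rfl | rfl
        · exact h0 hz h1.symm
        · exact h85 hz h1.symm
    · intro z hz
      obtain ⟨h1, h2⟩ := mem_filter.1 hz
      exact mem_filter.2 ⟨hZ z h1, by rw [ZMod.cast_neg (by norm_num), h2, ← hr]⟩
  have hc : ∀ Z : Finset (ZMod 170), HasClassCountsTen Z ⟨classCard 10 Z 0, classCard 10 Z 1,
      classCard 10 Z 2, classCard 10 Z 3, classCard 10 Z 4, classCard 10 Z 5⟩ := fun Z =>
    ⟨rfl, rfl, rfl, rfl, rfl, rfl⟩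
  rcases mem_classCountCases (reps_classCard hF (hc X) (hc Y))
    (((hc X).sum_eq hF.neg_left).trans hX) (((hc Y).sum_eq hF.neg_right).trans hY)
    (hpar X hF.neg_left 5 (by decide) (fun _ => by decide) (fun h => absurd h h0.2.2.1))
    (hpar Y hF.neg_right 0 (by decide) (fun h => absurd h h0.2.2.2) (fun _ => by decide)) with h | h
  · exact containsRow_of_classCountsTen hF hX hY h0 (hc X) (hc Y) h
  · obtain ⟨v, hv⟩ := exists_unit_of_coprime (show Nat.gcd 3 170 = 1 by norm_num)
    have hv3 : ((v : ZMod 170).cast : ZMod 10) = 3 := by rw [hv]; rfl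
    refine ContainsRow.of_scale (u := v) (containsRow_of_classCountsTen (hF.scale v)
      ((card_scale v X).trans hX) ((card_scale v Y).trans hY) (halves_scale rfl h0 v)
      ((hc X).scale_three hF.neg_left hv3) ((hc Y).scale_three hF.neg_right hv3) h)

/-! ### Order 197 -/

theorem halfTable_oneHundredNinetySeven : HalfTable 197 (halfTable 197 419) 419 := by
  unfold HalfTable; decide +kernel

set_option maxHeartbeats 0 in
-- The case t = ±3 below: t is the element 3 of Y already known, so only 9 = 3t in X is new
-- information and the search is longer.
theorem run_nine : ∀ j < 16,
    runOdd 197 419 (fullCap 197 14) (fullCap 197 14) (symmetricLists 14) [1, 9] [3] 18 16 j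
      = true := by
  intro j hj
  interval_cases j <;> decide +kernel

/-- Representatives of the classes `{± t, ± 1 / t}`, with an element to be represented first. -/
def searchesFourteen : List (ℕ × ℕ) :=
  [(2, 10), (4, 6), (5, 7), (6, 6), (7, 42), (8, 6), (9, 6), (10, 60), (11, 66), (12, 72),
    (13, 6), (14, 84), (15, 6), (16, 96), (17, 95), (19, 83), (20, 6), (21, 71), (23, 6), (24,
    53), (25, 47), (26, 41), (27, 35), (29, 23), (30, 6), (31, 11), (32, 5), (35, 13), (36,
    19), (38, 6), (39, 6), (40, 5), (42, 6), (43, 6), (44, 67), (47, 6), (48, 6), (50, 94),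
    (51, 6), (52, 6), (54, 6), (56, 58), (65, 6), (68, 5), (70, 6), (71, 32), (77, 68), (81,
    6)]

set_option maxHeartbeats 0 in
theorem run_oneHundredNinetySeven : ∀ p ∈ searchesFourteen, ∀ j < 1,
    runOdd 197 419 (fullCap 197 14) (fullCap 197 14) (symmetricLists 14) [1, 3 * p.1] [3, p.1] p.2 1 j
      = true := by
  simp only [searchesFourteen, List.forall_mem_cons]
  repeat' apply And.intro
  on_goal 49 => exact List.forall_mem_nil _
  all_goals intro j hj
  all_goals interval_cases j; decide +kernel

/-- Besides 0, ±1 and the class of 3, the list has one t for each class under sign and inversion. -/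
theorem searchesFourteen_cover (t : ZMod 197) (h0 : t ≠ 0) (h1 : t ≠ 1) (h2 : t ≠ -1) :
    t = 3 ∨ t = -3 ∨ 3 * t = 1 ∨ 3 * t = -1 ∨ ∃ p ∈ searchesFourteen, t = p.1 ∨ t = -(p.1 : ZMod 197) ∨
      p.1 * t = 1 ∨ p.1 * t = -1 := by
  revert t
  decide +kernel

theorem containsRow_of_nine {X Y : Finset (ZMod 197)} (hF : NearFactorization X Y)
    (hX : X.card = 14) (hY : Y.card = 14) (h1 : 1 ∈ X) (h9 : 9 ∈ X) (h3 : 3 ∈ Y) :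
    ContainsRow X Y (symmetricLists 14) := by
  refine hF.containsRow_of_runOdd (lA := [1, 9]) (lB := [3]) hX hY rfl (by norm_num) (by norm_num)
    rfl halfTable_oneHundredNinetySeven (fullCap_sound hX) (fullCap_sound hY) ?_ (by simpa using h3)
    (by norm_num) (by norm_num) run_nine
  simpa using ⟨h1, h9⟩

theorem containsRow_of_searches {X Y : Finset (ZMod 197)} (hF : NearFactorization X Y)
    (hX : X.card = 14) (hY : Y.card = 14) {p : ℕ × ℕ} (hp : p ∈ searchesFourteen) (h1 : 1 ∈ X)
    (h3 : 3 ∈ Y) (ht : (p.1 : ZMod 197) ∈ Y) (h3t : 3 * (p.1 : ZMod 197) ∈ X) :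
    ContainsRow X Y (symmetricLists 14) := by
  have hg : ∀ p ∈ searchesFourteen, 0 < p.2 ∧ p.2 < 197 := by decide
  refine hF.containsRow_of_runOdd (lA := [1, 3 * p.1]) (lB := [3, p.1]) hX hY rfl (by norm_num)
    (by norm_num) rfl halfTable_oneHundredNinetySeven (fullCap_sound hX) (fullCap_sound hY) ?_ ?_
    (hg p hp) one_pos (run_oneHundredNinetySeven p hp)
  · simpa using ⟨h1, h3t⟩
  · simpa using ⟨h3, ht⟩

/-- As 14 ≡ 2 modulo 3 for both factors, scaling gives 1 in X and 3 in Y, and there is also t in Y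
with 3t in X. Interchanging the factors and dividing by t puts the inverse of t in the place of t,
so t matters only up to sign and inversion. -/
theorem classified_fourteen : Classified 197 14 (symmetricLists 14) := by
  intro X Y hF hX hY
  have hp : Nat.Prime 197 := by norm_num
  have huniq : ∀ x : ZMod 197, x ≠ 0 → ∃ u : (ZMod 197)ˣ, (u : ZMod 197) = x := by
    intro x hx
    have : Fact (Nat.Prime 197) := ⟨hp⟩
    exact ⟨Units.mk0 x hx, rfl⟩
  obtain ⟨x, hx, hx3⟩ := hF.exists_three_mul (by omega)
  have hx0 : x ≠ 0 := by rintro rfl; exact hF.zero_not_mem rfl (by omega) hx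
  obtain ⟨u, rfl⟩ := huniq x hx0
  refine ContainsRow.of_scale (u := u⁻¹) ?_
  have h1 : 1 ∈ scale u⁻¹ X := mem_scale_of_mul_eq hx (Units.inv_mul u)
  have h3 : 3 ∈ scale u⁻¹ Y := mem_scale_of_mul_eq hx3 (by
    linear_combination (3 : ZMod 197) * Units.inv_mul u)
  replace hX := (card_scale u⁻¹ X).trans hX
  replace hY := (card_scale u⁻¹ Y).trans hY
  replace hF := hF.scale u⁻¹
  generalize scale u⁻¹ X = X at *
  generalize scale u⁻¹ Y = Y at *
  clear hx hx3
  obtain ⟨t, ht, h3t⟩ := hF.symm.exists_three_mul (by omega)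
  have ht0 : t ≠ 0 := by rintro rfl; exact hF.symm.zero_not_mem rfl (by omega) ht
  have ht1 : t ≠ 1 := by
    rintro rfl; exact hF.add_ne_zero _ h1 _ (hF.neg_right _ ht) (by simp)
  have ht2 : t ≠ -1 := by
    rintro rfl; exact hF.add_ne_zero _ h1 _ ht (by simp)
  -- Multiplication by 3 = 1/s and interchange of the factors turn s, 1 and 3 into 1, 3 and 9.
  have third : ∀ s ∈ Y, 3 * s = 1 → ContainsRow X Y (symmetricLists 14) := by
    intro s hs e
    obtain ⟨v, hv⟩ := huniq 3 (by decide)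
    refine (ContainsRow.of_scale (u := v) ?_).symm
    exact containsRow_of_nine (hF.symm.scale v) ((card_scale v Y).trans hY)
      ((card_scale v X).trans hX) (mem_scale_of_mul_eq hs (by rw [hv, e]))
      (mem_scale_of_mul_eq h3 (by rw [hv]; norm_num)) (mem_scale_of_mul_eq h1 (by rw [hv, mul_one]))
  have inverse : ∀ s ∈ Y, 3 * s ∈ X → ∀ p ∈ searchesFourteen, p.1 * s = 1 →
      ContainsRow X Y (symmetricLists 14) := by
    intro s hs h3s p hp e
    obtain ⟨v, hv⟩ := huniq p.1 (by rintro h; rw [h, zero_mul] at e; exact absurd e (by decide))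
    refine (ContainsRow.of_scale (u := v) ?_).symm
    exact containsRow_of_searches (hF.symm.scale v) ((card_scale v Y).trans hY)
      ((card_scale v X).trans hX) hp (mem_scale_of_mul_eq hs (by rw [hv, e]))
      (mem_scale_of_mul_eq h3s (by rw [hv]; linear_combination 3 * e))
      (mem_scale_of_mul_eq h1 (by rw [hv, mul_one]))
      (mem_scale_of_mul_eq h3 (by rw [hv, mul_comm]))
  rcases searchesFourteen_cover t ht0 ht1 ht2 with rfl | rfl | h | h | ⟨p, hp, rfl | rfl | h | h⟩
  · exact containsRow_of_nine hF hX hY h1 (by rwa [show (3 : ZMod 197) * 3 = 9 by norm_num] at h3t) h3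
  · refine containsRow_of_nine hF hX hY h1 ?_ h3
    have := hF.neg_left _ h3t
    rwa [show -((3 : ZMod 197) * -3) = 9 by norm_num] at this
  · exact third t ht h
  · exact third (-t) (hF.neg_right _ ht) (by rw [mul_neg, h, neg_neg])
  · exact containsRow_of_searches hF hX hY hp h1 h3 ht h3t
  · refine containsRow_of_searches hF hX hY hp h1 h3 ?_ ?_
    · simpa using hF.neg_right _ ht
    · simpa using hF.neg_left _ h3t
  · exact inverse t ht h3t p hp h
  · exact inverse (-t) (hF.neg_right _ ht) (by rw [mul_neg]; exact hF.neg_left _ h3t) p hp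
      (by rw [mul_neg, h, neg_neg])

/-! ### Lexicographic comparison -/

/-- A number that decreases when a set of residues increases lexicographically. -/
def listKey (n : ℕ) (l : List ℕ) : ℕ := (l.map fun x => 2 ^ (n - 1 - x)).sum

theorem listKey_lt {n : ℕ} : ∀ {l : List ℕ} {b : ℕ}, l.Pairwise (· < ·) → (∀ x ∈ l, b ≤ x ∧ x < n) →
    listKey n l < 2 ^ (n - b)
  | [], b, _, _ => by simp [listKey]
  | c :: l, b, hl, hb => by
    have hc := hb c (by simp)
    have ih := listKey_lt (l := l) (b := c + 1) (List.pairwise_cons.1 hl).2 fun x hx =>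
      ⟨(List.pairwise_cons.1 hl).1 x hx, (hb x (by simp [hx])).2⟩
    have e : n - c = (n - 1 - c) + 1 := by omega
    have e' : n - (c + 1) = n - 1 - c := by omega
    have h1 : 2 ^ (n - c) ≤ 2 ^ (n - b) := Nat.pow_le_pow_right two_pos (by omega)
    rw [e, pow_succ] at h1
    rw [e'] at ih
    have h2 : listKey n (c :: l) = 2 ^ (n - 1 - c) + listKey n l := by simp [listKey]
    omega

/-- The key is the indicator function read as a binary number with the residue 0 as leading digit.
At the first difference, the smaller residue contributes a power of 2 exceeding everything that the
other list can still contribute. -/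
theorem listKey_lt_of_lt {n : ℕ} : ∀ {l m : List ℕ}, l.Pairwise (· < ·) → m.Pairwise (· < ·) →
    (∀ x ∈ l, x < n) → (∀ x ∈ m, x < n) → l.length = m.length → l < m → listKey n m < listKey n l
  | [], m, _, _, _, _, hlen, h => by
    have : m = [] := List.length_eq_zero_iff.1 hlen.symm
    subst this
    exact absurd h (List.lt_irrefl _)
  | a :: l, [], _, _, _, _, hlen, h => by simp at hlen
  | a :: l, b :: m, hl, hm, hln, hmn, hlen, h => by
    have h2 : ∀ c k, listKey n (c :: k) = 2 ^ (n - 1 - c) + listKey n k := by simp [listKey]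
    rcases List.cons_lt_cons_iff.1 h with h' | ⟨rfl, h'⟩
    · have h1 := listKey_lt (b := b) hm fun x hx => ⟨by
        rcases List.mem_cons.1 hx with rfl | hx
        · exact le_rfl
        · exact ((List.pairwise_cons.1 hm).1 x hx).le, hmn x hx⟩
      have hb := hmn b (by simp)
      have h3 : 2 ^ (n - b) ≤ 2 ^ (n - 1 - a) := Nat.pow_le_pow_right two_pos (by omega)
      rw [h2 a]; omega
    · rw [h2, h2]
      have := listKey_lt_of_lt (List.pairwise_cons.1 hl).2 (List.pairwise_cons.1 hm).2
        (fun x hx => hln x (by simp [hx])) (fun x hx => hmn x (by simp [hx])) (by simpa using hlen) h'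
      omega

section
variable {n : ℕ} [NeZero n]

/-- The key of the residue list of a set. -/
def setKey (S : Finset (ZMod n)) : ℕ := ∑ x ∈ S, 2 ^ (n - 1 - x.val)

theorem listKey_residueList (S : Finset (ZMod n)) : listKey n (residueList S) = setKey S := by
  rw [listKey, residueList, setKey, ← Multiset.sum_coe, ← Multiset.map_coe, Finset.sort_eq,
    image_val_of_injOn (ZMod.val_injective n).injOn, Multiset.map_map]
  rfl

theorem residueList_le {S T : Finset (ZMod n)} (hc : S.card = T.card) (h : setKey T ≤ setKey S) :
    residueList S ≤ residueList T := by
  refine not_lt.1 fun hlt => ?_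
  have hlen : ∀ S : Finset (ZMod n), (residueList S).length = S.card := fun S => by
    rw [residueList, Finset.length_sort, card_image_of_injective _ (ZMod.val_injective n)]
  have hb : ∀ S : Finset (ZMod n), ∀ x ∈ residueList S, x < n := fun S x hx => by
    rw [residueList, Finset.mem_sort, mem_image] at hx
    obtain ⟨y, -, rfl⟩ := hx
    exact ZMod.val_lt y
  have hs : ∀ S : Finset (ZMod n), (residueList S).Pairwise (· < ·) := fun S =>
    (Finset.sortedLT_sort _).pairwise
  have := listKey_lt_of_lt (hs T) (hs S) (hb T) (hb S) (by rw [hlen, hlen, hc]) hlt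
  rw [listKey_residueList, listKey_residueList] at this
  omega

theorem setKey_image {α β : ZMod n} (hα : IsUnit α) {S : Finset (ZMod n)} :
    setKey (affineImage α β S) = ∑ x ∈ S, 2 ^ (n - 1 - (α * x + β).val) := by
  rw [setKey, affineImage, sum_image]
  intro x _ y _ e
  exact hα.mul_right_injective (add_right_cancel e)

theorem card_affineImage {α β : ZMod n} (hα : IsUnit α) (S : Finset (ZMod n)) :
    (affineImage α β S).card = S.card := by
  refine card_image_of_injective _ fun x y e => ?_
  exact hα.mul_right_injective (add_right_cancel e)

/-- Canonical pairs that are affine-equivalent have the same first set. -/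
theorem IsCanonical.eq_of_affineEquivalent {C D : Fin 2 → Finset (ZMod n)} (hC : IsCanonical C)
    (hD : IsCanonical D) (h : AffineEquivalent C D) : C 0 = D 0 := by
  have key : ∀ {C D : Fin 2 → Finset (ZMod n)}, IsCanonical C → AffineEquivalent C D →
      residueList (C 0) ≤ residueList (D 0) := by
    rintro C D hC ⟨α, β, h | h⟩
    · rw [h]; exact hC 0 α β
    · rw [h]; exact hC (1 - 0) α β
  have e := le_antisymm (key hC h) (key hD h.symm)
  have := congrArg List.toFinset e
  rw [residueList, residueList, Finset.sort_toFinset, Finset.sort_toFinset] at this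
  exact image_injective (ZMod.val_injective n) this

end

/-! ### Strong external difference families from coverings -/

section
variable {n a : ℕ} [NeZero n]

/-- There are a² pairs and a² nonzero residues, so a covering is a bijection; then 0 is not a
difference and the sets are disjoint. -/
theorem differences_of_cover {P Q : Finset (ZMod n)} (hn : n = a ^ 2 + 1) (hP : P.card = a)
    (hQ : Q.card = a) (h : ∀ g : ZMod n, g ≠ 0 → ∃ x ∈ P, ∃ y ∈ Q, x - y = g) :
    differences P Q = (univ.erase (0 : ZMod n)).val ∧ Disjoint P Q := by
  have hcp : (P ×ˢ Q).card = n - 1 := by rw [card_product, hP, hQ, hn]; simp [pow_two]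
  have hce : (univ.erase (0 : ZMod n)).card = n - 1 := by
    rw [card_erase_of_mem (mem_univ _), card_univ, ZMod.card]
  have hsub : univ.erase (0 : ZMod n) ⊆ (P ×ˢ Q).image fun p => p.1 - p.2 := by
    intro g hg
    obtain ⟨x, hx, y, hy, e⟩ := h g (ne_of_mem_erase hg)
    exact mem_image.2 ⟨(x, y), mem_product.2 ⟨hx, hy⟩, e⟩
  have heq := eq_of_subset_of_card_le hsub (card_image_le.trans (by rw [hcp, hce]))
  have hinj : Set.InjOn (fun p : ZMod n × ZMod n => p.1 - p.2) (P ×ˢ Q : Finset _) := by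
    rw [← card_image_iff, ← heq, hcp, hce]
  refine ⟨?_, ?_⟩
  · rw [differences, heq, image_val_of_injOn hinj]
  · rw [disjoint_left]
    intro x hx hy
    have : (0 : ZMod n) ∈ univ.erase (0 : ZMod n) := by
      rw [heq]; exact mem_image.2 ⟨(x, x), mem_product.2 ⟨hx, hy⟩, sub_self x⟩
    exact ne_of_mem_erase this rfl

theorem IsSEDF.of_cover {A : Fin 2 → Finset (ZMod n)} (hn : n = a ^ 2 + 1)
    (hc : ∀ i, (A i).card = a) (h : ∀ g : ZMod n, g ≠ 0 → ∃ x ∈ A 0, ∃ y ∈ A 1, x - y = g) :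
    IsSEDF n 2 a 1 A := by
  obtain ⟨h0, hd⟩ := differences_of_cover hn (hc 0) (hc 1) h
  obtain ⟨h1, -⟩ := differences_of_cover hn (hc 1) (hc 0) fun g hg => by
    obtain ⟨x, hx, y, hy, e⟩ := h (-g) (neg_ne_zero.2 hg)
    exact ⟨y, hy, x, hx, by rw [← neg_sub, e, neg_neg]⟩
  refine ⟨ZMod.card n, le_rfl, hc, ?_, ?_⟩
  · intro i j hij
    fin_cases i <;> fin_cases j
    · exact absurd rfl hij
    · exact hd
    · exact hd.symm
    · exact absurd rfl hij
  · intro i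
    rw [one_smul]
    fin_cases i
    · rw [← h0]; exact sum_singleton _ (1 : Fin 2)
    · rw [← h1]; exact sum_singleton _ (0 : Fin 2)

theorem IsSEDF.of_affineImage {A B : Fin 2 → Finset (ZMod n)} (hn : n = a ^ 2 + 1)
    {α β : ZMod n} (hα : IsUnit α) (hB : ∀ i, affineImage α β (A i) = B i)
    (h : IsSEDF n 2 a 1 B) : IsSEDF n 2 a 1 A := by
  refine IsSEDF.of_cover hn (fun i => ?_) fun g hg => ?_
  · rw [← card_affineImage hα (β := β), hB, h.card_eq]
  · obtain ⟨x, hx, y, hy, e⟩ := h.exists_sub 0 (g := α * g) fun h0 => hg (hα.mul_right_eq_zero.1 h0)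
    rw [← hB] at hx hy
    obtain ⟨x', hx', rfl⟩ := mem_image.1 hx
    obtain ⟨y', hy', rfl⟩ := mem_image.1 hy
    exact ⟨x', hx', y', hy', hα.mul_right_injective (by simp only; linear_combination e)⟩

end

/-! ### α-valuations -/

/-- The sets of labels of an α-valuation of a complete bipartite graph, explicitly. -/
def AlphaCheck (a : ℕ) (p : Finset ℕ × Finset ℕ) : Prop :=
  p.1.card = a ∧ p.2.card = a ∧ (∀ l ∈ p.2, p.1.sup id < l ∧ l ≤ a * a) ∧
    ∀ d < a * a, ∃ s ∈ p.1, s + (d + 1) ∈ p.2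

instance (a : ℕ) (p : Finset ℕ × Finset ℕ) : Decidable (AlphaCheck a p) := by
  unfold AlphaCheck; infer_instance

theorem ncard_edgeSet_completeBipartiteGraph (a b : ℕ) :
    (completeBipartiteGraph (Fin a) (Fin b)).edgeSet.ncard = a * b := by
  have e : (completeBipartiteGraph (Fin a) (Fin b)).edgeSet =
      Set.range fun p : Fin a × Fin b => s(Sum.inl p.1, Sum.inr p.2) := by
    ext x
    induction x using Sym2.ind with
    | _ u v =>
      rw [SimpleGraph.mem_edgeSet, Set.mem_range]
      rcases u with u | u <;> rcases v with v | v <;> simp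
  rw [e, Set.ncard_range_of_injective]
  · simp
  · rintro ⟨u, v⟩ ⟨u', v'⟩ h
    simpa using h

/-- The labelling enumerates the two sets in increasing order, and the maximum of the small labels
is the separating value. -/
theorem AlphaCheck.isAlphaPair {a : ℕ} (ha : 0 < a) {p : Finset ℕ × Finset ℕ} (h : AlphaCheck a p) :
    IsAlphaPair a a p := by
  obtain ⟨S, L⟩ := p
  obtain ⟨hS, hL, hl, hd⟩ := h
  simp only at hS hL hl hd
  set x := S.sup id
  have hs : ∀ s ∈ S, s ≤ x := fun s hs => le_sup (f := id) hs
  obtain ⟨l0, hl0⟩ := card_pos.1 (hL ▸ ha)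
  have hx : x ≤ a * a := ((hl l0 hl0).1.trans_le (hl l0 hl0).2).le
  let f : Fin a ⊕ Fin a → ℕ := Sum.elim (S.orderEmbOfFin hS) (L.orderEmbOfFin hL)
  have hf1 : ∀ i, S.orderEmbOfFin hS i ∈ S := S.orderEmbOfFin_mem hS
  have hf2 : ∀ i, L.orderEmbOfFin hL i ∈ L := L.orderEmbOfFin_mem hL
  have hS' : ∀ s ∈ S, ∃ i, S.orderEmbOfFin hS i = s := fun s hs => by
    have := S.range_orderEmbOfFin hS
    have h : s ∈ (S : Set ℕ) := hs
    rw [← this] at h; exact h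
  have hL' : ∀ s ∈ L, ∃ i, L.orderEmbOfFin hL i = s := fun s hs => by
    have := L.range_orderEmbOfFin hL
    have h : s ∈ (L : Set ℕ) := hs
    rw [← this] at h; exact h
  refine ⟨f, x, ⟨⟨?_, ?_, ?_⟩, ?_, ?_⟩, ?_, ?_⟩
  · rintro (i | i) (j | j) e
    · exact congrArg _ ((S.orderEmbOfFin hS).injective e)
    · have e : S.orderEmbOfFin hS i = L.orderEmbOfFin hL j := e
      have := hs _ (hf1 i); have := (hl _ (hf2 j)).1; omega
    · have e : L.orderEmbOfFin hL i = S.orderEmbOfFin hS j := e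
      have := hs _ (hf1 j); have := (hl _ (hf2 i)).1; omega
    · exact congrArg _ ((L.orderEmbOfFin hL).injective e)
  · rw [ncard_edgeSet_completeBipartiteGraph]
    rintro (i | i)
    · exact (hs _ (hf1 i)).trans hx
    · exact (hl _ (hf2 i)).2
  · rw [ncard_edgeSet_completeBipartiteGraph]
    ext d
    have key : ∀ i j, ((S.orderEmbOfFin hS i : ℤ) - L.orderEmbOfFin hL j).natAbs ∈
        Set.Icc 1 (a * a) := fun i j => by
      have h1 := hs _ (hf1 i); have h2 := hl _ (hf2 j)
      rw [Set.mem_Icc]; omega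
    constructor
    · rintro ⟨u | u, v | v, hadj, rfl⟩
      · simp at hadj
      · exact key u v
      · have := key v u
        rwa [← Int.natAbs_neg, neg_sub] at this
      · simp at hadj
    · rintro ⟨h1, h2⟩
      obtain ⟨s, hs, hsd⟩ := hd (d - 1) (by omega)
      obtain ⟨i, hi⟩ := hS' s hs
      obtain ⟨j, hj⟩ := hL' _ hsd
      refine ⟨Sum.inl i, Sum.inr j, by simp, ?_⟩
      show d = ((S.orderEmbOfFin hS i : ℤ) - L.orderEmbOfFin hL j).natAbs
      rw [hi, hj]; push_cast; omega
  · rw [ncard_edgeSet_completeBipartiteGraph]; exact hx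
  · rintro (i | i) (j | j) hadj
    · simp at hadj
    · exact Or.inl ⟨hs _ (hf1 i), (hl _ (hf2 j)).1⟩
    · exact Or.inr ⟨hs _ (hf1 j), (hl _ (hf2 i)).1⟩
    · simp at hadj
  · ext k
    constructor
    · intro hk
      obtain ⟨i, hi⟩ := hS' k hk
      exact ⟨⟨Sum.inl i, hi⟩, hs k hk⟩
    · rintro ⟨⟨i | i, rfl⟩, hk⟩
      · exact hf1 i
      · have := (hl _ (hf2 i)).1
        have hk : L.orderEmbOfFin hL i ≤ x := hk
        omega
  · ext k
    constructor
    · intro hk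
      obtain ⟨i, hi⟩ := hL' k hk
      exact ⟨⟨Sum.inr i, hi⟩, (hl k hk).1⟩
    · rintro ⟨⟨i | i, rfl⟩, hk⟩
      · have := hs _ (hf1 i)
        have hk : x < S.orderEmbOfFin hS i := hk
        omega
      · exact hf2 i

/-! ### Verification of the rows of the table -/

/-- The residues of the image of a union of sets `P_i` under an affine map. -/
def symmetricImage (n w s : ℕ) (l : List ℕ) : Finset ℕ :=
  l.toFinset.biUnion fun i => {(w * i + s) % n, (w * (n - i % n) + s) % n}

/-- The images of `l` with `0` as the image of an element are not lexicographically smaller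
than `m`. -/
def LeastAmongImages (n : ℕ) (m l : List ℕ) : Prop :=
  ∀ u < n, Nat.gcd u n = 1 → ∀ x ∈ l,
    listKey n (l.map fun c => u * (c + (n - x)) % n) ≤ listKey n m

instance (n : ℕ) (m l : List ℕ) : Decidable (LeastAmongImages n m l) := by
  unfold LeastAmongImages; infer_instance

/-- The result of the blowup sequence is the canonical representation, or its image under
`X ↦ w X + s` with the sets interchanged. -/
def BlowupCheck (a w s : ℕ) (r : TableRow) : Prop :=
  blowupResult r.blowups = r.canonicalSets ∨
    (AlphaCheck a (blowupResult r.blowups) ∧ Nat.gcd w (a ^ 2 + 1) = 1 ∧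
      r.canonicalSets.2.image (fun c => (w * c + s) % (a ^ 2 + 1)) =
        (blowupResult r.blowups).1.image (· % (a ^ 2 + 1)) ∧
      r.canonicalSets.1.image (fun c => (w * c + s) % (a ^ 2 + 1)) =
        (blowupResult r.blowups).2.image (· % (a ^ 2 + 1)))

instance (a w s : ℕ) (r : TableRow) : Decidable (BlowupCheck a w s r) := by
  unfold BlowupCheck; infer_instance

structure RowCheck (a w s : ℕ) (r : TableRow) : Prop where
  scale : Nat.gcd r.scale (a ^ 2 + 1) = 1
  alpha : AlphaCheck a r.canonicalSets
  first : symmetricImage (a ^ 2 + 1) r.scale r.shift r.symFirst = r.canonFirst.toFinset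
  second : symmetricImage (a ^ 2 + 1) r.scale r.shift r.symSecond = r.canonSecond.toFinset
  zero : 0 ∈ r.canonFirst
  nodup_first : r.canonFirst.Nodup
  nodup_second : r.canonSecond.Nodup
  least_first : LeastAmongImages (a ^ 2 + 1) r.canonFirst r.canonFirst
  least_second : LeastAmongImages (a ^ 2 + 1) r.canonFirst r.canonSecond
  blowups : ∀ l ∈ r.blowups, 1 < l
  blowup : BlowupCheck a w s r

instance (a w s : ℕ) (r : TableRow) : Decidable (RowCheck a w s r) :=
  decidable_of_iff (Nat.gcd r.scale (a ^ 2 + 1) = 1 ∧ AlphaCheck a r.canonicalSets ∧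
    symmetricImage (a ^ 2 + 1) r.scale r.shift r.symFirst = r.canonFirst.toFinset ∧
    symmetricImage (a ^ 2 + 1) r.scale r.shift r.symSecond = r.canonSecond.toFinset ∧
    0 ∈ r.canonFirst ∧ r.canonFirst.Nodup ∧ r.canonSecond.Nodup ∧
    LeastAmongImages (a ^ 2 + 1) r.canonFirst r.canonFirst ∧
    LeastAmongImages (a ^ 2 + 1) r.canonFirst r.canonSecond ∧ (∀ l ∈ r.blowups, 1 < l) ∧
    BlowupCheck a w s r)
    ⟨fun ⟨h1, h2, h3, h4, h5, h6, h7, h8, h9, h10, h11⟩ =>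
      ⟨h1, h2, h3, h4, h5, h6, h7, h8, h9, h10, h11⟩,
    fun ⟨h1, h2, h3, h4, h5, h6, h7, h8, h9, h10, h11⟩ =>
      ⟨h1, h2, h3, h4, h5, h6, h7, h8, h9, h10, h11⟩⟩

section
variable {n : ℕ} [NeZero n]

theorem image_symmetricImage (w s : ℕ) (l : List ℕ) :
    (symmetricImage n w s l).image (Nat.cast : ℕ → ZMod n) =
      affineImage (w : ZMod n) s (l.toFinset.biUnion (orbitP n)) := by
  rw [symmetricImage, affineImage, biUnion_image, biUnion_image]
  refine biUnion_congr rfl fun i _ => ?_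
  have key : ((n - i % n : ℕ) : ZMod n) = -(i : ZMod n) := by
    rw [Nat.cast_sub (Nat.mod_lt _ (NeZero.pos n)).le]; simp
  simp only [orbitP, image_insert, image_singleton, ZMod.natCast_mod, Nat.cast_add, Nat.cast_mul, key]

theorem image_mod_eq {S T : Finset ℕ} {w s : ℕ}
    (h : S.image (fun c => (w * c + s) % n) = T.image (· % n)) :
    T.image (Nat.cast : ℕ → ZMod n) =
      affineImage (w : ZMod n) s (S.image (Nat.cast : ℕ → ZMod n)) := by
  have := congrArg (Finset.image (Nat.cast : ℕ → ZMod n)) h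
  rw [image_image, image_image] at this
  rw [affineImage, image_image]
  convert this.symm using 1
  · exact image_congr fun x _ => by simp
  · exact image_congr fun x _ => by simp

theorem sum_image_natCast {l : List ℕ} (hl : l.Nodup) (hn : ∀ c ∈ l, c < n) (f : ZMod n → ℕ) :
    ∑ x ∈ l.toFinset.image (Nat.cast : ℕ → ZMod n), f x = (l.map fun c : ℕ => f (c : ZMod n)).sum := by
  rw [sum_image, List.sum_toFinset _ hl]
  intro x hx y hy e
  have hx := hn x (List.mem_toFinset.1 hx)
  have hy := hn y (List.mem_toFinset.1 hy)
  rw [← ZMod.val_natCast_of_lt hx, ← ZMod.val_natCast_of_lt hy]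
  exact congrArg _ e

/-- A check of the images with an element `0` suffices for being lexicographically least. -/
theorem LeastAmongImages.residueList_le {l m : List ℕ} (h : LeastAmongImages n m l) (hl : l.Nodup)
    (hm : m.Nodup) (hln : ∀ c ∈ l, c < n) (hmn : ∀ c ∈ m, c < n) (h0 : 0 ∈ m)
    (hlen : l.length = m.length) (α : (ZMod n)ˣ) (β : ZMod n) :
    residueList (m.toFinset.image (Nat.cast : ℕ → ZMod n)) ≤
      residueList (affineImage (α : ZMod n) β (l.toFinset.image (Nat.cast : ℕ → ZMod n))) := by
  have hcard : ∀ l : List ℕ, l.Nodup → (∀ c ∈ l, c < n) →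
      (l.toFinset.image (Nat.cast : ℕ → ZMod n)).card = l.length := by
    intro l hl hn
    rw [card_eq_sum_ones, sum_image_natCast hl hn]
    simp
  have hkm : setKey (m.toFinset.image (Nat.cast : ℕ → ZMod n)) = listKey n m := by
    rw [setKey, sum_image_natCast hm hmn, listKey]
    refine congrArg _ (List.map_congr_left fun c hc => ?_)
    rw [ZMod.val_natCast_of_lt (hmn c hc)]
  refine _root_.residueList_le ?_ ?_
  · rw [card_affineImage α.isUnit, hcard m hm hmn, hcard l hl hln, hlen]
  rw [hkm]
  -- If x is the element mapped to 0, the image is given by c ↦ α(c - x), one of the tested maps. An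
  -- image without 0 has a key below 2^(n-1), which is at most the key of a list containing 0.
  by_cases hz : (0 : ZMod n) ∈
      affineImage (α : ZMod n) β (l.toFinset.image (Nat.cast : ℕ → ZMod n))
  · obtain ⟨y, hy, e⟩ := mem_image.1 hz
    obtain ⟨x, hx, rfl⟩ := mem_image.1 hy
    have hx := List.mem_toFinset.1 hx
    have hgcd : Nat.gcd (α : ZMod n).val n = 1 := (ZMod.isUnit_iff_coprime _ _).1 (by
      rw [ZMod.natCast_zmod_val]; exact α.isUnit)
    refine le_trans (le_of_eq ?_) (h (α : ZMod n).val (ZMod.val_lt _) hgcd x hx)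
    rw [setKey_image α.isUnit, sum_image_natCast hl hln, listKey, List.map_map]
    refine congrArg _ (List.map_congr_left fun c _ => ?_)
    have key : (α : ZMod n) * c + β = (((α : ZMod n).val * (c + (n - x)) : ℕ) : ZMod n) := by
      rw [Nat.cast_mul, ZMod.natCast_zmod_val, Nat.cast_add, Nat.cast_sub (hln x hx).le,
        ZMod.natCast_self]
      linear_combination e
    rw [key, ZMod.val_natCast]
    rfl
  · have hlt : listKey n (residueList (affineImage (α : ZMod n) β
        (l.toFinset.image (Nat.cast : ℕ → ZMod n)))) < 2 ^ (n - 1) := by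
      refine listKey_lt (Finset.sortedLT_sort _).pairwise fun x hx => ?_
      rw [residueList, Finset.mem_sort, mem_image] at hx
      obtain ⟨y, hy, rfl⟩ := hx
      refine ⟨Nat.one_le_iff_ne_zero.2 fun h => hz ?_, ZMod.val_lt y⟩
      rwa [(ZMod.val_eq_zero y).1 h] at hy
    rw [listKey_residueList] at hlt
    refine hlt.le.trans ?_
    have : (2 : ℕ) ^ (n - 1 - 0) ∈ m.map fun x => 2 ^ (n - 1 - x) := List.mem_map_of_mem h0
    exact List.single_le_sum (fun _ _ => Nat.zero_le _) _ this

end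

section
variable {a w s : ℕ} {r : TableRow}

theorem RowCheck.isUnit (h : RowCheck a w s r) : IsUnit (r.scale : ZMod (a ^ 2 + 1)) :=
  (ZMod.isUnit_iff_coprime _ _).2 h.scale

theorem RowCheck.affineImage (h : RowCheck a w s r) (i : Fin 2) :
    affineImage (r.scale : ZMod (a ^ 2 + 1)) (r.shift : ZMod (a ^ 2 + 1))
      (r.symmetricPair (a ^ 2 + 1) i) = r.canonicalPair (a ^ 2 + 1) i := by
  fin_cases i
  · exact (image_symmetricImage _ _ _).symm.trans (congrArg _ h.first)
  · exact (image_symmetricImage _ _ _).symm.trans (congrArg _ h.second)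

theorem AlphaCheck.lt {p : Finset ℕ × Finset ℕ} (ha : 0 < a) (h : AlphaCheck a p) :
    (∀ c ∈ p.1, c < a ^ 2 + 1) ∧ ∀ c ∈ p.2, c < a ^ 2 + 1 := by
  obtain ⟨h1, h2, h3, -⟩ := h
  obtain ⟨l, hl⟩ := card_pos.1 (h2 ▸ ha)
  refine ⟨fun c hc => ?_, fun c hc => ?_⟩
  · have h4 : c ≤ p.1.sup id := le_sup (f := id) hc
    have := h3 l hl
    rw [pow_two]; omega
  · have := h3 c hc
    rw [pow_two]; omega

/-- The differences large minus small are 1, …, a², which are all nonzero residues modulo a² + 1. -/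
theorem RowCheck.canonicalPair_isSEDF (ha : 0 < a) (h : RowCheck a w s r) :
    IsSEDF (a ^ 2 + 1) 2 a 1 (r.canonicalPair (a ^ 2 + 1)) := by
  obtain ⟨hl1, hl2⟩ := h.alpha.lt ha
  obtain ⟨h1, h2, -, h4⟩ := h.alpha
  have hinj : ∀ S : Finset ℕ, (∀ c ∈ S, c < a ^ 2 + 1) →
      (S.image (Nat.cast : ℕ → ZMod (a ^ 2 + 1))).card = S.card := fun S hS => by
    refine card_image_of_injOn fun x hx y hy e => ?_
    rw [← ZMod.val_natCast_of_lt (hS x hx), ← ZMod.val_natCast_of_lt (hS y hy)]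
    exact congrArg _ e
  refine IsSEDF.of_cover rfl (fun i => ?_) fun g hg => ?_
  · fin_cases i
    · exact (hinj _ hl1).trans h1
    · exact (hinj _ hl2).trans h2
  · have hv : (-g).val ≠ 0 := fun e => hg (neg_eq_zero.1 ((ZMod.val_eq_zero _).1 e))
    have hv' := ZMod.val_lt (-g)
    obtain ⟨x, hx, hy⟩ := h4 ((-g).val - 1) (by rw [← pow_two]; omega)
    refine ⟨x, mem_image_of_mem _ hx, _, mem_image_of_mem _ hy, ?_⟩
    rw [Nat.sub_add_cancel (Nat.one_le_iff_ne_zero.2 hv), Nat.cast_add, ZMod.natCast_zmod_val]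
    ring

theorem RowCheck.isCanonical (ha : 0 < a) (h : RowCheck a w s r) :
    IsCanonical (r.canonicalPair (a ^ 2 + 1)) := by
  obtain ⟨hl1, hl2⟩ := h.alpha.lt ha
  obtain ⟨h1, h2, -, -⟩ := h.alpha
  have hl1 : ∀ c ∈ r.canonFirst, c < a ^ 2 + 1 := fun c hc => hl1 c (List.mem_toFinset.2 hc)
  have hl2 : ∀ c ∈ r.canonSecond, c < a ^ 2 + 1 := fun c hc => hl2 c (List.mem_toFinset.2 hc)
  have hlen : r.canonSecond.length = r.canonFirst.length := by
    rw [← List.toFinset_card_of_nodup h.nodup_first, ← List.toFinset_card_of_nodup h.nodup_second]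
    exact h2.trans h1.symm
  intro i α β
  fin_cases i
  · exact h.least_first.residueList_le h.nodup_first h.nodup_first hl1 hl1 h.zero rfl α β
  · exact h.least_second.residueList_le h.nodup_second h.nodup_first hl2 hl1 h.zero hlen α β

theorem RowCheck.blowup_isAlphaPair (ha : 0 < a) (h : RowCheck a w s r) :
    IsAlphaPair a a (blowupResult r.blowups) := by
  rcases h.blowup with e | ⟨e, -⟩
  · rw [e]; exact h.alpha.isAlphaPair ha
  · exact e.isAlphaPair ha

theorem RowCheck.affineEquivalent_blowup (h : RowCheck a w s r) :
    AffineEquivalent (r.canonicalPair (a ^ 2 + 1))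
      (reduceMod (a ^ 2 + 1) (blowupResult r.blowups)) := by
  rcases h.blowup with e | ⟨-, hw, h1, h2⟩
  · rw [e]
    exact ⟨1, 0, Or.inl fun i => by simp [_root_.affineImage, TableRow.canonicalPair]⟩
  · obtain ⟨α, hα⟩ := (ZMod.isUnit_iff_coprime w (a ^ 2 + 1)).2 hw
    refine ⟨α, s, Or.inr fun i => ?_⟩
    rw [hα]
    fin_cases i
    · exact image_mod_eq h1
    · exact image_mod_eq h2

theorem TableRow.neg_symmetricPair (r : TableRow) (n : ℕ) (i : Fin 2) :
    (r.symmetricPair n i).image (fun x => -x) = r.symmetricPair n i := by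
  have key : ∀ l : List ℕ, (l.toFinset.biUnion (orbitP n)).image (fun x => -x) =
      l.toFinset.biUnion (orbitP n) := fun l => by
    rw [biUnion_image]
    refine biUnion_congr rfl fun i _ => ?_
    rw [orbitP, image_insert, image_singleton, neg_neg, pair_comm]
  fin_cases i
  · exact key _
  · exact key _

end

/-- The classification follows from the verification of the rows and the classification of
near-factorizations. -/
theorem table_complete {a w s : ℕ} (ha : 0 < a) (hcl : Classified (a ^ 2 + 1) a (symmetricLists a))
    (hr : ∀ r ∈ sedfTable a, RowCheck a w s r)
    (hne : (sedfTable a).Pairwise fun r s => r.canonFirst.toFinset ≠ s.canonFirst.toFinset) :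
    (∀ r ∈ sedfTable a,
      IsSEDF (a ^ 2 + 1) 2 a 1 (r.symmetricPair (a ^ 2 + 1)) ∧
      (∀ i, (r.symmetricPair (a ^ 2 + 1) i).image (fun x => -x)
        = r.symmetricPair (a ^ 2 + 1) i) ∧
      IsUnit (r.scale : ZMod (a ^ 2 + 1)) ∧
      (∀ i, affineImage (r.scale : ZMod (a ^ 2 + 1)) (r.shift : ZMod (a ^ 2 + 1))
        (r.symmetricPair (a ^ 2 + 1) i) = r.canonicalPair (a ^ 2 + 1) i) ∧
      IsSEDF (a ^ 2 + 1) 2 a 1 (r.canonicalPair (a ^ 2 + 1)) ∧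
      IsCanonical (r.canonicalPair (a ^ 2 + 1)) ∧
      IsAlphaPair a a r.canonicalSets ∧
      (∀ ℓ ∈ r.blowups, 1 < ℓ) ∧
      IsAlphaPair a a (blowupResult r.blowups) ∧
      AffineEquivalent (r.canonicalPair (a ^ 2 + 1))
        (reduceMod (a ^ 2 + 1) (blowupResult r.blowups))) ∧
    (sedfTable a).Pairwise (fun r s =>
      ¬ AffineEquivalent (r.canonicalPair (a ^ 2 + 1)) (s.canonicalPair (a ^ 2 + 1))) ∧
    (∀ A : Fin 2 → Finset (ZMod (a ^ 2 + 1)), IsSEDF (a ^ 2 + 1) 2 a 1 A →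
      ∃ r ∈ sedfTable a, AffineEquivalent A (r.canonicalPair (a ^ 2 + 1)) ∧
        AffineEquivalent A (reduceMod (a ^ 2 + 1) (blowupResult r.blowups))) ∧
    (∀ A : Fin 2 → Finset (ZMod (a ^ 2 + 1)), IsSEDF (a ^ 2 + 1) 2 a 1 A →
      ∃ p : Finset ℕ × Finset ℕ, IsAlphaPair a a p ∧
        AffineEquivalent A (reduceMod (a ^ 2 + 1) p)) := by
  have hsym : ∀ r ∈ sedfTable a, IsSEDF (a ^ 2 + 1) 2 a 1 (r.symmetricPair (a ^ 2 + 1)) :=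
    fun r h => ((hr r h).canonicalPair_isSEDF ha).of_affineImage rfl (hr r h).isUnit
      (hr r h).affineImage
  have hex : ∀ A : Fin 2 → Finset (ZMod (a ^ 2 + 1)), IsSEDF (a ^ 2 + 1) 2 a 1 A →
      ∃ r ∈ sedfTable a, AffineEquivalent A (r.canonicalPair (a ^ 2 + 1)) ∧
        AffineEquivalent A (reduceMod (a ^ 2 + 1) (blowupResult r.blowups)) := by
    intro A hA
    obtain ⟨r, hr', h⟩ := hcl.exists_row rfl ha (fun r h => (hsym r h).card_eq) hA
    obtain ⟨α, hα⟩ := (hr r hr').isUnit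
    have h' : AffineEquivalent A (r.canonicalPair (a ^ 2 + 1)) := h.trans
      ⟨α, r.shift, Or.inl fun i => by rw [hα]; exact ((hr r hr').affineImage i).symm⟩
    exact ⟨r, hr', h', h'.trans (hr r hr').affineEquivalent_blowup⟩
  refine ⟨fun r h => ⟨hsym r h, r.neg_symmetricPair _, (hr r h).isUnit, (hr r h).affineImage,
    (hr r h).canonicalPair_isSEDF ha, (hr r h).isCanonical ha, (hr r h).alpha.isAlphaPair ha,
    (hr r h).blowups, (hr r h).blowup_isAlphaPair ha, (hr r h).affineEquivalent_blowup⟩, ?_, hex, ?_⟩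
  -- Equivalent canonical pairs have equal first sets, and the first sets of the rows are distinct.
  · refine hne.imp_of_mem fun {r t} h h' hrt he => hrt ?_
    have e := ((hr r h).isCanonical ha).eq_of_affineEquivalent ((hr t h').isCanonical ha) he
    have key : ∀ r ∈ sedfTable a,
        ((r.canonicalPair (a ^ 2 + 1)) 0).image ZMod.val = r.canonFirst.toFinset := by
      intro r h
      show (r.canonFirst.toFinset.image _).image ZMod.val = _
      rw [image_image]
      conv_rhs => rw [← image_id (s := r.canonFirst.toFinset)]
      exact image_congr fun c hc => ZMod.val_natCast_of_lt (((hr r h).alpha.lt ha).1 c hc)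
    rw [← key r h, ← key t h', e]
  · intro A hA
    obtain ⟨r, h, -, h'⟩ := hex A hA
    exact ⟨_, (hr r h).blowup_isAlphaPair ha, h'⟩

theorem image_toFinset_map (f : ℕ → ℕ) (l : List ℕ) :
    l.toFinset.image f = (l.map f).toFinset := by
  ext; simp

/-! ### Boolean tests for the rows -/

/-- The number whose binary digits are the indicator function of the list. -/
def maskOf (l : List ℕ) : ℕ :=
  List.rec 0 (fun c _ r => Nat.lor (Nat.shiftLeft 1 c) r) l

theorem testBit_maskOf (i : ℕ) : ∀ l : List ℕ, (maskOf l).testBit i = true ↔ i ∈ l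
  | [] => by simp [maskOf]
  | c :: l => by
    have h : maskOf (c :: l) = 1 <<< c ||| maskOf l := rfl
    rw [h, Nat.testBit_or, Bool.or_eq_true, testBit_maskOf i l, List.mem_cons, Nat.one_shiftLeft,
      Nat.testBit_two_pow, decide_eq_true_eq, eq_comm]

theorem maskOf_eq_iff {l m : List ℕ} : maskOf l = maskOf m ↔ l.toFinset = m.toFinset := by
  constructor
  · intro h
    ext i
    rw [List.mem_toFinset, List.mem_toFinset, ← testBit_maskOf, h, testBit_maskOf]
  · intro h
    refine Nat.eq_of_testBit_eq fun i => Bool.eq_iff_iff.2 ?_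
    rw [testBit_maskOf, testBit_maskOf, ← List.mem_toFinset, h, List.mem_toFinset]

/-- The key of the image of a list under `c ↦ u (c - x)`. -/
def imageKey (n u x : ℕ) (l : List ℕ) : ℕ :=
  List.rec 0 (fun c _ r => Nat.add (Nat.shiftLeft 1 (Nat.sub (Nat.sub n 1)
    (Nat.mod (Nat.mul u (Nat.add c (Nat.sub n x))) n))) r) l

theorem imageKey_eq (n u x : ℕ) : ∀ l : List ℕ,
    imageKey n u x l = listKey n (l.map fun c => u * (c + (n - x)) % n)
  | [] => rfl
  | c :: l => by
    have h : imageKey n u x (c :: l) =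
      1 <<< (n - 1 - u * (c + (n - x)) % n) + imageKey n u x l := rfl
    rw [h, imageKey_eq n u x l, Nat.one_shiftLeft]
    simp [listKey]

/-- With u = 1 and x = 0 the image key is the key of m itself, when its entries are below n. -/
noncomputable def leastTest (n : ℕ) (m l : List ℕ) : Bool :=
  forceNat (imageKey n 1 0 m) fun k => (List.range n).all fun u =>
    Nat.ble 2 (Nat.gcd u n) || l.all fun x => Nat.ble (imageKey n u x l) k

theorem LeastAmongImages.of_leastTest {n : ℕ} {m l : List ℕ} (hm : ∀ c ∈ m, c < n)
    (h : leastTest n m l = true) : LeastAmongImages n m l := by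
  intro u hu hg x hx
  rw [leastTest, forceNat_eq, List.all_eq_true] at h
  have h := h u (List.mem_range.2 hu)
  rw [Bool.or_eq_true, List.all_eq_true] at h
  rcases h with h | h
  · have := Nat.le_of_ble_eq_true h
    omega
  · have := Nat.le_of_ble_eq_true (h x hx)
    rw [imageKey_eq, imageKey_eq] at this
    refine this.trans (le_of_eq (congrArg _ ?_))
    conv_rhs => rw [← List.map_id m]
    refine List.map_congr_left fun c hc => ?_
    rw [one_mul, Nat.sub_zero, Nat.add_mod_right, Nat.mod_eq_of_lt (hm c hc), id]

def alphaTest (a : ℕ) (l m : List ℕ) : Bool :=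
  l.length == a && m.length == a && decide l.Nodup && decide m.Nodup &&
    (m.all fun d => Nat.blt (l.foldr max 0) d && Nat.ble d (a * a)) &&
    -- The right-hand side is the mask of {1, …, a²}. Truncation of the subtraction is harmless
    -- because only positive differences are used.
    maskOf (l.flatMap fun s => m.map fun t => Nat.sub t s) == 2 ^ (a * a + 1) - 2

theorem AlphaCheck.of_alphaTest {a : ℕ} {l m : List ℕ} (h : alphaTest a l m = true) :
    AlphaCheck a (l.toFinset, m.toFinset) := by
  simp only [alphaTest, Bool.and_eq_true, beq_iff_eq, decide_eq_true_eq, List.all_eq_true] at h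
  obtain ⟨⟨⟨⟨⟨h1, h2⟩, h3⟩, h4⟩, h5⟩, h6⟩ := h
  refine ⟨(List.toFinset_card_of_nodup h3).trans h1, (List.toFinset_card_of_nodup h4).trans h2,
    fun d hd => ?_, fun d hd => ?_⟩
  · obtain ⟨h7, h8⟩ := h5 d (List.mem_toFinset.1 hd)
    refine ⟨?_, Nat.le_of_ble_eq_true h8⟩
    refine lt_of_le_of_lt (le_of_eq ?_) (Nat.le_of_ble_eq_true h7)
    rw [← List.foldr_sup_eq_sup_toFinset]
    rfl
  · have h7 : (2 ^ (a * a + 1) - 2).testBit (d + 1) = true := by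
      have e : 2 ^ (a * a + 1) - 2 = 2 * (2 ^ (a * a) - 1) := by rw [pow_succ]; omega
      rw [e, Nat.testBit_succ, Nat.mul_div_cancel_left _ two_pos, Nat.testBit_two_pow_sub_one,
        decide_eq_true_eq]
      exact hd
    rw [← h6, testBit_maskOf, List.mem_flatMap] at h7
    obtain ⟨s, hs, h7⟩ := h7
    obtain ⟨t, ht, h7⟩ := List.mem_map.1 h7
    have h7 : t - s = d + 1 := h7
    refine ⟨s, List.mem_toFinset.2 hs, ?_⟩
    rw [← h7, Nat.add_sub_cancel' (by omega)]
    exact List.mem_toFinset.2 ht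

def symmetricImageList (n w s : ℕ) (l : List ℕ) : List ℕ :=
  l.flatMap fun i => [(w * i + s) % n, (w * (n - i % n) + s) % n]

theorem symmetricImageList_toFinset (n w s : ℕ) (l : List ℕ) :
    (symmetricImageList n w s l).toFinset = symmetricImage n w s l := by
  ext; simp [symmetricImageList, symmetricImage]

/-- The sets of labels obtained by blowups, as lists. -/
def blowupList : List ℕ → List ℕ × List ℕ → List ℕ × List ℕ
  | [], p => p
  | [k], p => (p.1.map (k * ·), p.2.flatMap fun i => (List.range k).map fun j => k * i - j)
  | k :: k' :: ks, p => blowupList ks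
    ((p.1.map (k * ·)).flatMap fun i => (List.range k').map fun j => k' * i + j,
      (p.2.flatMap fun i => (List.range k).map fun j => k * i - j).map (k' * ·))

theorem blowupII_toFinset (k : ℕ) (l m : List ℕ) : blowupII k (l.toFinset, m.toFinset) =
    ((l.map (k * ·)).toFinset,
      (m.flatMap fun i => (List.range k).map fun j => k * i - j).toFinset) := by
  refine Prod.ext ?_ ?_ <;> ext <;> simp [blowupII]

theorem blowupI_toFinset (k : ℕ) (l m : List ℕ) : blowupI k (l.toFinset, m.toFinset) =
    ((l.flatMap fun i => (List.range k).map fun j => k * i + j).toFinset,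
      (m.map (k * ·)).toFinset) := by
  refine Prod.ext ?_ ?_ <;> ext <;> simp [blowupI]

theorem blowupSequence_toFinset : ∀ (ks : List ℕ) (p : List ℕ × List ℕ),
    blowupSequence ks (p.1.toFinset, p.2.toFinset) =
      ((blowupList ks p).1.toFinset, (blowupList ks p).2.toFinset)
  | [], p => rfl
  | [k], p => blowupII_toFinset k p.1 p.2
  | k :: k' :: ks, p => by
    rw [blowupSequence, blowupII_toFinset, blowupI_toFinset]
    exact blowupSequence_toFinset ks (_, _)

theorem blowupResult_eq (ks : List ℕ) : blowupResult ks =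
    ((blowupList ks ([0], [1])).1.toFinset, (blowupList ks ([0], [1])).2.toFinset) :=
  blowupSequence_toFinset ks ([0], [1])

def blowupTest (a w s : ℕ) (r : TableRow) (p : List ℕ × List ℕ) : Bool :=
  (maskOf p.1 == maskOf r.canonFirst && maskOf p.2 == maskOf r.canonSecond) ||
    (alphaTest a p.1 p.2 && Nat.gcd w (a ^ 2 + 1) == 1 &&
      maskOf (r.canonSecond.map fun c => (w * c + s) % (a ^ 2 + 1)) ==
        maskOf (p.1.map (· % (a ^ 2 + 1))) &&
      maskOf (r.canonFirst.map fun c => (w * c + s) % (a ^ 2 + 1)) ==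
        maskOf (p.2.map (· % (a ^ 2 + 1))))

theorem BlowupCheck.of_blowupTest {a w s : ℕ} {r : TableRow}
    (h : blowupTest a w s r (blowupList r.blowups ([0], [1])) = true) : BlowupCheck a w s r := by
  simp only [blowupTest, Bool.or_eq_true, Bool.and_eq_true, beq_iff_eq, maskOf_eq_iff] at h
  rw [BlowupCheck, blowupResult_eq]
  rcases h with ⟨h1, h2⟩ | ⟨⟨⟨h1, h2⟩, h3⟩, h4⟩
  · exact Or.inl (Prod.ext h1 h2)
  · refine Or.inr ⟨.of_alphaTest h1, h2, ?_, ?_⟩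
    · simp only [TableRow.canonicalSets, image_toFinset_map]; exact h3
    · simp only [TableRow.canonicalSets, image_toFinset_map]; exact h4

noncomputable def rowTest (a w s : ℕ) (r : TableRow) : Bool :=
  Nat.gcd r.scale (a ^ 2 + 1) == 1 && alphaTest a r.canonFirst r.canonSecond &&
    maskOf (symmetricImageList (a ^ 2 + 1) r.scale r.shift r.symFirst) == maskOf r.canonFirst &&
    maskOf (symmetricImageList (a ^ 2 + 1) r.scale r.shift r.symSecond) == maskOf r.canonSecond &&
    Nat.testBit (maskOf r.canonFirst) 0 &&
    leastTest (a ^ 2 + 1) r.canonFirst r.canonFirst &&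
    leastTest (a ^ 2 + 1) r.canonFirst r.canonSecond &&
    r.blowups.all (Nat.blt 1) && blowupTest a w s r (blowupList r.blowups ([0], [1]))

theorem RowCheck.of_rowTest {a w s : ℕ} (ha : 0 < a) {r : TableRow} (h : rowTest a w s r = true) :
    RowCheck a w s r := by
  simp only [rowTest, Bool.and_eq_true, beq_iff_eq, maskOf_eq_iff, symmetricImageList_toFinset,
    List.all_eq_true, testBit_maskOf] at h
  obtain ⟨⟨⟨⟨⟨⟨⟨⟨h1, h2⟩, h3⟩, h4⟩, h5⟩, h6⟩, h7⟩, h8⟩, h9⟩ := h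
  have hα := AlphaCheck.of_alphaTest h2
  have hlt : ∀ c ∈ r.canonFirst, c < a ^ 2 + 1 :=
    fun c hc => (hα.lt ha).1 c (List.mem_toFinset.2 hc)
  simp only [alphaTest, Bool.and_eq_true, decide_eq_true_eq] at h2
  exact ⟨h1, hα, h3, h4, h5, h2.1.1.1.2, h2.1.1.2, .of_leastTest hlt h6, .of_leastTest hlt h7,
    fun l hl => Nat.le_of_ble_eq_true (h8 l hl), .of_blowupTest h9⟩

set_option maxHeartbeats 0 in
-- The map 4X + 20, with the sets interchanged, is needed only for the row with blowups (2, 2, 4,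
-- 4); all other blowup results are the canonical sets themselves.
theorem rowTest_table : ∀ a < 15, (sedfTable a).all (rowTest a 4 20) = true := by
  intro a ha
  interval_cases a
  all_goals decide +kernel

theorem canonFirst_pairwise_ne {a : ℕ} (ha : a < 15) :
    (sedfTable a).Pairwise fun r s => r.canonFirst.toFinset ≠ s.canonFirst.toFinset := by
  have key : ∀ a < 15,
    (sedfTable a).Pairwise fun r s => maskOf r.canonFirst ≠ maskOf s.canonFirst := by
    decide +kernel
  exact (key a ha).imp fun h e => h (maskOf_eq_iff.2 e)

theorem rowCheck_table {a : ℕ} (ha : 0 < a) (ha' : a < 15) :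
    ∀ r ∈ sedfTable a, RowCheck a 4 20 r := fun r hr =>
  .of_rowTest ha (List.all_eq_true.1 (rowTest_table a ha') r hr)

theorem mainTheorem10 (a : ℕ) (ha_pos : 1 ≤ a) (ha_le : a ≤ 14) :
    (∀ r ∈ sedfTable a,
      IsSEDF (a ^ 2 + 1) 2 a 1 (r.symmetricPair (a ^ 2 + 1)) ∧
      (∀ i, (r.symmetricPair (a ^ 2 + 1) i).image (fun x => -x)
        = r.symmetricPair (a ^ 2 + 1) i) ∧
      IsUnit (r.scale : ZMod (a ^ 2 + 1)) ∧
      (∀ i, affineImage (r.scale : ZMod (a ^ 2 + 1)) (r.shift : ZMod (a ^ 2 + 1))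
        (r.symmetricPair (a ^ 2 + 1) i) = r.canonicalPair (a ^ 2 + 1) i) ∧
      IsSEDF (a ^ 2 + 1) 2 a 1 (r.canonicalPair (a ^ 2 + 1)) ∧
      IsCanonical (r.canonicalPair (a ^ 2 + 1)) ∧
      IsAlphaPair a a r.canonicalSets ∧
      (∀ ℓ ∈ r.blowups, 1 < ℓ) ∧
      IsAlphaPair a a (blowupResult r.blowups) ∧
      AffineEquivalent (r.canonicalPair (a ^ 2 + 1))
        (reduceMod (a ^ 2 + 1) (blowupResult r.blowups))) ∧
    (sedfTable a).Pairwise (fun r s =>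
      ¬ AffineEquivalent (r.canonicalPair (a ^ 2 + 1)) (s.canonicalPair (a ^ 2 + 1))) ∧
    (∀ A : Fin 2 → Finset (ZMod (a ^ 2 + 1)), IsSEDF (a ^ 2 + 1) 2 a 1 A →
      ∃ r ∈ sedfTable a, AffineEquivalent A (r.canonicalPair (a ^ 2 + 1)) ∧
        AffineEquivalent A (reduceMod (a ^ 2 + 1) (blowupResult r.blowups))) ∧
    (∀ A : Fin 2 → Finset (ZMod (a ^ 2 + 1)), IsSEDF (a ^ 2 + 1) 2 a 1 A →
      ∃ p : Finset ℕ × Finset ℕ, IsAlphaPair a a p ∧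
        AffineEquivalent A (reduceMod (a ^ 2 + 1) p)) := by
  have hr := rowCheck_table ha_pos (Nat.lt_succ_of_le ha_le)
  have hne := canonFirst_pairwise_ne (Nat.lt_succ_of_le ha_le)
  refine table_complete ha_pos ?_ hr hne
  clear hr hne
  interval_cases a
  · exact classified_one
  · exact classified_two
  · exact classified_three
  · exact classified_four
  · exact classified_five
  · exact classified_six
  · exact classified_seven
  · exact classified_eight
  · exact classified_nine
  · exact classified_ten
  · exact classified_eleven
  · exact classified_twelve
  · exact classified_thirteen
  · exact classified_fourteen
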